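/- **Setting.** For every sample size $n\ge 1$ let $p=p(n)$, $r=r(n)\ge 1$ be integers, $\epsilon=\epsilon(n)>0$, $\delta=\delta(n)\in(0,1/e)$, $b_n>0$, and let $\theta_0=\theta_0(n)\in\mathbb R^{p}$ satisfy $\|\theta_0\|_2=1$; put $S_0=\{j:\theta_{0,j}\ne0\}$, $s_0=|S_0|$. Let $\sigma>0$ be fixed and let $\mathcal D$ be a fixed probability distribution supported on $[-b,b]$ with mean $0$ and variance $1$. Let $X,\widetilde X\in\mathbb R^{n\times p}$ have i.i.d. entries from $\mathcal D$, let $\xi\in\mathbb R^n$ have i.i.d. entries distributed as $\mathcal N(0,\sigma^2)$ conditioned on $[-b_n,b_n]$, and let $R\in\mathbb R^{r\times(n+2p+1)}$ have i.i.d. $\mathcal N(0,1/r)$ entries, all independent. Assume $b_n=O(\sigma\sqrt{\log n})$, $b_n/\sigma-\sqrt{2\log(2n)}\to\infty$, and $p(n),r(n)\to\infty$ as $n\to\infty$. Let $y=X\theta_0+\xi$ and $$B=\sqrt{2pb^2+(b\sqrt{s_0}+b_n)^2},\quad w^2=\tfrac{4B^2}{\epsilon}\Big(\sqrt{2r\log(4/\delta)}+\log(4/\delta)\Big),\quad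 [X^*\ \widetilde X^*\ y^*]=R\begin{bmatrix}X\ \ \widetilde X\ \ y\\ wI_{2p+1}\end{bmatrix}.$$ With $d=2p$ and a constant $C_\lambda>0$ put $$\rho_n^2=\tfrac{n+r+1}{nr}+\tfrac{w^2}{nr},\quad \phi_w=1+\tfrac{w^2}{n},\quad \lambda=C_\lambda\sigma\max\Big\{\sqrt{\tfrac{\log d}{n}},\sqrt{\tfrac{(\log d)^3}{r}}\Big\},\quad \kappa_n=2\lambda\sqrt{s_0}+\tfrac{w^2}{n}.$$ Let $\widehat\theta^*$ be a minimizer over $\theta\in\mathbb R^{2p}$ of $\frac1{2n}\|[X^*\ \widetilde X^*]\theta-y^*\|_2^2+\lambda\|\theta\|_1$, and $\widehat\theta^u=\widehat\theta^*+\frac1n[X^*\ \widetilde X^*]^\top(y^*-[X^*\ \widetilde X^*]\widehat\theta^*)+\frac{w^2}{n}\widehat\theta^*$. The *debiasing conditions* are, as $n\to\infty$, 1. $\frac{\kappa_n^2}{\lambda^2\phi_w}=o\Big(\sqrt{\tfrac{n}{\log d}}\,\min\big\{1,\sqrt{\tfrac rn},\tfrac{\sqrt{rn}}{w^2}\big\}\Big)$;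 2. $\sqrt{s_0}=O\left(\frac{\max\{1/\sqrt n,\ \log d/\sqrt r\}}{\max\{w\log d/\sqrt{nr},\ (w^2/n)\sqrt{\log d/r}\}}\right)$; 3. $\frac{\sqrt{s_0}}{\sigma\rho_n}=o\Big(\min\big\{\tfrac n{w^2}\sqrt{\tfrac r{\log d}},\tfrac{\sqrt{nr}}{w\log d}\big\}\Big)$; 4. $\frac1{\sigma\rho_n}\frac{4\kappa_n^2}{\lambda\phi_w}=o\Big(\min\big\{\sqrt{\tfrac n{\log d}},\sqrt{\tfrac r{\log d}},\tfrac n{w^2}\sqrt{\tfrac r{\log d}},\tfrac{\sqrt{nr}}{w\log d}\big\}\Big)$. Let $f:\mathbb R^2\to\mathbb R_{\ge0}$, $(x,a)\mapsto f(x;a)$, be such that for some $L>0$ and every $a\in\mathbb R$: $f(\cdot;a)$ is $L$-Lipschitz; $kf(x;a)=f(kx;ka)$ for all $k>0$ and all $x$; $f(\cdot;a)$ is even, and non-decreasing on $[0,\infty)$; and there are $c_a,c_x>0$ (possibly depending on $a$) with $f(x;a)\ge c_ax$ for $x\ge c_x$. Put $W_j=f(\widehat\theta^u_j;\sigma\rho_n)-f(\widehat\theta^u_{j+p};\sigma\rho_n)$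 for $1\le j\le p$. For $t\in\mathbb R\cup\{+\infty\}$ let $\widehat S(t)=\{j:W_j\ge t\}$, $$\mathrm{FDP}(t)=\frac{|\widehat S(t)\setminus S_0|}{|\widehat S(t)|\vee1},\quad \mathrm{Power}(t)=\frac{|\widehat S(t)\cap S_0|}{s_0},\quad \widehat{\mathrm{FDP}}(t)=\frac{1+|\{j:W_j\le-t\}|}{|\{j:W_j\ge t\}|\vee1}.$$ **Statement.** There is an absolute constant $C_\lambda>0$ such that the following holds in every such setting. Assume the debiasing conditions, $s_0(n)/p(n)\to c_0$ for some $c_0\in(0,1)$, and $|\theta_{0,j}|\ge\mu_n$ for all $j\in S_0$, where $\mu_n>0$ and $\mu_n/(\sigma\rho_n)\to\infty$. Then: 1. For every $q\in(0,1)$, the data-dependent threshold $\widehat t_n=\min\{t\in\mathcal W:\widehat{\mathrm{FDP}}(t)\le q\}$, where $\mathcal W=\{|W_j|:j\le p\}\setminus\{0\}$ and $\widehat t_n=+\infty$ if the set is empty, satisfies (a) $\mathbb E[\mathrm{FDP}(\widehat t_n)]\le q$ for every $n\ge1$, and (b) $\mathrm{Power}(\widehat t_n)\to1$ in probability as $n\to\infty$.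 2. For every deterministic real sequence $(t_n)$ with $t_n/(\sigma\rho_n)\to\infty$ and $t_n/\mu_n\to0$, $\mathrm{FDP}(t_n)\to0$ and $\mathrm{Power}(t_n)\to1$ in probability as $n\to\infty$. -/

import Mathlib

open MeasureTheory ProbabilityTheory Filter Asymptotics
open scoped Topology

noncomputable section

namespace JLKnockoff

/-! ### Privatization, private Lasso and its debiased version -/

/-- Johnson–Lindenstrauss transform: append `w` times the identity below the data matrix `A`
and multiply from the left by the random matrix `R`. -/
def jlt {ι κ ρ : Type*} [Fintype ι] [Fintype κ] [DecidableEq κ]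
    (R : Matrix ρ (ι ⊕ κ) ℝ) (A : Matrix ι κ ℝ) (w : ℝ) : Matrix ρ κ ℝ :=
  R * Matrix.fromRows A (w • (1 : Matrix κ κ ℝ))

/-- Response `y = X θ₀ + ξ` of the linear model. -/
def response {n p : ℕ} (X : Matrix (Fin n) (Fin p) ℝ) (θ₀ : Fin p → ℝ) (ξ : Fin n → ℝ) :
    Fin n → ℝ :=
  X.mulVec θ₀ + ξ

/-- The data matrix `A = [X X̃ y]`. Original features are indexed by `inl (inl j)`, knockoffs by
`inl (inr j)`, the response by `inr ()`. -/
def dataMatrix {n p : ℕ} (X Xt : Matrix (Fin n) (Fin p) ℝ) (y : Fin n → ℝ) :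
    Matrix (Fin n) ((Fin p ⊕ Fin p) ⊕ Unit) ℝ :=
  Matrix.fromCols (Matrix.fromCols X Xt) (Matrix.replicateCol Unit y)

/-- Lasso objective `(1/(2n)) ‖M θ - y‖₂² + lam ‖θ‖₁`. The normalization `n` is the original
sample size, not the number of rows of `M`. -/
def lassoObjective {ρ κ : Type*} [Fintype ρ] [Fintype κ] (n : ℕ) (lam : ℝ)
    (M : Matrix ρ κ ℝ) (y : ρ → ℝ) (θ : κ → ℝ) : ℝ :=
  1 / (2 * (n : ℝ)) * ∑ i, (M.mulVec θ i - y i) ^ 2 + lam * ∑ k, |θ k|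

/-- `θ` is a Lasso solution, i.e. a global minimizer of the Lasso objective. -/
def IsLassoSolution {ρ κ : Type*} [Fintype ρ] [Fintype κ] (n : ℕ) (lam : ℝ)
    (M : Matrix ρ κ ℝ) (y : ρ → ℝ) (θ : κ → ℝ) : Prop :=
  ∀ θ' : κ → ℝ, lassoObjective n lam M y θ ≤ lassoObjective n lam M y θ'

/-- Debiased private Lasso `θ + (1/n) Mᵀ (y - M θ) + (w²/n) θ`. -/
def debiased {ρ κ : Type*} [Fintype ρ] [Fintype κ] (n : ℕ) (w : ℝ)
    (M : Matrix ρ κ ℝ) (y : ρ → ℝ) (θ : κ → ℝ) : κ → ℝ :=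
  θ + (1 / (n : ℝ)) • M.transpose.mulVec (y - M.mulVec θ) + (w ^ 2 / (n : ℝ)) • θ

/-! ### Feature statistics, knockoff threshold, FDP and power -/

/-- Conditions on the function `f(x; a)` (written `f x a`) that generates feature statistics. -/
structure IsFeatureFunction (f : ℝ → ℝ → ℝ) : Prop where
  nonneg : ∀ x a, 0 ≤ f x a
  lipschitz : ∃ L : NNReal, 0 < L ∧ ∀ a, LipschitzWith L (fun x => f x a)
  homogeneous : ∀ k x a, 0 < k → k * f x a = f (k * x) (k * a)
  even : ∀ x a, f x a = f (-x) a
  monotone : ∀ a, MonotoneOn (fun x => f x a) (Set.Ici 0)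
  linear_growth : ∀ a, ∃ ca cx : ℝ, 0 < ca ∧ 0 < cx ∧ ∀ x, cx ≤ x → ca * x ≤ f x a

/-- `W_j = f(u_j; a) - f(u_{j+p}; a)`. -/
def featureStat {p : ℕ} (f : ℝ → ℝ → ℝ) (a : ℝ) (u : Fin p ⊕ Fin p → ℝ) (j : Fin p) : ℝ :=
  f (u (Sum.inl j)) a - f (u (Sum.inr j)) a

/-- Estimated false discovery proportion at the threshold `t`. -/
def fdpHat {p : ℕ} (W : Fin p → ℝ) (t : ℝ) : ℝ :=
  (1 + ((Finset.univ.filter fun j => W j ≤ -t).card : ℝ)) /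
    max 1 ((Finset.univ.filter fun j => t ≤ W j).card : ℝ)

/-- Data-dependent knockoff threshold: the least `t` among the nonzero values `|W_j|` with
`fdpHat W t ≤ q`, and `⊤` (that is, `+∞`) if there is none. -/
def knockoffThreshold {p : ℕ} (q : ℝ) (W : Fin p → ℝ) : WithTop ℝ :=
  ((Finset.univ.image fun j => |W j|).filter fun t => t ≠ 0 ∧ fdpHat W t ≤ q).min

open Classical in
/-- Features selected at the (possibly infinite) threshold `t`. -/
def selected {p : ℕ} (W : Fin p → ℝ) (t : WithTop ℝ) : Finset (Fin p) :=
  Finset.univ.filter fun j => t ≤ (W j : WithTop ℝ)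

/-- `S₀`, the set of indices of nonzero coefficients. -/
def supp {p : ℕ} (θ₀ : Fin p → ℝ) : Finset (Fin p) :=
  Finset.univ.filter fun j => θ₀ j ≠ 0

/-- False discovery proportion at threshold `t`. -/
def FDP {p : ℕ} (θ₀ : Fin p → ℝ) (W : Fin p → ℝ) (t : WithTop ℝ) : ℝ :=
  ((selected W t \ supp θ₀).card : ℝ) / max 1 ((selected W t).card : ℝ)

/-- Power at threshold `t`. -/
def power {p : ℕ} (θ₀ : Fin p → ℝ) (W : Fin p → ℝ) (t : WithTop ℝ) : ℝ :=
  ((selected W t ∩ supp θ₀).card : ℝ) / ((supp θ₀).card : ℝ)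

/-! ### The asymptotic setting -/

/-- Deterministic data of the problem; all sequences are indexed by the sample size `n`. -/
structure Setting where
  /-- noise level before truncation -/
  σ : ℝ
  /-- bound on the entries of the design -/
  b : ℝ
  /-- distribution of the entries of the design -/
  D : Measure ℝ
  /-- number of features -/
  p : ℕ → ℕ
  /-- number of rows of the projection matrix -/
  r : ℕ → ℕ
  /-- first privacy parameter -/
  ε : ℕ → ℝ
  /-- second privacy parameter -/
  δ : ℕ → ℝ
  /-- truncation level of the noise -/
  bn : ℕ → ℝ
  /-- true regression coefficients -/
  θ₀ : ∀ n, Fin (p n) → ℝ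

namespace Setting

variable (S : Setting)

/-- Sparsity level. -/
def s₀ (n : ℕ) : ℕ := (supp (S.θ₀ n)).card

/-- Number of columns of `[X X̃]`, as a real number. -/
def d (n : ℕ) : ℝ := 2 * (S.p n : ℝ)

/-- Bound on the `ℓ²` norm of the rows of `[X X̃ y]`. -/
def B (n : ℕ) : ℝ :=
  √(2 * (S.p n : ℝ) * S.b ^ 2 + (S.b * √(S.s₀ n : ℝ) + S.bn n) ^ 2)

/-- Privacy parameter `w`. -/
def w (n : ℕ) : ℝ :=
  √(4 * S.B n ^ 2 / S.ε n *
    (√(2 * (S.r n : ℝ) * Real.log (4 / S.δ n)) + Real.log (4 / S.δ n)))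

/-- `ρ_n`. -/
def ρ (n : ℕ) : ℝ :=
  √(((n : ℝ) + S.r n + 1) / (n * S.r n) + S.w n ^ 2 / (n * S.r n))

/-- Regularization parameter, with multiplicative constant `C`. -/
def lam (C : ℝ) (n : ℕ) : ℝ :=
  C * S.σ * max √(Real.log (S.d n) / n) √(Real.log (S.d n) ^ 3 / S.r n)

/-- `φ_w = 1 + w²/n`. -/
def φ (n : ℕ) : ℝ := 1 + S.w n ^ 2 / n

/-- `κ_n = 2 lam √s₀ + w²/n`. -/
def κ (C : ℝ) (n : ℕ) : ℝ := 2 * S.lam C n * √(S.s₀ n : ℝ) + S.w n ^ 2 / n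

/-- Law of a single noise variable: `N(0, σ²)` conditioned on `[-b_n, b_n]`. -/
def noiseLaw (n : ℕ) : Measure ℝ :=
  (gaussianReal 0 (Real.toNNReal (S.σ ^ 2)))[|Set.Icc (-S.bn n) (S.bn n)]

/-- Law of a single entry of the projection matrix: `N(0, 1/r)`. -/
def projLaw (n : ℕ) : Measure ℝ := gaussianReal 0 (1 / (S.r n : NNReal))

/-- Standing assumptions on the parameters of the model. -/
structure Standing : Prop where
  σ_pos : 0 < S.σ
  D_prob : IsProbabilityMeasure S.D
  D_bdd : ∀ᵐ x ∂S.D, |x| ≤ S.b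
  D_mean : ∫ x, x ∂S.D = 0
  D_var : variance id S.D = 1
  bn_pos : ∀ n, 0 < S.bn n
  bn_upper : S.bn =O[atTop] fun n => S.σ * √(Real.log n)
  bn_lower : Tendsto (fun n => S.bn n / S.σ - √(2 * Real.log (2 * n))) atTop atTop
  θ₀_norm : ∀ n, ∑ j, S.θ₀ n j ^ 2 = 1
  r_pos : ∀ n, 0 < S.r n
  ε_pos : ∀ n, 0 < S.ε n
  δ_pos : ∀ n, 0 < S.δ n
  δ_lt : ∀ n, S.δ n < Real.exp (-1)
  p_tendsto : Tendsto S.p atTop atTop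
  r_tendsto : Tendsto S.r atTop atTop

/-- The four growth conditions for debiasing, for a design with `d = 2p` columns. -/
structure Debiasing (C : ℝ) : Prop where
  compatibility :
    (fun n => S.κ C n ^ 2 / (S.lam C n ^ 2 * S.φ n)) =o[atTop] fun n =>
      √((n : ℝ) / Real.log (S.d n)) *
        min 1 (min √((S.r n : ℝ) / n) (√((S.r n : ℝ) * n) / S.w n ^ 2))
  regularization :
    (fun n => √(S.s₀ n : ℝ)) =O[atTop] fun n =>
      max (1 / √(n : ℝ)) (Real.log (S.d n) / √(S.r n : ℝ)) /
        max (S.w n * Real.log (S.d n) / √((n : ℝ) * S.r n))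
          (S.w n ^ 2 / n * √(Real.log (S.d n) / S.r n))
  sparsity :
    (fun n => 1 / (S.σ * S.ρ n) * √(S.s₀ n : ℝ)) =o[atTop] fun n =>
      min ((n : ℝ) / S.w n ^ 2 * √((S.r n : ℝ) / Real.log (S.d n)))
        (√((n : ℝ) * S.r n) / (S.w n * Real.log (S.d n)))
  error :
    (fun n => 1 / (S.σ * S.ρ n) * (4 * S.κ C n ^ 2 / (S.lam C n * S.φ n))) =o[atTop] fun n =>
      min (min √((n : ℝ) / Real.log (S.d n)) √((S.r n : ℝ) / Real.log (S.d n)))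
        (min ((n : ℝ) / S.w n ^ 2 * √((S.r n : ℝ) / Real.log (S.d n)))
          (√((n : ℝ) * S.r n) / (S.w n * Real.log (S.d n))))

end Setting

/-- The random objects at sample size `n`: design, knockoffs, noise, projection matrix and
private Lasso estimate. -/
structure Sample (S : Setting) (n : ℕ) (Ω : Type*) where
  X : Ω → Matrix (Fin n) (Fin (S.p n)) ℝ
  Xt : Ω → Matrix (Fin n) (Fin (S.p n)) ℝ
  ξ : Ω → Fin n → ℝ
  R : Ω → Matrix (Fin (S.r n)) (Fin n ⊕ ((Fin (S.p n) ⊕ Fin (S.p n)) ⊕ Unit)) ℝ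
  θhat : Ω → Fin (S.p n) ⊕ Fin (S.p n) → ℝ

namespace Sample

variable {S : Setting} {n : ℕ} {Ω : Type*} (T : Sample S n Ω)

/-- All scalar random inputs of the procedure as one family: the entries of `[X X̃]`, of `ξ` and
of `R`. -/
def entries :
    (Fin n × (Fin (S.p n) ⊕ Fin (S.p n))) ⊕ Fin n ⊕
      (Fin (S.r n) × (Fin n ⊕ ((Fin (S.p n) ⊕ Fin (S.p n)) ⊕ Unit))) → Ω → ℝ
  | Sum.inl (i, k) => fun ω => Matrix.fromCols (T.X ω) (T.Xt ω) i k
  | Sum.inr (Sum.inl i) => fun ω => T.ξ ω i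
  | Sum.inr (Sum.inr (i, k)) => fun ω => T.R ω i k

/-- The privatized data matrix `A* = [X* X̃* y*]`. -/
def Astar (ω : Ω) : Matrix (Fin (S.r n)) ((Fin (S.p n) ⊕ Fin (S.p n)) ⊕ Unit) ℝ :=
  jlt (T.R ω) (dataMatrix (T.X ω) (T.Xt ω) (response (T.X ω) (S.θ₀ n) (T.ξ ω))) (S.w n)

/-- `[X* X̃*]`. -/
def Xstar (ω : Ω) : Matrix (Fin (S.r n)) (Fin (S.p n) ⊕ Fin (S.p n)) ℝ :=
  (T.Astar ω).toCols₁

/-- `y*`. -/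
def ystar (ω : Ω) : Fin (S.r n) → ℝ := fun i => T.Astar ω i (Sum.inr ())

/-- The random objects have the laws of the model, are jointly independent, and `θhat` is
(a measurable version of) the private Lasso estimate with regularization constant `C`. -/
structure IsModel [MeasurableSpace Ω] (C : ℝ) (P : Measure Ω) : Prop where
  indep : iIndepFun T.entries P
  law_X : ∀ i j, HasLaw (fun ω => T.X ω i j) S.D P
  law_Xt : ∀ i j, HasLaw (fun ω => T.Xt ω i j) S.D P
  law_ξ : ∀ i, HasLaw (fun ω => T.ξ ω i) (S.noiseLaw n) P
  law_R : ∀ i k, HasLaw (fun ω => T.R ω i k) (S.projLaw n) P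
  θhat_measurable : Measurable T.θhat
  θhat_lasso : ∀ᵐ ω ∂P, IsLassoSolution n (S.lam C n) (T.Xstar ω) (T.ystar ω) (T.θhat ω)

/-- Feature statistics `W_j` built from the debiased private Lasso, with scale `a = σ ρ_n`. -/
def W (f : ℝ → ℝ → ℝ) (ω : Ω) : Fin (S.p n) → ℝ :=
  featureStat f (S.σ * S.ρ n) (debiased n (S.w n) (T.Xstar ω) (T.ystar ω) (T.θhat ω))

end Sample

/-- Convergence in probability to a constant, for random variables that may live on different
probability spaces. -/
def TendstoInProb {Ω : ℕ → Type*} [∀ n, MeasurableSpace (Ω n)] (P : ∀ n, Measure (Ω n))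
    (Y : ∀ n, Ω n → ℝ) (c : ℝ) : Prop :=
  ∀ η : ℝ, 0 < η → Tendsto (fun n => P n {ω | η ≤ |Y n ω - c|}) atTop (𝓝 0)

end JLKnockoff

end

/-!
The privatized design is almost surely in general position, so the Lasso estimate is almost surely
unique and hence a function of the data. Exchanging a null feature with its knockoff preserves the
law of the data, so it flips the sign of the null statistic `W j` without changing the joint law of
`W`. Averaging the false discovery proportion over these flips, one null at a time, gives FDR
control: the ratio of the nulls above the threshold to one plus the nulls below minus the threshold
becomes a sum that is at most one.

For the asymptotics no uniform control of the coordinates is needed. The error of the debiased Lasso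
is a noise term plus the error of the Gram matrix applied to the error of the Lasso; the entries of
both have second moments of the right order, so the error is of order `√p σ ρ` in the Euclidean
norm. By Chebyshev's counting inequality, a threshold of larger order than `σ ρ` and smaller order
than `μ` therefore separates all but a vanishing fraction of the features, while the signals make up
a positive fraction. Applied to an intermediate deterministic threshold, this shows that its
estimated FDP is eventually at most `q`, and the data-dependent threshold selects at least as much.
-/

noncomputable section

namespace JLKnockoff

open scoped Matrix

/-! ### Zero sets of polynomials and general position -/

section Polynomial

variable {R : Type*} [CommRing R] [MeasurableSpace R] [MeasurableAdd₂ R] [MeasurableMul₂ R]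

theorem measurable_mvPolynomial_eval {τ : Type*} [Finite τ] (q : MvPolynomial τ R) :
    Measurable fun x : τ → R => MvPolynomial.eval x q := by
  have := Fintype.ofFinite τ
  simp only [MvPolynomial.eval_eq']
  fun_prop

variable [IsDomain R] [MeasurableSingletonClass R]

theorem ae_eval_ne_zero_fin {n : ℕ} (ν : Fin n → Measure R) [∀ i, SigmaFinite (ν i)]
    [∀ i, NullSingletonClass (ν i)] {q : MvPolynomial (Fin n) R} (hq : q ≠ 0) :
    ∀ᵐ x ∂(Measure.pi ν), MvPolynomial.eval x q ≠ 0 := by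
  induction n with
  | zero =>
    refine ae_of_all _ fun x hx => hq ?_
    obtain ⟨c, rfl⟩ := MvPolynomial.C_surjective (R := R) (Fin 0) q
    rw [MvPolynomial.eval_C] at hx
    rw [hx, map_zero]
  | succ n ih =>
    let Q := MvPolynomial.finSuccEquiv R n q
    have hQ : Q ≠ 0 := (map_ne_zero_iff _ (MvPolynomial.finSuccEquiv R n).injective).2 hq
    have hmeas : MeasurableSet {z : R × (Fin n → R) |
        MvPolynomial.eval (Fin.cons z.1 z.2 : Fin (n + 1) → R) q ≠ 0} := by
      refine (measurableSet_singleton (0 : R)).compl.preimage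
        ((measurable_mvPolynomial_eval q).comp (measurable_pi_lambda _ (Fin.cases ?_ fun j => ?_)))
      · simpa only [Fin.cons_zero] using measurable_fst
      · simp only [Fin.cons_succ]; fun_prop
    have hprod : ∀ᵐ z ∂((ν 0).prod (Measure.pi fun i : Fin n => ν i.succ)),
        MvPolynomial.eval (Fin.cons z.1 z.2 : Fin (n + 1) → R) q ≠ 0 := by
      rw [Measure.ae_prod_iff_ae_ae hmeas, Measure.ae_ae_comm hmeas]
      filter_upwards [ih (fun i => ν i.succ) (Polynomial.leadingCoeff_ne_zero.2 hQ)] with x hx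
      have hmap : Polynomial.map (MvPolynomial.eval x) Q ≠ 0 := fun h0 => hx <| by
        simpa using congrArg (Polynomial.coeff · Q.natDegree) h0
      refine measure_mono_null (fun y hy => ?_)
        ((Polynomial.finite_setOfPred_isRoot hmap).measure_zero (ν 0))
      simpa [MvPolynomial.eval_eq_eval_mv_eval', Polynomial.IsRoot, Q] using hy
    filter_upwards [(measurePreserving_piFinSuccAbove ν 0).quasiMeasurePreserving.ae hprod]
      with x hx
    have hcons : (Fin.cons (x 0) fun j => x j.succ : Fin (n + 1) → R) = x := Fin.cons_self_tail x
    simpa [MeasurableEquiv.piFinSuccAbove, Fin.insertNthEquiv, Fin.removeNth, hcons] using hx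

theorem ae_eval_ne_zero {τ : Type*} [Fintype τ] (ν : τ → Measure R) [∀ i, SigmaFinite (ν i)]
    [∀ i, NullSingletonClass (ν i)] {q : MvPolynomial τ R} (hq : q ≠ 0) :
    ∀ᵐ x ∂(Measure.pi ν), MvPolynomial.eval x q ≠ 0 := by
  let e := (Fintype.equivFin τ).symm
  have hrename : MvPolynomial.rename e.symm q ≠ 0 :=
    (map_ne_zero_iff _ (MvPolynomial.rename_injective _ e.symm.injective)).2 hq
  have hpi := (measurePreserving_piCongrLeft ν e).symm
  filter_upwards [hpi.quasiMeasurePreserving.ae (ae_eval_ne_zero_fin (fun i => ν (e i)) hrename)]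
    with x hx
  have hcomp : (MeasurableEquiv.piCongrLeft (fun _ => R) e).symm x ∘ e.symm = x := by
    ext i
    simp [MeasurableEquiv.piCongrLeft, Equiv.piCongrLeft]
  rwa [MvPolynomial.eval_rename, hcomp] at hx

end Polynomial

theorem det_transpose_mul_self_ne_zero_iff {ι κ 𝕜 : Type*} [Fintype ι] [Fintype κ] [DecidableEq κ]
    [Field 𝕜] [LinearOrder 𝕜] [IsStrictOrderedRing 𝕜] (A : Matrix ι κ 𝕜) :
    (Aᵀ * A).det ≠ 0 ↔ LinearIndependent 𝕜 A.col := by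
  rw [← isUnit_iff_ne_zero, ← Matrix.isUnit_iff_isUnit_det, ← Matrix.mulVec_injective_iff_isUnit,
    ← Matrix.mulVec_injective_iff, ← Matrix.coe_mulVecLin, ← Matrix.coe_mulVecLin,
    ← LinearMap.ker_eq_bot, ← LinearMap.ker_eq_bot, Matrix.ker_mulVecLin_transpose_mul_self]

theorem ae_linearIndependent_col_of_exists {τ ι κ : Type*} [Fintype τ] [Finite ι] [Finite κ]
    (ν : τ → Measure ℝ) [∀ i, SigmaFinite (ν i)] [∀ i, NullSingletonClass (ν i)]
    (N : Matrix ι κ (MvPolynomial τ ℝ))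
    (hN : ∃ x, LinearIndependent ℝ (N.map (MvPolynomial.eval x)).col) :
    ∀ᵐ x ∂(Measure.pi ν), LinearIndependent ℝ (N.map (MvPolynomial.eval x)).col := by
  classical
  have := Fintype.ofFinite ι
  have := Fintype.ofFinite κ
  have heval (x : τ → ℝ) : MvPolynomial.eval x (Nᵀ * N).det ≠ 0 ↔
      LinearIndependent ℝ (N.map (MvPolynomial.eval x)).col := by
    rw [← det_transpose_mul_self_ne_zero_iff, RingHom.map_det, RingHom.mapMatrix_apply,
      Matrix.map_mul, Matrix.transpose_map]
  obtain ⟨x₀, hx₀⟩ := hN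
  have hdet : (Nᵀ * N).det ≠ 0 := fun h0 => (heval x₀).2 hx₀ (by rw [h0, map_zero])
  filter_upwards [ae_eval_ne_zero ν hdet] with x hx using (heval x).1 hx

section GeneralPosition

variable {ρ κ : Type*}

/-- The design `M` with an additional row of signs. A common fit of two Lasso solutions annihilates
this row as well, which is why general position is required of the augmented columns. -/
def augment (M : Matrix ρ κ ℝ) (s : κ → ℤˣ) : Matrix (ρ ⊕ Unit) κ ℝ :=
  Matrix.fromRows M (Matrix.replicateRow Unit fun j => ((s j : ℤ) : ℝ))

/-- A design is in general position if, for all signs, any `|ρ| + 1` of its augmented columns are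
linearly independent. This is the condition under which the Lasso has a unique solution. -/
def GeneralPosition [Fintype ρ] (M : Matrix ρ κ ℝ) : Prop :=
  ∀ (s : κ → ℤˣ) (F : Finset κ), F.card ≤ Fintype.card ρ + 1 → LinearIndepOn ℝ (augment M s).col F

theorem continuous_augment (s : κ → ℤˣ) : Continuous fun M : Matrix ρ κ ℝ => augment M s := by
  refine continuous_matrix fun i j => ?_
  rcases i with i | i
  · simp only [augment, Matrix.fromRows_apply_inl]; fun_prop
  · simp only [augment, Matrix.fromRows_apply_inr]; fun_prop

variable [Fintype ρ]

theorem isOpen_generalPosition [Finite κ] : IsOpen {M : Matrix ρ κ ℝ | GeneralPosition M} := by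
  simp only [GeneralPosition, Set.ofPred_forall]
  refine isOpen_iInter_of_finite fun s => isOpen_iInter_of_finite fun F =>
    isOpen_iInter_of_finite fun _ => ?_
  have hcont : Continuous fun (M : Matrix ρ κ ℝ) (j : F) => (augment M s).col j :=
    continuous_pi fun j => continuous_pi fun i => (continuous_augment s).matrix_elem i j
  exact isOpen_setOfPred_linearIndependent.preimage hcont

theorem exists_linearIndepOn_augment (s : κ → ℤˣ) (F : Finset κ)
    (hF : F.card ≤ Fintype.card ρ + 1) :
    ∃ M : Matrix ρ κ ℝ, LinearIndepOn ℝ (augment M s).col F := by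
  classical
  obtain ⟨e⟩ : Nonempty (F ↪ ρ ⊕ Unit) :=
    Function.Embedding.nonempty_of_card_le (by simpa using hF)
  let M : Matrix ρ κ ℝ := Matrix.of fun i j =>
    if h : j ∈ F then if e ⟨j, h⟩ = Sum.inl i then 1 else 0 else 0
  refine ⟨M, Fintype.linearIndependent_iff.2 fun c hc => ?_⟩
  have hrow (i : ρ) : ∑ j : F, c j * (if e j = Sum.inl i then 1 else 0) = 0 := by
    simpa [augment, M] using congrFun hc (Sum.inl i)
  have hsign : ∑ j : F, c j * ((s j : ℤ) : ℝ) = 0 := by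
    simpa [augment] using congrFun hc (Sum.inr ())
  have hinl {j : F} {i : ρ} (hj : e j = Sum.inl i) : c j = 0 := by
    have hi := hrow i
    simp only [← hj, e.injective.eq_iff] at hi
    simpa using hi
  intro j
  rcases hj : e j with i | ⟨⟩
  · exact hinl hj
  · have hothers (k : F) (hk : k ≠ j) : c k * ((s k : ℤ) : ℝ) = 0 := by
      rcases hk' : e k with i | ⟨⟩
      · rw [hinl hk', zero_mul]
      · exact absurd (e.injective (hk'.trans hj.symm)) hk
    have hj0 := (Fintype.sum_eq_single j hothers).symm.trans hsign
    simpa using hj0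

theorem ae_generalPosition_mul [Finite κ] [DecidableEq κ] {N : Type*} [Fintype N]
    (ν : ρ × N → Measure ℝ) [∀ q, SigmaFinite (ν q)] [∀ q, NullSingletonClass (ν q)]
    {A : Matrix N κ ℝ} {L : Matrix κ N ℝ} (hL : L * A = 1) :
    ∀ᵐ x ∂(Measure.pi ν), GeneralPosition (Matrix.of (fun i k => x (i, k)) * A) := by
  have := Fintype.ofFinite κ
  simp only [GeneralPosition, ae_all_iff]
  intro s F hF
  let Mpoly : Matrix (ρ ⊕ Unit) F (MvPolynomial (ρ × N) ℝ) := Matrix.of fun i j =>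
    Sum.elim (fun a => ∑ k, MvPolynomial.X (a, k) * MvPolynomial.C (A k j))
      (fun _ => MvPolynomial.C ((s j : ℤ) : ℝ)) i
  have heval (x : ρ × N → ℝ) : (Mpoly.map (MvPolynomial.eval x)).col =
      fun j : F => (augment (Matrix.of (fun i k => x (i, k)) * A) s).col j := by
    ext j (i | i)
    · simp [Mpoly, augment, Matrix.mul_apply]
    · simp [Mpoly, augment]
  obtain ⟨M, hM⟩ := exists_linearIndepOn_augment s F hF
  have hfactor : Matrix.of (fun i k => (M * L) i k) * A = M := by
    rw [show Matrix.of (fun i k => (M * L) i k) = M * L from rfl, Matrix.mul_assoc, hL,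
      Matrix.mul_one]
  have hae := ae_linearIndependent_col_of_exists ν Mpoly
    ⟨fun q => (M * L) q.1 q.2, by rw [heval]; simp only [hfactor]; exact hM⟩
  filter_upwards [hae] with x hx
  rwa [heval] at hx

end GeneralPosition

/-! ### Uniqueness of the Lasso solution -/

theorem card_lt_of_linearIndependent_of_dotProduct_eq_zero {ι F : Type*} [Fintype ι] [Fintype F]
    {v : F → ι → ℝ} (hv : LinearIndependent ℝ v) {x : ι → ℝ} (hx : x ≠ 0)
    (horth : ∀ j, v j ⬝ᵥ x = 0) : Fintype.card F < Fintype.card ι := by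
  refine lt_of_le_of_ne (by simpa using hv.fintype_card_le_finrank) fun hcard => hx ?_
  have hspan : x ∈ Submodule.span ℝ (Set.range v) := by
    rw [hv.span_eq_top_of_card_eq_finrank' (by simpa using hcard)]
    exact Submodule.mem_top
  refine dotProduct_self_eq_zero.1 (Submodule.span_induction (p := fun z _ => z ⬝ᵥ x = 0)
    ?_ (zero_dotProduct x) ?_ ?_ hspan)
  · rintro _ ⟨j, rfl⟩
    exact horth j
  · intro a b _ _ ha hb
    rw [add_dotProduct, ha, hb, add_zero]
  · intro c a _ ha
    rw [smul_dotProduct, ha, smul_zero]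

theorem GeneralPosition.card_le_of_dotProduct_eq_zero {ρ κ : Type*} [Fintype ρ]
    {M : Matrix ρ κ ℝ} (hM : GeneralPosition M) {s : κ → ℤˣ} {x : ρ ⊕ Unit → ℝ} (hx : x ≠ 0)
    {E : Finset κ} (horth : ∀ j ∈ E, (augment M s).col j ⬝ᵥ x = 0) :
    E.card ≤ Fintype.card ρ + 1 := by
  by_contra! hlt
  obtain ⟨F, hFE, hF⟩ := Finset.exists_subset_card_eq hlt.le
  have := card_lt_of_linearIndependent_of_dotProduct_eq_zero (hM s F hF.le) hx
    fun j => horth j (hFE j.2)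
  simp [hF] at this

/-- The augmented columns in the support of `v` are orthogonal to `(u, -1)`, so there are too few
of them to be dependent, while `v` is a linear relation between them. -/
theorem GeneralPosition.eq_zero_of_mulVec_eq_zero {ρ κ : Type*} [Fintype ρ] [Fintype κ]
    {M : Matrix ρ κ ℝ} (hM : GeneralPosition M) {u : ρ → ℝ} {v : κ → ℝ} (hv : M *ᵥ v = 0)
    (hu : ∀ j, v j ≠ 0 → |M.col j ⬝ᵥ u| = 1) : v = 0 := by
  classical
  let E : Finset κ := Finset.univ.filter fun j => v j ≠ 0
  have hsign (j : κ) : ∃ s : ℤˣ, v j ≠ 0 → M.col j ⬝ᵥ u = ((s : ℤ) : ℝ) := by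
    by_cases hj : v j = 0
    · exact ⟨1, fun h => absurd hj h⟩
    · rcases eq_or_eq_neg_of_abs_eq (hu j hj) with h | h
      · exact ⟨1, fun _ => by simp [h]⟩
      · exact ⟨-1, fun _ => by simp [h]⟩
  choose s hs using hsign
  have horth (j : κ) (hj : j ∈ E) : (augment M s).col j ⬝ᵥ Sum.elim u (fun _ => -1) = 0 := by
    have hj' := hs j (Finset.mem_filter.1 hj).2
    simp only [dotProduct, Matrix.col_apply] at hj'
    simp [dotProduct, augment, hj']
  have hcard : E.card ≤ Fintype.card ρ + 1 :=
    hM.card_le_of_dotProduct_eq_zero (fun h => by simpa using congrFun h (Sum.inr ())) horth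
  have hrelation : ∑ j ∈ E, v j • (augment M s).col j = 0 := by
    have hsupport : ∑ j ∈ E, v j • (augment M s).col j = ∑ j, v j • (augment M s).col j :=
      Finset.sum_subset (Finset.subset_univ E) fun j _ hj => by
        rw [show v j = 0 by simpa [E] using hj, zero_smul]
    have hrows (i : ρ) : ∑ j, v j * M i j = 0 := by
      simpa [Matrix.mulVec, dotProduct, mul_comm] using congrFun hv i
    ext (i | i)
    · rw [hsupport]
      simpa [augment] using hrows i
    · calc (∑ j ∈ E, v j • (augment M s).col j) (Sum.inr i)
          = ∑ j ∈ E, v j * (M.col j ⬝ᵥ u) := by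
            simp only [Finset.sum_apply, Pi.smul_apply, smul_eq_mul]
            exact Finset.sum_congr rfl fun j hj => by
              rw [hs j (Finset.mem_filter.1 hj).2]; simp [augment]
        _ = ∑ j, v j * (M.col j ⬝ᵥ u) := Finset.sum_subset (Finset.subset_univ E) fun j _ hj => by
            rw [show v j = 0 by simpa [E] using hj, zero_mul]
        _ = ∑ i, (∑ j, v j * M i j) * u i := by
            simp only [dotProduct, Matrix.col_apply, Finset.mul_sum, Finset.sum_mul, mul_assoc]
            exact Finset.sum_comm
        _ = 0 := by simp [hrows]
  ext j
  by_contra hj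
  exact hj (linearIndepOn_finset_iff.1 (hM s E hcard) v hrelation j (by simpa [E] using hj))

section Lasso

variable {ρ κ : Type*} [Fintype ρ] [Fintype κ] {n : ℕ} {lam : ℝ} {M : Matrix ρ κ ℝ} {y : ρ → ℝ}

theorem lassoObjective_add (n : ℕ) (lam : ℝ) (M : Matrix ρ κ ℝ) (y : ρ → ℝ) (θ v : κ → ℝ) :
    lassoObjective n lam M y (θ + v) = lassoObjective n lam M y θ
      + 1 / (2 * (n : ℝ)) * ∑ i, (M *ᵥ v) i ^ 2 - 1 / (n : ℝ) * (M *ᵥ v ⬝ᵥ (y - M *ᵥ θ))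
      + lam * ∑ k, (|θ k + v k| - |θ k|) := by
  have hsq : ∑ i, ((M *ᵥ (θ + v)) i - y i) ^ 2 = ∑ i, ((M *ᵥ θ) i - y i) ^ 2
      + ∑ i, (M *ᵥ v) i ^ 2 - 2 * (M *ᵥ v ⬝ᵥ (y - M *ᵥ θ)) := by
    rw [dotProduct, Finset.mul_sum, ← Finset.sum_add_distrib, ← Finset.sum_sub_distrib]
    refine Finset.sum_congr rfl fun i _ => ?_
    simp only [Matrix.mulVec_add, Pi.add_apply, Pi.sub_apply]
    ring
  simp only [lassoObjective, hsq, Finset.sum_sub_distrib, Pi.add_apply]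
  ring

theorem lassoObjective_midpoint_le (n : ℕ) (hlam : 0 ≤ lam) (M : Matrix ρ κ ℝ) (y : ρ → ℝ)
    (θ θ' : κ → ℝ) :
    lassoObjective n lam M y ((1 / 2 : ℝ) • (θ + θ'))
        + 1 / (8 * (n : ℝ)) * ∑ i, (M *ᵥ θ - M *ᵥ θ') i ^ 2
      ≤ (lassoObjective n lam M y θ + lassoObjective n lam M y θ') / 2 := by
  have hsq : ∑ i, ((M *ᵥ ((1 / 2 : ℝ) • (θ + θ'))) i - y i) ^ 2
      = (∑ i, ((M *ᵥ θ) i - y i) ^ 2 + ∑ i, ((M *ᵥ θ') i - y i) ^ 2) / 2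
        - (∑ i, (M *ᵥ θ - M *ᵥ θ') i ^ 2) / 4 := by
    simp only [← Finset.sum_add_distrib, Finset.sum_div, ← Finset.sum_sub_distrib]
    refine Finset.sum_congr rfl fun i _ => ?_
    simp only [Matrix.mulVec_smul, Matrix.mulVec_add, Pi.smul_apply, Pi.add_apply, Pi.sub_apply,
      smul_eq_mul]
    ring
  have habs : ∑ k, |((1 / 2 : ℝ) • (θ + θ')) k| ≤ (∑ k, |θ k| + ∑ k, |θ' k|) / 2 := by
    rw [← Finset.sum_add_distrib, Finset.sum_div]
    refine Finset.sum_le_sum fun k _ => ?_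
    rw [Pi.smul_apply, Pi.add_apply, smul_eq_mul, abs_mul, abs_of_pos one_half_pos]
    linarith [abs_add_le (θ k) (θ' k)]
  have hpenalty := mul_le_mul_of_nonneg_left habs hlam
  simp only [lassoObjective, hsq]
  rw [show 1 / (8 * (n : ℝ)) = 1 / (2 * (n : ℝ)) / 4 by ring]
  linarith

theorem IsLassoSolution.mulVec_eq (hn : 0 < n) (hlam : 0 ≤ lam) {θ θ' : κ → ℝ}
    (h : IsLassoSolution n lam M y θ) (h' : IsLassoSolution n lam M y θ') :
    M *ᵥ θ = M *ᵥ θ' := by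
  have hsum : ∑ i, (M *ᵥ θ - M *ᵥ θ') i ^ 2 ≤ 0 := by
    have hle : 1 / (8 * (n : ℝ)) * ∑ i, (M *ᵥ θ - M *ᵥ θ') i ^ 2 ≤ 0 := by
      linarith [lassoObjective_midpoint_le n hlam M y θ θ', h ((1 / 2 : ℝ) • (θ + θ')),
        h' ((1 / 2 : ℝ) • (θ + θ'))]
    exact nonpos_of_mul_nonpos_right hle (by positivity)
  have hzero := (Finset.sum_eq_zero_iff_of_nonneg fun i _ => sq_nonneg _).1
    (hsum.antisymm (Finset.sum_nonneg fun i _ => sq_nonneg ((M *ᵥ θ - M *ᵥ θ') i)))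
  ext i
  exact sub_eq_zero.1 (pow_eq_zero_iff two_ne_zero |>.1 (hzero i (Finset.mem_univ i)))

theorem eq_zero_of_eventually_nonneg {c A : ℝ} (h : ∀ᶠ t in 𝓝 (0 : ℝ), 0 ≤ t * c + t ^ 2 * A) :
    c = 0 := by
  have hmin : IsLocalMin (fun t : ℝ => t * c + t ^ 2 * A) 0 := by
    filter_upwards [h] with t ht
    simpa using ht
  have hderiv : HasDerivAt (fun t : ℝ => t * c + t ^ 2 * A) c 0 := by
    convert! ((hasDerivAt_id (0 : ℝ)).mul_const c).add
      (((hasDerivAt_id (0 : ℝ)).pow 2).mul_const A) using 1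
    simp
  exact hmin.hasDerivAt_eq_zero hderiv

theorem abs_add_sub_abs_of_abs_lt {x t : ℝ} (h : |t| < |x|) :
    |x + t| - |x| = t * (SignType.sign x : ℝ) := by
  have ht := abs_lt.1 h
  rcases lt_trichotomy x 0 with hx | rfl | hx
  · rw [abs_of_neg hx] at ht
    rw [abs_of_neg hx, abs_of_neg (by linarith), sign_neg hx, SignType.coe_neg_one]
    ring
  · exact absurd h (by simp)
  · rw [abs_of_pos hx] at ht
    rw [abs_of_pos hx, abs_of_pos (by linarith), sign_pos hx, SignType.coe_one]
    ring

/-- First-order condition in the direction of an active coefficient, along which the objective is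
differentiable. -/
theorem IsLassoSolution.abs_col_dotProduct_eq (hn : 0 < n) (hlam : 0 ≤ lam) {θ : κ → ℝ}
    (h : IsLassoSolution n lam M y θ) {j : κ} (hj : θ j ≠ 0) :
    |M.col j ⬝ᵥ (y - M *ᵥ θ)| = n * lam := by
  classical
  have : (0 : ℝ) < n := by exact_mod_cast hn
  set z := M.col j ⬝ᵥ (y - M *ᵥ θ)
  have hstationary : lam * (SignType.sign (θ j) : ℝ) - 1 / n * z = 0 := by
    refine eq_zero_of_eventually_nonneg (A := 1 / (2 * (n : ℝ)) * ∑ i, M i j ^ 2) ?_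
    filter_upwards [Metric.ball_mem_nhds (0 : ℝ) (abs_pos.2 hj)] with t ht
    replace ht : |t| < |θ j| := by simpa using ht
    have hdir : M *ᵥ Pi.single j t = t • M.col j := by
      ext i
      simp [Matrix.mulVec_single, mul_comm]
    have habs : ∑ k, (|θ k + (Pi.single j t : κ → ℝ) k| - |θ k|)
        = t * (SignType.sign (θ j) : ℝ) := by
      rw [Fintype.sum_eq_single j fun k hk => by simp [hk], Pi.single_eq_same,
        abs_add_sub_abs_of_abs_lt ht]
    have hmin := h (θ + Pi.single j t)
    simp only [lassoObjective_add, hdir, habs, smul_dotProduct, Pi.smul_apply, Matrix.col_apply,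
      smul_eq_mul, mul_pow, ← Finset.mul_sum] at hmin
    linarith
  have hz : z = n * lam * (SignType.sign (θ j) : ℝ) := by
    field_simp at hstationary
    linarith
  have hsign : |(SignType.sign (θ j) : ℝ)| = 1 := by
    rcases lt_or_gt_of_ne hj with hj | hj <;> simp [hj]
  rw [hz, abs_mul, hsign, mul_one, abs_of_nonneg (by positivity)]

theorem GeneralPosition.lasso_unique (hn : 0 < n) (hlam : 0 < lam) (hM : GeneralPosition M)
    {θ θ' : κ → ℝ} (h : IsLassoSolution n lam M y θ) (h' : IsLassoSolution n lam M y θ') :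
    θ = θ' := by
  have hfit := h.mulVec_eq hn hlam.le h'
  have hscale : (0 : ℝ) < n * lam := by positivity
  refine sub_eq_zero.1 (hM.eq_zero_of_mulVec_eq_zero (u := ((n : ℝ) * lam)⁻¹ • (y - M *ᵥ θ))
    (by rw [Matrix.mulVec_sub, hfit, sub_self]) fun j hj => ?_)
  have hcorr : |M.col j ⬝ᵥ (y - M *ᵥ θ)| = n * lam := by
    by_cases hθ : θ j = 0
    · rw [hfit]
      exact h'.abs_col_dotProduct_eq hn hlam.le fun hθ' => hj (by simp [hθ, hθ'])
    · exact h.abs_col_dotProduct_eq hn hlam.le hθ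
  rw [dotProduct_smul, smul_eq_mul, abs_mul, hcorr, abs_of_pos (inv_pos.2 hscale),
    inv_mul_cancel₀ hscale.ne']

end Lasso

/-! ### Laws of points on a graph -/

section Graph

variable {α β Ω Ω' : Type*} [MeasurableSpace α] [StandardBorelSpace α] [MeasurableSpace β]
  [StandardBorelSpace β] [MeasurableSpace Ω] [MeasurableSpace Ω'] {P : Measure Ω} {P' : Measure Ω'}
  {Γ : Set (α × β)}

theorem map_prodMk_apply_of_mem_graph {E : Ω → α} {U : Ω → β} (hE : AEMeasurable E P)
    (hU : AEMeasurable U P) (hΓ : MeasurableSet Γ) (hinj : Set.InjOn Prod.fst Γ)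
    (h : ∀ᵐ ω ∂P, (E ω, U ω) ∈ Γ) {D : Set (α × β)} (hD : MeasurableSet D) :
    P.map (fun ω => (E ω, U ω)) D = P.map E (Prod.fst '' (Γ ∩ D)) := by
  have himage : MeasurableSet (Prod.fst '' (Γ ∩ D)) :=
    (hΓ.inter hD).image_of_measurable_injOn measurable_fst (hinj.mono Set.inter_subset_left)
  rw [Measure.map_apply_of_aemeasurable (hE.prodMk hU) hD,
    Measure.map_apply_of_aemeasurable hE himage]
  refine measure_congr ?_
  filter_upwards [h] with ω hω
  refine propext ⟨fun hωD => ⟨(E ω, U ω), ⟨hω, hωD⟩, rfl⟩, ?_⟩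
  rintro ⟨z, ⟨hzΓ, hzD⟩, hzE⟩
  have hz : z = (E ω, U ω) := hinj hzΓ hω hzE
  rwa [hz] at hzD

theorem map_prodMk_eq_of_mem_graph {E : Ω → α} {U : Ω → β} {E' : Ω' → α} {U' : Ω' → β}
    (hE : AEMeasurable E P) (hU : AEMeasurable U P) (hE' : AEMeasurable E' P')
    (hU' : AEMeasurable U' P') (hlaw : P.map E = P'.map E') (hΓ : MeasurableSet Γ)
    (hinj : Set.InjOn Prod.fst Γ) (h : ∀ᵐ ω ∂P, (E ω, U ω) ∈ Γ)
    (h' : ∀ᵐ ω ∂P', (E' ω, U' ω) ∈ Γ) :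
    P.map (fun ω => (E ω, U ω)) = P'.map (fun ω => (E' ω, U' ω)) :=
  Measure.ext fun D hD => by
    rw [map_prodMk_apply_of_mem_graph hE hU hΓ hinj h hD,
      map_prodMk_apply_of_mem_graph hE' hU' hΓ hinj h' hD, hlaw]

end Graph

/-! ### The knockoff filter -/

theorem measurable_finset_card {α ι : Type*} [MeasurableSpace α] [Finite ι] {s : α → Finset ι}
    (hs : ∀ i, MeasurableSet {a | i ∈ s a}) : Measurable fun a => ((s a).card : ℝ) := by
  classical
  have := Fintype.ofFinite ι
  have hsum : (fun a => ((s a).card : ℝ)) =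
      fun a => ∑ i, {a | i ∈ s a}.indicator (fun _ => (1 : ℝ)) a := by
    ext a
    simp [Set.indicator_apply]
  rw [hsum]
  exact Finset.measurable_sum _ fun i _ => measurable_const.indicator (hs i)

section Knockoff

variable {p : ℕ} {q : ℝ} {W : Fin p → ℝ}

theorem mem_selected {t : WithTop ℝ} {j : Fin p} : j ∈ selected W t ↔ t ≤ (W j : WithTop ℝ) := by
  simp [selected]

theorem selected_top (W : Fin p → ℝ) : selected W ⊤ = ∅ := by
  ext j
  simp [mem_selected]

theorem mem_supp {θ₀ : Fin p → ℝ} {j : Fin p} : j ∈ supp θ₀ ↔ θ₀ j ≠ 0 := by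
  simp [supp]

theorem fdpHat_eq_card_selected (W : Fin p → ℝ) (t : ℝ) :
    fdpHat W t = (1 + (selected (-W) t).card) / max 1 ((selected W t).card : ℝ) := by
  have hneg : selected (-W) t = Finset.univ.filter fun j => W j ≤ -t := by
    ext j
    simp only [mem_selected, Pi.neg_apply, WithTop.coe_le_coe, Finset.mem_filter,
      Finset.mem_univ, true_and]
    exact le_neg
  have hpos : selected W t = Finset.univ.filter fun j => t ≤ W j := by
    ext j
    simp [mem_selected]
  rw [fdpHat, hneg, hpos]

theorem fdp_nonneg (θ₀ W : Fin p → ℝ) (t : WithTop ℝ) : 0 ≤ FDP θ₀ W t := by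
  unfold FDP
  positivity

theorem fdp_le_one (θ₀ W : Fin p → ℝ) (t : WithTop ℝ) : FDP θ₀ W t ≤ 1 := by
  unfold FDP
  rw [div_le_one (by positivity)]
  exact (Nat.cast_le.2 (Finset.card_le_card Finset.sdiff_subset)).trans (le_max_right _ _)

theorem knockoffThreshold_eq_coe {t : ℝ} (ht : knockoffThreshold q W = t) :
    0 < t ∧ (∃ k, |W k| = t) ∧ fdpHat W t ≤ q := by
  have hmem := Finset.mem_of_min ht
  simp only [Finset.mem_filter, Finset.mem_image, Finset.mem_univ, true_and] at hmem
  obtain ⟨⟨k, rfl⟩, h0, hq⟩ := hmem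
  exact ⟨lt_of_le_of_ne (abs_nonneg _) (Ne.symm h0), ⟨k, rfl⟩, hq⟩

theorem knockoffThreshold_le_coe_iff {x : ℝ} :
    knockoffThreshold q W ≤ x ↔ ∃ k, W k ≠ 0 ∧ fdpHat W |W k| ≤ q ∧ |W k| ≤ x := by
  constructor
  · intro h
    obtain ⟨t, ht⟩ := WithTop.ne_top_iff_exists.1 (ne_top_of_le_ne_top WithTop.coe_ne_top h)
    obtain ⟨h0, ⟨k, rfl⟩, hq⟩ := knockoffThreshold_eq_coe ht.symm
    exact ⟨k, abs_pos.1 h0, hq, by rw [← ht] at h; exact_mod_cast h⟩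
  · rintro ⟨k, h0, hq, hx⟩
    refine (Finset.min_le ?_).trans (WithTop.coe_le_coe.2 hx)
    simp only [Finset.mem_filter, Finset.mem_image, Finset.mem_univ, true_and]
    exact ⟨⟨k, rfl⟩, abs_ne_zero.2 h0, hq⟩

/-- The statistics with the sign of the `j`-th coordinate flipped, as they arise from exchanging
feature `j` with its knockoff. -/
def flipSign (j : Fin p) (W : Fin p → ℝ) : Fin p → ℝ := Function.update W j (-W j)

theorem flipSign_same (j : Fin p) (W : Fin p → ℝ) : flipSign j W j = -W j := by
  simp [flipSign]

theorem flipSign_of_ne {j k : Fin p} (h : k ≠ j) (W : Fin p → ℝ) : flipSign j W k = W k := by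
  simp [flipSign, h]

theorem abs_flipSign (j k : Fin p) (W : Fin p → ℝ) : |flipSign j W k| = |W k| := by
  rcases eq_or_ne k j with rfl | h
  · rw [flipSign_same, abs_neg]
  · rw [flipSign_of_ne h]

theorem measurable_flipSign (j : Fin p) : Measurable (flipSign j) := by
  refine measurable_pi_lambda _ fun k => ?_
  rcases eq_or_ne k j with rfl | h
  · simp only [flipSign_same]
    exact (measurable_pi_apply k).neg
  · simpa only [flipSign_of_ne h] using measurable_pi_apply k

theorem selected_flipSign {j : Fin p} {t : WithTop ℝ} (hj : j ∈ selected (-W) t) :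
    selected (flipSign j W) t = insert j (selected W t) := by
  ext k
  rcases eq_or_ne k j with rfl | h
  · simpa [mem_selected, flipSign_same] using hj
  · simp [mem_selected, flipSign_of_ne h, h]

theorem selected_neg_flipSign {j : Fin p} {t : WithTop ℝ} (hj : j ∉ selected W t) :
    selected (-flipSign j W) t = (selected (-W) t).erase j := by
  ext k
  rcases eq_or_ne k j with rfl | h
  · simpa [mem_selected, flipSign_same] using hj
  · simp [mem_selected, flipSign_of_ne h, h]

theorem notMem_selected_of_mem_selected_neg {j : Fin p} {t : ℝ} (ht : 0 < t)
    (hj : j ∈ selected (-W) t) : j ∉ selected W t := by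
  simp only [mem_selected, Pi.neg_apply, WithTop.coe_le_coe] at hj ⊢
  linarith

theorem fdpHat_flipSign {j : Fin p} {t : ℝ} (ht : 0 < t) (hj : j ∈ selected (-W) t) :
    fdpHat (flipSign j W) t
      = (selected (-W) t).card / max 1 ((selected W t).card + 1 : ℝ) := by
  have hj' := notMem_selected_of_mem_selected_neg ht hj
  rw [fdpHat_eq_card_selected, selected_flipSign hj, selected_neg_flipSign hj',
    Finset.card_insert_of_notMem hj', ← Finset.card_erase_add_one hj]
  push_cast
  rw [add_comm]

theorem knockoffThreshold_flipSign_le {j k : Fin p}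
    (hj : j ∈ selected (-W) (knockoffThreshold q (flipSign j W)))
    (hk : k ∈ selected (-W) (knockoffThreshold q (flipSign k W)))
    (hjk : knockoffThreshold q (flipSign j W) ≤ knockoffThreshold q (flipSign k W)) :
    knockoffThreshold q (flipSign k W) ≤ knockoffThreshold q (flipSign j W) := by
  obtain ⟨t, ht⟩ := WithTop.ne_top_iff_exists.1
    (ne_top_of_le_ne_top WithTop.coe_ne_top (mem_selected.1 hj))
  obtain ⟨ht0, ⟨i, hi⟩, hq⟩ := knockoffThreshold_eq_coe ht.symm
  rw [← ht] at hj hjk ⊢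
  have hk' : k ∈ selected (-W) t := mem_selected.2 (hjk.trans (mem_selected.1 hk))
  have hi' : |flipSign k W i| = t := by rw [abs_flipSign, ← abs_flipSign j, hi]
  refine knockoffThreshold_le_coe_iff.2 ⟨i, abs_pos.1 (hi' ▸ ht0), ?_, hi'.le⟩
  rwa [hi', fdpHat_flipSign ht0 hk', ← fdpHat_flipSign ht0 hj]

theorem knockoffThreshold_flipSign_eq {j k : Fin p}
    (hj : j ∈ selected (-W) (knockoffThreshold q (flipSign j W)))
    (hk : k ∈ selected (-W) (knockoffThreshold q (flipSign k W))) :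
    knockoffThreshold q (flipSign j W) = knockoffThreshold q (flipSign k W) := by
  rcases le_total (knockoffThreshold q (flipSign j W)) (knockoffThreshold q (flipSign k W))
    with h | h
  · exact h.antisymm (knockoffThreshold_flipSign_le hj hk h)
  · exact (knockoffThreshold_flipSign_le hk hj h).antisymm h

/-- Contribution of the null `j` to the ratio of the number of selected nulls in `S` to one plus
the number of nulls in `S` whose statistic lies below minus the threshold. The index `j` itself is
left out of the denominator: this makes no difference when `j` is selected, and it leaves the
denominator independent of the sign of `W j`. -/
def nullRatio (q : ℝ) (S : Finset (Fin p)) (j : Fin p) (W : Fin p → ℝ) : ℝ :=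
  if j ∈ selected W (knockoffThreshold q W) then
    1 / (1 + ((S.erase j ∩ selected (-W) (knockoffThreshold q W)).card : ℝ)) else 0

theorem nullRatio_nonneg (q : ℝ) (S : Finset (Fin p)) (j : Fin p) (W : Fin p → ℝ) :
    0 ≤ nullRatio q S j W := by
  unfold nullRatio
  split_ifs <;> positivity

theorem nullRatio_le_one (q : ℝ) (S : Finset (Fin p)) (j : Fin p) (W : Fin p → ℝ) :
    nullRatio q S j W ≤ 1 := by
  unfold nullRatio
  split_ifs
  · rw [div_le_one (by positivity)]
    simp
  · exact zero_le_one

theorem nullRatio_flipSign {S : Finset (Fin p)} {j : Fin p} (hjS : j ∈ S) (W : Fin p → ℝ) :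
    nullRatio q S j (flipSign j W) =
      if j ∈ selected (-W) (knockoffThreshold q (flipSign j W)) then
        1 / ((S ∩ selected (-W) (knockoffThreshold q (flipSign j W))).card : ℝ) else 0 := by
  set t := knockoffThreshold q (flipSign j W)
  have hiff : j ∈ selected (flipSign j W) t ↔ j ∈ selected (-W) t := by
    simp [mem_selected, flipSign_same]
  rw [nullRatio, if_congr hiff rfl rfl]
  refine ite_congr rfl (fun hj => ?_) fun _ => rfl
  have herase : S.erase j ∩ selected (-flipSign j W) t = (S ∩ selected (-W) t).erase j := by
    ext k
    rcases eq_or_ne k j with rfl | h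
    · simp
    · simp [mem_selected, flipSign_of_ne h, h]
  rw [herase, ← Finset.card_erase_add_one (Finset.mem_inter.2 ⟨hjS, hj⟩)]
  push_cast
  rw [add_comm]

/-- All `j` contributing to the sum share the same threshold, hence the same denominator, and that
denominator counts at least all of them. -/
theorem sum_nullRatio_flipSign_le_one (q : ℝ) (S : Finset (Fin p)) (W : Fin p → ℝ) :
    ∑ j ∈ S, nullRatio q S j (flipSign j W) ≤ 1 := by
  let t (j : Fin p) := knockoffThreshold q (flipSign j W)
  let J := S.filter fun j => j ∈ selected (-W) (t j)
  have hsum : ∑ j ∈ S, nullRatio q S j (flipSign j W)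
      = ∑ j ∈ J, 1 / ((S ∩ selected (-W) (t j)).card : ℝ) := by
    rw [Finset.sum_filter]
    exact Finset.sum_congr rfl fun j hj => nullRatio_flipSign hj W
  rw [hsum]
  rcases J.eq_empty_or_nonempty with hJ | ⟨i, hi⟩
  · simp [hJ]
  have ht (j : Fin p) (hj : j ∈ J) : t j = t i :=
    knockoffThreshold_flipSign_eq (Finset.mem_filter.1 hj).2 (Finset.mem_filter.1 hi).2
  have hsub : J ⊆ S ∩ selected (-W) (t i) := fun j hj => by
    have hj' := Finset.mem_filter.1 hj
    exact Finset.mem_inter.2 ⟨hj'.1, ht j hj ▸ hj'.2⟩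
  calc ∑ j ∈ J, 1 / ((S ∩ selected (-W) (t j)).card : ℝ)
      = ∑ _j ∈ J, 1 / ((S ∩ selected (-W) (t i)).card : ℝ) :=
        Finset.sum_congr rfl fun j hj => by rw [ht j hj]
    _ = J.card / ((S ∩ selected (-W) (t i)).card : ℝ) := by
        rw [Finset.sum_const, nsmul_eq_mul, mul_one_div]
    _ ≤ 1 := div_le_one_of_le₀ (by exact_mod_cast Finset.card_le_card hsub) (by positivity)

theorem fdp_knockoffThreshold_le (θ₀ W : Fin p → ℝ) :
    FDP θ₀ W (knockoffThreshold q W) ≤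
      q * ((selected W (knockoffThreshold q W) \ supp θ₀).card *
        (1 / (1 + ((selected (-W) (knockoffThreshold q W)).card : ℝ)))) := by
  rcases h : knockoffThreshold q W with _ | t
  · change FDP θ₀ W ⊤ ≤ q * ((selected W ⊤ \ supp θ₀).card * _)
    simp [FDP, selected_top]
  · have hfdp := (knockoffThreshold_eq_coe h).2.2
    rw [fdpHat_eq_card_selected, div_le_iff₀ (by positivity)] at hfdp
    change FDP θ₀ W (t : WithTop ℝ) ≤ q * ((selected W (t : WithTop ℝ) \ supp θ₀).card *
      (1 / (1 + ((selected (-W) (t : WithTop ℝ)).card : ℝ))))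
    rw [FDP, div_le_iff₀ (by positivity), mul_one_div, ← mul_div_assoc, div_mul_eq_mul_div,
      le_div_iff₀ (by positivity)]
    calc _ ≤ ((selected W (t : WithTop ℝ) \ supp θ₀).card : ℝ) * _ :=
          mul_le_mul_of_nonneg_left hfdp (by positivity)
      _ = _ := by ring

theorem one_div_le_nullRatio (S : Finset (Fin p)) {j : Fin p}
    (hj : j ∈ selected W (knockoffThreshold q W)) :
    1 / (1 + ((selected (-W) (knockoffThreshold q W)).card : ℝ)) ≤ nullRatio q S j W := by
  rw [nullRatio, if_pos hj]
  gcongr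
  exact Finset.inter_subset_right

theorem fdp_le_mul_sum_nullRatio (hq : 0 ≤ q) (θ₀ W : Fin p → ℝ) :
    FDP θ₀ W (knockoffThreshold q W) ≤ q * ∑ j ∈ (supp θ₀)ᶜ, nullRatio q (supp θ₀)ᶜ j W := by
  refine (fdp_knockoffThreshold_le θ₀ W).trans (mul_le_mul_of_nonneg_left ?_ hq)
  rw [← nsmul_eq_mul, ← Finset.sum_const]
  calc ∑ _j ∈ selected W (knockoffThreshold q W) \ supp θ₀, _
      ≤ ∑ j ∈ selected W (knockoffThreshold q W) \ supp θ₀, nullRatio q (supp θ₀)ᶜ j W :=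
        Finset.sum_le_sum fun j hj => one_div_le_nullRatio _ (Finset.mem_sdiff.1 hj).1
    _ ≤ ∑ j ∈ (supp θ₀)ᶜ, nullRatio q (supp θ₀)ᶜ j W :=
        Finset.sum_le_sum_of_subset_of_nonneg
          (fun j hj => Finset.mem_compl.2 (Finset.mem_sdiff.1 hj).2)
          fun j _ _ => nullRatio_nonneg q _ j W

theorem measurable_fdpHat {t : (Fin p → ℝ) → ℝ} (ht : Measurable t) :
    Measurable fun W : Fin p → ℝ => fdpHat W (t W) := by
  simp only [fdpHat_eq_card_selected]
  refine (measurable_const.add (measurable_finset_card fun i => ?_)).div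
    (measurable_const.max (measurable_finset_card fun i => ?_)) <;>
  simp only [mem_selected, WithTop.coe_le_coe]
  exacts [measurableSet_le ht (measurable_pi_apply i).neg,
    measurableSet_le ht (measurable_pi_apply i)]

theorem measurableSet_knockoffThreshold_le (q : ℝ) {g : (Fin p → ℝ) → ℝ} (hg : Measurable g) :
    MeasurableSet {W : Fin p → ℝ | knockoffThreshold q W ≤ g W} := by
  simp only [knockoffThreshold_le_coe_iff, Set.ofPred_exists]
  refine MeasurableSet.iUnion fun k => ?_
  have hk : Measurable fun W : Fin p → ℝ => W k := measurable_pi_apply k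
  exact ((measurableSet_singleton (0 : ℝ)).compl.preimage hk).inter
    ((measurableSet_le (measurable_fdpHat hk.abs) measurable_const).inter
      (measurableSet_le hk.abs hg))

theorem measurableSet_mem_selected_knockoffThreshold (q : ℝ) {V : (Fin p → ℝ) → Fin p → ℝ}
    (hV : Measurable V) (j : Fin p) :
    MeasurableSet {W : Fin p → ℝ | j ∈ selected (V W) (knockoffThreshold q W)} := by
  simp only [mem_selected]
  exact measurableSet_knockoffThreshold_le q (hV.eval)

theorem measurable_nullRatio (q : ℝ) (S : Finset (Fin p)) (j : Fin p) :
    Measurable (nullRatio q S j) := by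
  refine Measurable.ite (measurableSet_mem_selected_knockoffThreshold q measurable_id j)
    (measurable_const.div (measurable_const.add (measurable_finset_card fun i => ?_)))
    measurable_const
  simp only [Finset.mem_inter]
  exact (MeasurableSet.const _).inter
    (measurableSet_mem_selected_knockoffThreshold q measurable_neg i)

theorem measurable_fdp_knockoffThreshold (q : ℝ) (θ₀ : Fin p → ℝ) :
    Measurable fun W : Fin p → ℝ => FDP θ₀ W (knockoffThreshold q W) := by
  have hsel := measurableSet_mem_selected_knockoffThreshold (p := p) q measurable_id
  refine (measurable_finset_card fun i => ?_).div
    (measurable_const.max (measurable_finset_card hsel))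
  simp only [Finset.mem_sdiff]
  exact (hsel i).inter (MeasurableSet.const _)

section FDR

variable {Ω : Type*} [MeasurableSpace Ω] {P : Measure Ω} {V : Ω → Fin p → ℝ}

theorem integrable_fdp_knockoffThreshold [IsFiniteMeasure P] (q : ℝ) (θ₀ : Fin p → ℝ)
    (hV : AEMeasurable V P) :
    Integrable (fun ω => FDP θ₀ (V ω) (knockoffThreshold q (V ω))) P := by
  refine Integrable.of_bound (C := 1)
    ((measurable_fdp_knockoffThreshold q θ₀).comp_aemeasurable hV).aestronglyMeasurable
    (ae_of_all _ fun ω => ?_)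
  rw [Real.norm_of_nonneg (fdp_nonneg _ _ _)]
  exact fdp_le_one _ _ _

theorem integrable_nullRatio [IsFiniteMeasure P] (q : ℝ) (S : Finset (Fin p)) (j : Fin p)
    (hV : AEMeasurable V P) : Integrable (fun ω => nullRatio q S j (V ω)) P := by
  refine Integrable.of_bound (C := 1)
    ((measurable_nullRatio q S j).comp_aemeasurable hV).aestronglyMeasurable
    (ae_of_all _ fun ω => ?_)
  rw [Real.norm_of_nonneg (nullRatio_nonneg _ _ _ _)]
  exact nullRatio_le_one _ _ _ _

theorem integral_sum_nullRatio_le_one [IsProbabilityMeasure P] (q : ℝ) {S : Finset (Fin p)}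
    (hV : AEMeasurable V P) (hflip : ∀ j ∈ S, P.map (fun ω => flipSign j (V ω)) = P.map V) :
    ∫ ω, ∑ j ∈ S, nullRatio q S j (V ω) ∂P ≤ 1 := by
  have hVflip (j : Fin p) : AEMeasurable (fun ω => flipSign j (V ω)) P :=
    (measurable_flipSign j).comp_aemeasurable hV
  have hswap (j : Fin p) (hj : j ∈ S) :
      ∫ ω, nullRatio q S j (V ω) ∂P = ∫ ω, nullRatio q S j (flipSign j (V ω)) ∂P := by
    have hmeas := (measurable_nullRatio q S j).aestronglyMeasurable (μ := P.map V)
    rw [← integral_map hV hmeas, ← hflip j hj,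
      integral_map (hVflip j) (measurable_nullRatio q S j).aestronglyMeasurable]
  have hint (j : Fin p) : Integrable (fun ω => nullRatio q S j (flipSign j (V ω))) P :=
    integrable_nullRatio q S j (hVflip j)
  calc ∫ ω, ∑ j ∈ S, nullRatio q S j (V ω) ∂P
      = ∑ j ∈ S, ∫ ω, nullRatio q S j (flipSign j (V ω)) ∂P := by
        rw [integral_finsetSum _ fun j _ => integrable_nullRatio q S j hV,
          Finset.sum_congr rfl hswap]
    _ = ∫ ω, ∑ j ∈ S, nullRatio q S j (flipSign j (V ω)) ∂P :=
        (integral_finsetSum _ fun j _ => hint j).symm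
    _ ≤ ∫ _, (1 : ℝ) ∂P :=
        integral_mono (integrable_finsetSum _ fun j _ => hint j) (integrable_const _)
          fun ω => sum_nullRatio_flipSign_le_one q S (V ω)
    _ = 1 := by simp

theorem integral_fdp_knockoffThreshold_le [IsProbabilityMeasure P] (hq : 0 ≤ q) {θ₀ : Fin p → ℝ}
    (hV : AEMeasurable V P)
    (hflip : ∀ j, θ₀ j = 0 → P.map (fun ω => flipSign j (V ω)) = P.map V) :
    ∫ ω, FDP θ₀ (V ω) (knockoffThreshold q (V ω)) ∂P ≤ q := by
  calc ∫ ω, FDP θ₀ (V ω) (knockoffThreshold q (V ω)) ∂P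
      ≤ ∫ ω, q * ∑ j ∈ (supp θ₀)ᶜ, nullRatio q (supp θ₀)ᶜ j (V ω) ∂P :=
        integral_mono (integrable_fdp_knockoffThreshold q θ₀ hV)
          ((integrable_finsetSum _ fun j _ => integrable_nullRatio q _ j hV).const_mul q)
          fun ω => fdp_le_mul_sum_nullRatio hq θ₀ (V ω)
    _ = q * ∫ ω, ∑ j ∈ (supp θ₀)ᶜ, nullRatio q (supp θ₀)ᶜ j (V ω) ∂P := integral_const_mul _ _
    _ ≤ q := mul_le_of_le_one_right hq <| integral_sum_nullRatio_le_one q hV fun j hj =>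
        hflip j (by simpa [mem_supp] using hj)

end FDR

end Knockoff

/-! ### Admissible parameters -/

namespace Setting

variable {S : Setting}

/-- The non-asymptotic part of the standing assumptions. -/
structure Admissible (S : Setting) : Prop where
  σ_pos : 0 < S.σ
  D_prob : IsProbabilityMeasure S.D
  D_bdd : ∀ᵐ x ∂S.D, |x| ≤ S.b
  D_mean : ∫ x, x ∂S.D = 0
  D_var : variance id S.D = 1
  bn_pos : ∀ n, 0 < S.bn n
  θ₀_norm : ∀ n, ∑ j, S.θ₀ n j ^ 2 = 1
  r_pos : ∀ n, 0 < S.r n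
  ε_pos : ∀ n, 0 < S.ε n
  δ_pos : ∀ n, 0 < S.δ n
  δ_lt : ∀ n, S.δ n < Real.exp (-1)

theorem Standing.admissible (hS : S.Standing) : S.Admissible := { hS with }

namespace Admissible

theorem p_pos (hS : S.Admissible) (n : ℕ) : 0 < S.p n := by
  rw [Nat.pos_iff_ne_zero]
  intro h0
  have : IsEmpty (Fin (S.p n)) := by rw [h0]; infer_instance
  simpa using hS.θ₀_norm n

theorem one_lt_log_div_δ (hS : S.Admissible) (n : ℕ) : 1 < Real.log (4 / S.δ n) := by
  have hδ := hS.δ_pos n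
  rw [Real.lt_log_iff_exp_lt (by positivity), lt_div_iff₀ hδ]
  calc Real.exp 1 * S.δ n < Real.exp 1 * Real.exp (-1) := by gcongr; exact hS.δ_lt n
    _ = 1 := by rw [← Real.exp_add]; simp
    _ < 4 := by norm_num

theorem integral_sq_D (hS : S.Admissible) : ∫ x, x ^ 2 ∂S.D = 1 := by
  rw [← hS.D_var, variance_of_integral_eq_zero aemeasurable_id (by simpa using hS.D_mean)]
  simp

theorem one_le_b (hS : S.Admissible) : 1 ≤ S.b := by
  have := hS.D_prob
  have hb : 0 ≤ S.b := by
    obtain ⟨x, hx⟩ := hS.D_bdd.exists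
    exact (abs_nonneg x).trans hx
  have hle : ∫ x, x ^ 2 ∂S.D ≤ ∫ _, S.b ^ 2 ∂S.D := by
    refine integral_mono_of_nonneg (ae_of_all _ fun x => sq_nonneg x) (integrable_const _) ?_
    filter_upwards [hS.D_bdd] with x hx using sq_le_sq.2 (hx.trans (le_abs_self _))
  rw [hS.integral_sq_D] at hle
  simp only [integral_const, probReal_univ, smul_eq_mul, one_mul] at hle
  exact (one_le_sq_iff₀ hb).1 hle

theorem B_pos (hS : S.Admissible) (n : ℕ) : 0 < S.B n := by
  have hb := hS.one_le_b
  have hbn := hS.bn_pos n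
  have : 0 < S.b * √(S.s₀ n : ℝ) + S.bn n := by positivity
  exact Real.sqrt_pos.2 (by positivity)

theorem w_pos (hS : S.Admissible) (n : ℕ) : 0 < S.w n := by
  have hlog := hS.one_lt_log_div_δ n
  have hε := hS.ε_pos n
  have hB := hS.B_pos n
  exact Real.sqrt_pos.2 (by positivity)

theorem log_d_pos (hS : S.Admissible) (n : ℕ) : 0 < Real.log (S.d n) := by
  have : (1 : ℝ) ≤ S.p n := by exact_mod_cast hS.p_pos n
  exact Real.log_pos (by unfold d; linarith)

theorem lam_pos (hS : S.Admissible) {C : ℝ} (hC : 0 < C) {n : ℕ} (hn : 0 < n) :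
    0 < S.lam C n := by
  have hlog := hS.log_d_pos n
  have hσ := hS.σ_pos
  have : 0 < √(Real.log (S.d n) / n) := Real.sqrt_pos.2 (by positivity)
  exact mul_pos (mul_pos hC hσ) (lt_max_of_lt_left this)

theorem isProbabilityMeasure_noiseLaw (hS : S.Admissible) (n : ℕ) :
    IsProbabilityMeasure (S.noiseLaw n) := by
  refine cond_isProbabilityMeasure fun h0 => ?_
  have hv : Real.toNNReal (S.σ ^ 2) ≠ 0 := by
    have := hS.σ_pos
    rw [ne_eq, Real.toNNReal_eq_zero, not_le]
    positivity
  have hvol := gaussianReal_absolutelyContinuous' 0 hv h0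
  rw [Real.volume_Icc, ENNReal.ofReal_eq_zero] at hvol
  linarith [hS.bn_pos n]

theorem nullSingletonClass_projLaw (hS : S.Admissible) (n : ℕ) :
    NullSingletonClass (S.projLaw n) :=
  nullSingletonClass_gaussianReal (by simpa using (hS.r_pos n).ne')

end Admissible

instance isProbabilityMeasure_projLaw (S : Setting) (n : ℕ) :
    IsProbabilityMeasure (S.projLaw n) := by
  unfold projLaw; infer_instance

end Setting

/-! ### The joint law of the scalar inputs -/

section PiSum

variable {ι ι' β : Type*} [MeasurableSpace β]

theorem measurable_sumElim (a : ι → β) :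
    Measurable fun c : ι' → β => (Sum.elim a c : ι ⊕ ι' → β) := by
  refine measurable_pi_lambda _ fun i => ?_
  rcases i with i | i
  · exact measurable_const
  · exact measurable_pi_apply i

variable [Fintype ι] [Fintype ι']

theorem lintegral_pi_sum (μ : ι ⊕ ι' → Measure β) [∀ i, SigmaFinite (μ i)]
    {F : (ι ⊕ ι' → β) → ENNReal} (hF : Measurable F) :
    ∫⁻ e, F e ∂Measure.pi μ = ∫⁻ a, ∫⁻ c, F (Sum.elim a c) ∂Measure.pi (fun i => μ (Sum.inr i))
      ∂Measure.pi (fun i => μ (Sum.inl i)) := by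
  have hmp := measurePreserving_sumPiEquivProdPi_symm (X := fun _ : ι ⊕ ι' => β) μ
  rw [← hmp.lintegral_comp hF, lintegral_prod
    (fun z => F ((MeasurableEquiv.sumPiEquivProdPi fun _ => β).symm z))
    (hF.comp hmp.measurable).aemeasurable]
  rfl

theorem ae_pi_sum_of_forall (μ : ι ⊕ ι' → Measure β) [∀ i, SigmaFinite (μ i)]
    {Q : (ι ⊕ ι' → β) → Prop} (hQ : MeasurableSet {e | Q e})
    (h : ∀ a, ∀ᵐ c ∂Measure.pi (fun i => μ (Sum.inr i)), Q (Sum.elim a c)) :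
    ∀ᵐ e ∂Measure.pi μ, Q e := by
  have hQc : MeasurableSet {e | ¬ Q e} := hQ.compl
  have hmeas : Measurable ({e | ¬ Q e}.indicator (1 : (ι ⊕ ι' → β) → ENNReal)) :=
    measurable_one.indicator hQc
  rw [ae_iff, ← lintegral_indicator_one hQc, lintegral_pi_sum _ hmeas]
  refine (lintegral_congr fun a => ?_).trans lintegral_zero
  refine (lintegral_eq_zero_iff (hmeas.comp (measurable_sumElim a))).2 ?_
  filter_upwards [h a] with c hc
  simp [hc]

end PiSum

/-- Index set of the scalar random inputs at sample size `n`: the entries of `[X X̃]`, of `ξ` and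
of `R`, in the order of `Sample.entries`. -/
abbrev EntryIndex (S : Setting) (n : ℕ) : Type :=
  (Fin n × (Fin (S.p n) ⊕ Fin (S.p n))) ⊕ Fin n ⊕
    (Fin (S.r n) × (Fin n ⊕ ((Fin (S.p n) ⊕ Fin (S.p n)) ⊕ Unit)))

/-- The law of each scalar random input. -/
def entryLaw (S : Setting) (n : ℕ) : EntryIndex S n → Measure ℝ
  | Sum.inl _ => S.D
  | Sum.inr (Sum.inl _) => S.noiseLaw n
  | Sum.inr (Sum.inr _) => S.projLaw n

/-- The privatized design `[X* X̃*]` as a function of the scalar inputs. -/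
def privatizedDesign (S : Setting) (n : ℕ) (e : EntryIndex S n → ℝ) :
    Matrix (Fin (S.r n)) (Fin (S.p n) ⊕ Fin (S.p n)) ℝ :=
  Matrix.of fun a k => ∑ i, e (Sum.inr (Sum.inr (a, Sum.inl i))) * e (Sum.inl (i, k)) +
    S.w n * e (Sum.inr (Sum.inr (a, Sum.inr (Sum.inl k))))

/-- The privatized response `y*` as a function of the scalar inputs. -/
def privatizedResponse (S : Setting) (n : ℕ) (e : EntryIndex S n → ℝ) : Fin (S.r n) → ℝ :=
  fun a => ∑ i, e (Sum.inr (Sum.inr (a, Sum.inl i))) *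
      (∑ j, e (Sum.inl (i, Sum.inl j)) * S.θ₀ n j + e (Sum.inr (Sum.inl i))) +
    S.w n * e (Sum.inr (Sum.inr (a, Sum.inr (Sum.inr ()))))

theorem jlt_apply {ι κ ρ : Type*} [Fintype ι] [Fintype κ] [DecidableEq κ]
    (R : Matrix ρ (ι ⊕ κ) ℝ) (A : Matrix ι κ ℝ) (w : ℝ) (a : ρ) (c : κ) :
    jlt R A w a c = ∑ i, R a (Sum.inl i) * A i c + w * R a (Sum.inr c) := by
  simp [jlt, Matrix.mul_apply, Fintype.sum_sum_type, Matrix.one_apply, mul_comm]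

namespace Sample

variable {S : Setting} {n : ℕ} {Ω : Type*} {T : Sample S n Ω}

/-- All scalar inputs of a sample at the point `ω`. -/
def entryFun (T : Sample S n Ω) (ω : Ω) : EntryIndex S n → ℝ := fun i => T.entries i ω

theorem Xstar_eq (T : Sample S n Ω) (ω : Ω) :
    T.Xstar ω = privatizedDesign S n (T.entryFun ω) := by
  ext a (k | k) <;> simp [Xstar, Astar, jlt_apply, privatizedDesign, dataMatrix, entryFun, entries]

theorem ystar_eq (T : Sample S n Ω) (ω : Ω) :
    T.ystar ω = privatizedResponse S n (T.entryFun ω) := by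
  ext a
  simp [ystar, Astar, jlt_apply, privatizedResponse, dataMatrix, response, Matrix.mulVec,
    dotProduct, entryFun, entries]

theorem IsModel.hasLaw_entryFun [MeasurableSpace Ω] {C : ℝ} {P : Measure Ω}
    (h : T.IsModel C P) : HasLaw T.entryFun (Measure.pi (entryLaw S n)) P := by
  refine h.indep.hasLaw_pi fun i => ?_
  rcases i with ⟨i, k | k⟩ | i | ⟨a, k⟩
  · simpa [entryFun, entries, entryLaw] using h.law_X i k
  · simpa [entryFun, entries, entryLaw] using h.law_Xt i k
  · exact h.law_ξ i
  · exact h.law_R a k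

end Sample

section Entries

variable {S : Setting}

theorem isProbabilityMeasure_entryLaw (hS : S.Admissible) (n : ℕ) (i : EntryIndex S n) :
    IsProbabilityMeasure (entryLaw S n i) := by
  rcases i with _ | _ | _
  · exact hS.D_prob
  · exact hS.isProbabilityMeasure_noiseLaw n
  · exact S.isProbabilityMeasure_projLaw n

theorem lintegral_entries (hS : S.Admissible) (n : ℕ)
    {F : (EntryIndex S n → ℝ) → ENNReal} (hF : Measurable F) :
    ∫⁻ e, F e ∂Measure.pi (entryLaw S n) =
      ∫⁻ a, ∫⁻ b, ∫⁻ c, F (Sum.elim a (Sum.elim b c)) ∂Measure.pi (fun _ => S.projLaw n)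
        ∂Measure.pi (fun _ => S.noiseLaw n) ∂Measure.pi (fun _ => S.D) := by
  have := isProbabilityMeasure_entryLaw hS n
  rw [lintegral_pi_sum _ hF]
  exact lintegral_congr fun a =>
    lintegral_pi_sum (fun i => entryLaw S n (Sum.inr i)) (hF.comp (measurable_sumElim a))

theorem continuous_privatizedDesign (S : Setting) (n : ℕ) : Continuous (privatizedDesign S n) := by
  refine continuous_matrix fun a k => ?_
  simp only [privatizedDesign, Matrix.of_apply]
  fun_prop

theorem continuous_privatizedResponse (S : Setting) (n : ℕ) :
    Continuous (privatizedResponse S n) := by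
  unfold privatizedResponse
  fun_prop

theorem measurableSet_generalPosition_privatizedDesign (S : Setting) (n : ℕ) :
    MeasurableSet {e | GeneralPosition (privatizedDesign S n e)} :=
  (isOpen_generalPosition.preimage (continuous_privatizedDesign S n)).measurableSet

theorem ae_generalPosition_privatizedDesign (hS : S.Admissible) (n : ℕ) :
    ∀ᵐ e ∂Measure.pi (entryLaw S n), GeneralPosition (privatizedDesign S n e) := by
  have := isProbabilityMeasure_entryLaw hS n
  have := hS.nullSingletonClass_projLaw n
  have hw := (hS.w_pos n).ne'
  have hmeas := measurableSet_generalPosition_privatizedDesign S n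
  refine ae_pi_sum_of_forall _ hmeas fun a => ae_pi_sum_of_forall _
    (measurableSet_preimage (measurable_sumElim a) hmeas) fun b => ?_
  let A : Matrix (Fin n ⊕ ((Fin (S.p n) ⊕ Fin (S.p n)) ⊕ Unit)) (Fin (S.p n) ⊕ Fin (S.p n)) ℝ :=
    Matrix.fromRows (Matrix.of fun i k => a (i, k)) (Matrix.fromRows (S.w n • 1) 0)
  let L : Matrix (Fin (S.p n) ⊕ Fin (S.p n)) (Fin n ⊕ ((Fin (S.p n) ⊕ Fin (S.p n)) ⊕ Unit)) ℝ :=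
    Matrix.fromCols 0 (Matrix.fromCols ((S.w n)⁻¹ • 1) 0)
  have hL : L * A = 1 := by
    simp [L, A, Matrix.fromCols_mul_fromRows, hw]
  filter_upwards [ae_generalPosition_mul (ρ := Fin (S.r n)) (fun _ => S.projLaw n) hL] with c hc
  convert hc using 1
  ext i k
  simp [A, privatizedDesign, Matrix.mul_apply, Fintype.sum_sum_type, Matrix.one_apply, mul_comm]

end Entries

/-! ### Exchangeability of a null feature and its knockoff -/

section LassoInvariance

variable {ρ κ : Type*} [Fintype ρ] [Fintype κ]

theorem isClosed_isLassoSolution (n : ℕ) (lam : ℝ) :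
    IsClosed {z : Matrix ρ κ ℝ × (ρ → ℝ) × (κ → ℝ) | IsLassoSolution n lam z.1 z.2.1 z.2.2} := by
  simp only [IsLassoSolution, Set.ofPred_forall]
  refine isClosed_iInter fun v => isClosed_le ?_ ?_ <;>
  · unfold lassoObjective
    fun_prop

theorem lassoObjective_submatrix (n : ℕ) (lam : ℝ) (M : Matrix ρ κ ℝ) (y : ρ → ℝ) (θ : κ → ℝ)
    (τ : Equiv.Perm κ) :
    lassoObjective n lam (M.submatrix id τ) y (θ ∘ τ) = lassoObjective n lam M y θ := by
  have : (θ ∘ τ) ∘ τ.symm = θ := by ext; simp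
  unfold lassoObjective
  rw [Matrix.submatrix_mulVec_equiv, this]
  congr 2
  exact Equiv.sum_comp τ fun k => |θ k|

theorem IsLassoSolution.submatrix {n : ℕ} {lam : ℝ} {M : Matrix ρ κ ℝ} {y : ρ → ℝ} {θ : κ → ℝ}
    (h : IsLassoSolution n lam M y θ) (τ : Equiv.Perm κ) :
    IsLassoSolution n lam (M.submatrix id τ) y (θ ∘ τ) := by
  intro v
  have : v = (v ∘ τ.symm) ∘ τ := by ext; simp
  rw [this, lassoObjective_submatrix, lassoObjective_submatrix]
  exact h _

theorem debiased_submatrix (n : ℕ) (w : ℝ) (M : Matrix ρ κ ℝ) (y : ρ → ℝ) (θ : κ → ℝ)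
    (τ : Equiv.Perm κ) :
    debiased n w (M.submatrix id τ) y (θ ∘ τ) = debiased n w M y θ ∘ τ := by
  have : (θ ∘ τ) ∘ τ.symm = θ := by ext; simp
  unfold debiased
  rw [Matrix.submatrix_mulVec_equiv, this]
  ext k
  simp [Matrix.mulVec, dotProduct]

/-- Interchange of the `j`-th feature with its knockoff. -/
abbrev swapFeature {p : ℕ} (j : Fin p) : Equiv.Perm (Fin p ⊕ Fin p) :=
  Equiv.swap (Sum.inl j) (Sum.inr j)

theorem featureStat_swapFeature {p : ℕ} (f : ℝ → ℝ → ℝ) (a : ℝ) (u : Fin p ⊕ Fin p → ℝ)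
    (j : Fin p) : featureStat f a (u ∘ swapFeature j) = flipSign j (featureStat f a u) := by
  ext k
  by_cases hk : k = j
  · subst hk; simp [flipSign_same, featureStat]
  · rw [flipSign_of_ne hk]
    simp only [featureStat, Function.comp_apply]
    rw [Equiv.swap_apply_of_ne_of_ne (by simpa using hk) (by simp),
      Equiv.swap_apply_of_ne_of_ne (by simp) (by simpa using hk)]

end LassoInvariance

section Exchangeability

variable {S : Setting} {n : ℕ}

/-- The permutation of the scalar inputs induced by a permutation of the features: it permutes the
columns of `[X X̃]` and the columns of `R` that multiply the corresponding rows of `w I`. -/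
def permEntries (τ : Equiv.Perm (Fin (S.p n) ⊕ Fin (S.p n))) : Equiv.Perm (EntryIndex S n) :=
  Equiv.sumCongr (Equiv.prodCongr (Equiv.refl _) τ)
    (Equiv.sumCongr (Equiv.refl _)
      (Equiv.prodCongr (Equiv.refl _) (Equiv.sumCongr (Equiv.refl _)
        (Equiv.sumCongr τ (Equiv.refl _)))))

theorem measurePreserving_permEntries (hS : S.Admissible)
    (τ : Equiv.Perm (Fin (S.p n) ⊕ Fin (S.p n))) :
    MeasurePreserving (fun e : EntryIndex S n → ℝ => e ∘ permEntries τ)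
      (Measure.pi (entryLaw S n)) (Measure.pi (entryLaw S n)) := by
  have := isProbabilityMeasure_entryLaw hS n
  refine measurePreserving_arrowCongr' (entryLaw S n) (entryLaw S n) (permEntries τ).symm
    (MeasurableEquiv.refl ℝ) fun i => ?_
  have : entryLaw S n ((permEntries τ).symm i) = entryLaw S n i := by
    rcases i with i | i | i <;> rfl
  rw [this]
  exact MeasurePreserving.id _

theorem privatizedDesign_permEntries (τ : Equiv.Perm (Fin (S.p n) ⊕ Fin (S.p n)))
    (e : EntryIndex S n → ℝ) :
    privatizedDesign S n (e ∘ permEntries τ) = (privatizedDesign S n e).submatrix id τ := by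
  ext a k
  simp [privatizedDesign, permEntries]

theorem privatizedResponse_swapFeature {j : Fin (S.p n)} (hj : S.θ₀ n j = 0)
    (e : EntryIndex S n → ℝ) :
    privatizedResponse S n (e ∘ permEntries (swapFeature j)) = privatizedResponse S n e := by
  ext a
  simp only [privatizedResponse, permEntries, Function.comp_apply, Equiv.sumCongr_apply,
    Sum.map_inr, Sum.map_inl, Equiv.prodCongr_apply, Prod.map_apply, Equiv.coe_refl, id]
  congr! 5 with i _ k
  by_cases hk : k = j
  · subst hk; simp [hj]
  · rw [Equiv.swap_apply_of_ne_of_ne (by simpa using hk) (by simp)]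

/-- Pairs of scalar inputs and a Lasso solution for them, restricted to inputs for which the
solution is unique; hence the graph of a partial function. -/
def lassoGraph (S : Setting) (C : ℝ) (n : ℕ) :
    Set ((EntryIndex S n → ℝ) × (Fin (S.p n) ⊕ Fin (S.p n) → ℝ)) :=
  {z | GeneralPosition (privatizedDesign S n z.1) ∧
    IsLassoSolution n (S.lam C n) (privatizedDesign S n z.1) (privatizedResponse S n z.1) z.2}

theorem measurableSet_lassoGraph (S : Setting) (C : ℝ) (n : ℕ) :
    MeasurableSet (lassoGraph S C n) := by
  have hdesign := continuous_privatizedDesign S n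
  have hresponse := continuous_privatizedResponse S n
  have hdata : Continuous fun z : (EntryIndex S n → ℝ) × (Fin (S.p n) ⊕ Fin (S.p n) → ℝ) =>
      (privatizedDesign S n z.1, privatizedResponse S n z.1, z.2) := by fun_prop
  exact (measurable_fst (measurableSet_generalPosition_privatizedDesign S n)).inter
    ((isClosed_isLassoSolution n (S.lam C n)).preimage hdata).measurableSet

theorem injOn_fst_lassoGraph (hS : S.Admissible) {C : ℝ} (hC : 0 < C) (hn : 0 < n) :
    Set.InjOn Prod.fst (lassoGraph S C n) := by
  rintro ⟨e, θ⟩ ⟨hgen, hθ⟩ ⟨e', θ'⟩ ⟨-, hθ'⟩ rfl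
  exact Prod.ext rfl (hgen.lasso_unique hn (hS.lam_pos hC hn) hθ hθ')

theorem swapFeature_mem_lassoGraph {C : ℝ} {j : Fin (S.p n)} (hj : S.θ₀ n j = 0)
    {e : EntryIndex S n → ℝ} {θ : Fin (S.p n) ⊕ Fin (S.p n) → ℝ}
    (hgen : GeneralPosition (privatizedDesign S n (e ∘ permEntries (swapFeature j))))
    (hθ : IsLassoSolution n (S.lam C n) (privatizedDesign S n e) (privatizedResponse S n e) θ) :
    (e ∘ permEntries (swapFeature j), θ ∘ swapFeature j) ∈ lassoGraph S C n := by
  refine ⟨hgen, ?_⟩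
  simp only [privatizedDesign_permEntries, privatizedResponse_swapFeature hj]
  exact hθ.submatrix _

/-- The feature statistics as a function of the scalar inputs and of the Lasso estimate. -/
def knockoffStat (S : Setting) (n : ℕ) (f : ℝ → ℝ → ℝ)
    (z : (EntryIndex S n → ℝ) × (Fin (S.p n) ⊕ Fin (S.p n) → ℝ)) : Fin (S.p n) → ℝ :=
  featureStat f (S.σ * S.ρ n)
    (debiased n (S.w n) (privatizedDesign S n z.1) (privatizedResponse S n z.1) z.2)

theorem IsFeatureFunction.continuous {f : ℝ → ℝ → ℝ} (hf : IsFeatureFunction f) (a : ℝ) :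
    Continuous fun x => f x a := by
  obtain ⟨L, -, hL⟩ := hf.lipschitz
  exact (hL a).continuous

theorem continuous_knockoffStat {f : ℝ → ℝ → ℝ} (hf : IsFeatureFunction f) :
    Continuous (knockoffStat S n f) := by
  have hdesign := continuous_privatizedDesign S n
  have hresponse := continuous_privatizedResponse S n
  have hdebiased (k) : Continuous fun z : (EntryIndex S n → ℝ) × _ =>
      debiased n (S.w n) (privatizedDesign S n z.1) (privatizedResponse S n z.1) z.2 k := by
    simp only [debiased]
    fun_prop
  exact continuous_pi fun j =>
    ((hf.continuous _).comp (hdebiased _)).sub ((hf.continuous _).comp (hdebiased _))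

theorem knockoffStat_swapFeature {j : Fin (S.p n)} (hj : S.θ₀ n j = 0) (f : ℝ → ℝ → ℝ)
    (e : EntryIndex S n → ℝ) (θ : Fin (S.p n) ⊕ Fin (S.p n) → ℝ) :
    knockoffStat S n f (e ∘ permEntries (swapFeature j), θ ∘ swapFeature j) =
      flipSign j (knockoffStat S n f (e, θ)) := by
  simp only [knockoffStat, privatizedDesign_permEntries, privatizedResponse_swapFeature hj,
    debiased_submatrix, featureStat_swapFeature]

end Exchangeability

section ModelFDR

variable {S : Setting} {n : ℕ} {Ω : Type*} {T : Sample S n Ω} {C : ℝ} {f : ℝ → ℝ → ℝ}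

theorem Sample.W_eq (T : Sample S n Ω) (f : ℝ → ℝ → ℝ) (ω : Ω) :
    T.W f ω = knockoffStat S n f (T.entryFun ω, T.θhat ω) := by
  simp only [Sample.W, knockoffStat, T.Xstar_eq, T.ystar_eq]

namespace Sample.IsModel

variable [MeasurableSpace Ω] {P : Measure Ω}

theorem aemeasurable_W (h : T.IsModel C P) (hf : IsFeatureFunction f) : AEMeasurable (T.W f) P := by
  have : T.W f = fun ω => knockoffStat S n f (T.entryFun ω, T.θhat ω) := funext (T.W_eq f)
  rw [this]
  exact (continuous_knockoffStat hf).measurable.comp_aemeasurable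
    (h.hasLaw_entryFun.aemeasurable.prodMk h.θhat_measurable.aemeasurable)

theorem ae_isLassoSolution (h : T.IsModel C P) :
    ∀ᵐ ω ∂P, IsLassoSolution n (S.lam C n) (privatizedDesign S n (T.entryFun ω))
      (privatizedResponse S n (T.entryFun ω)) (T.θhat ω) := by
  filter_upwards [h.θhat_lasso] with ω hω
  rwa [← T.Xstar_eq, ← T.ystar_eq]

theorem map_swapFeature (hS : S.Admissible) (hC : 0 < C) (hn : 0 < n) (h : T.IsModel C P)
    {j : Fin (S.p n)} (hj : S.θ₀ n j = 0) :
    P.map (fun ω => (T.entryFun ω ∘ permEntries (swapFeature j), T.θhat ω ∘ swapFeature j)) =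
      P.map fun ω => (T.entryFun ω, T.θhat ω) := by
  have hE := h.hasLaw_entryFun
  have hE' : HasLaw (fun ω => T.entryFun ω ∘ permEntries (swapFeature j))
      (Measure.pi (entryLaw S n)) P := (measurePreserving_permEntries hS _).fun_comp_hasLaw hE
  have hθ := h.θhat_measurable
  have hθ' : Measurable fun ω => T.θhat ω ∘ swapFeature j :=
    measurable_pi_lambda _ fun k => (measurable_pi_apply _).comp hθ
  have hgen := ae_generalPosition_privatizedDesign hS n
  have hmeas := measurableSet_setOfPred.1 (measurableSet_generalPosition_privatizedDesign S n)
  refine map_prodMk_eq_of_mem_graph hE'.aemeasurable hθ'.aemeasurable hE.aemeasurable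
    hθ.aemeasurable (hE'.map_eq.trans hE.map_eq.symm) (measurableSet_lassoGraph S C n)
    (injOn_fst_lassoGraph hS hC hn) ?_ ?_
  · filter_upwards [(hE'.ae_iff hmeas).2 hgen, h.ae_isLassoSolution] with ω hgenω hLasso
    exact swapFeature_mem_lassoGraph hj hgenω hLasso
  · filter_upwards [(hE.ae_iff hmeas).2 hgen, h.ae_isLassoSolution] with ω hgenω hLasso
    exact ⟨hgenω, hLasso⟩

theorem map_flipSign_W (hS : S.Admissible) (hC : 0 < C) (hn : 0 < n) (h : T.IsModel C P)
    (hf : IsFeatureFunction f) {j : Fin (S.p n)} (hj : S.θ₀ n j = 0) :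
    P.map (fun ω => flipSign j (T.W f ω)) = P.map (T.W f) := by
  have hstat := (continuous_knockoffStat (S := S) (n := n) hf).measurable
  have hpair := h.hasLaw_entryFun.aemeasurable.prodMk h.θhat_measurable.aemeasurable
  have hpair' : AEMeasurable (fun ω =>
      (T.entryFun ω ∘ permEntries (swapFeature j), T.θhat ω ∘ swapFeature j)) P :=
    .prodMk ((measurePreserving_permEntries hS _).measurable.comp_aemeasurable
      h.hasLaw_entryFun.aemeasurable) (measurable_pi_lambda _ fun k =>
        (measurable_pi_apply _).comp h.θhat_measurable).aemeasurable
  have hW : T.W f = knockoffStat S n f ∘ fun ω => (T.entryFun ω, T.θhat ω) := funext (T.W_eq f)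
  have hflipW : (fun ω => flipSign j (T.W f ω)) = knockoffStat S n f ∘ fun ω =>
      (T.entryFun ω ∘ permEntries (swapFeature j), T.θhat ω ∘ swapFeature j) := by
    ext1 ω
    rw [T.W_eq, Function.comp_apply, knockoffStat_swapFeature hj]
  rw [hflipW, hW, ← AEMeasurable.map_map_of_aemeasurable hstat.aemeasurable hpair',
    ← AEMeasurable.map_map_of_aemeasurable hstat.aemeasurable hpair,
    h.map_swapFeature hS hC hn hj]

theorem integral_fdp_le [IsProbabilityMeasure P] (hS : S.Admissible) (hC : 0 < C) (hn : 0 < n)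
    (h : T.IsModel C P) (hf : IsFeatureFunction f) {q : ℝ} (hq : 0 ≤ q) :
    ∫ ω, FDP (S.θ₀ n) (T.W f ω) (knockoffThreshold q (T.W f ω)) ∂P ≤ q :=
  integral_fdp_knockoffThreshold_le hq (h.aemeasurable_W hf) fun _ hj =>
    h.map_flipSign_W hS hC hn hf hj

end Sample.IsModel

end ModelFDR

/-! ### Second moments of independent sums -/

section IndependentSums

variable {I K : Type*} [Fintype I] [Fintype K]

theorem lintegral_sq_sum_eval_sub_le {α : I → Type*} [∀ i, MeasurableSpace (α i)]
    {μ : ∀ i, Measure (α i)} [∀ i, IsProbabilityMeasure (μ i)] {h : ∀ i, α i → ℝ}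
    (hh : ∀ i, MemLp (h i) 2 (μ i)) {V : I → ℝ} (hV : ∀ i, ∫ y, h i y ^ 2 ∂μ i ≤ V i) :
    ∫⁻ x, ENNReal.ofReal ((∑ i, h i (x i) - ∑ i, ∫ y, h i y ∂μ i) ^ 2) ∂Measure.pi μ ≤
      ENNReal.ofReal (∑ i, V i) := by
  have heval (i : I) := measurePreserving_eval μ i
  have hL (i : I) : MemLp (fun x : ∀ i, α i => h i (x i)) 2 (Measure.pi μ) :=
    (hh i).comp_measurePreserving (heval i)
  have hmean : ∫ x, (∑ i, fun x : ∀ i, α i => h i (x i)) x ∂Measure.pi μ =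
      ∑ i, ∫ y, h i y ∂μ i := by
    simp only [Finset.sum_apply]
    rw [integral_finsetSum _ fun i _ => (hL i).integrable one_le_two]
    exact Finset.sum_congr rfl fun i _ => integral_comp_eval (hh i).aestronglyMeasurable
  have hindep : iIndepFun (fun i (x : ∀ i, α i) => h i (x i)) (Measure.pi μ) :=
    iIndepFun_pi fun i => (hh i).aestronglyMeasurable.aemeasurable
  have hsum := memLp_finsetSum' Finset.univ fun i _ => hL i
  calc ∫⁻ x, ENNReal.ofReal ((∑ i, h i (x i) - ∑ i, ∫ y, h i y ∂μ i) ^ 2) ∂Measure.pi μ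
      = ENNReal.ofReal (variance (∑ i, fun x : ∀ i, α i => h i (x i)) (Measure.pi μ)) := by
        rw [ofReal_variance hsum, evariance_eq_lintegral_ofReal, hmean]
        simp only [Finset.sum_apply]
    _ ≤ ENNReal.ofReal (∑ i, V i) := by
        rw [IndepFun.variance_sum (fun i _ => hL i) fun i _ j _ hij => hindep.indepFun hij]
        refine ENNReal.ofReal_le_ofReal (Finset.sum_le_sum fun i _ => ?_)
        refine (variance_le_expectation_sq (hL i).aestronglyMeasurable).trans
          (le_of_eq_of_le ?_ (hV i))
        exact integral_comp_eval (f := fun y => h i y ^ 2) ((hh i).aestronglyMeasurable.fun_pow 2)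

theorem measurePreserving_curry {β : Type*} [MeasurableSpace β] (ν : Measure β) [SigmaFinite ν] :
    MeasurePreserving (Function.curry : (I × K → β) → I → K → β) (Measure.pi fun _ => ν)
      (Measure.pi fun _ => Measure.pi fun _ => ν) := by
  refine MeasurePreserving.symm (MeasurableEquiv.curry I K β).symm
    ⟨(MeasurableEquiv.curry I K β).symm.measurable, (Measure.pi_eq fun s _ => ?_).symm⟩
  rw [MeasurableEquiv.map_apply]
  have hpre : (MeasurableEquiv.curry I K β).symm ⁻¹' Set.univ.pi s =
      Set.univ.pi fun i => Set.univ.pi fun k => s (i, k) := by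
    ext f
    simp [MeasurableEquiv.curry, Set.mem_pi, Function.uncurry]
  rw [hpre, Measure.pi_pi, Fintype.prod_prod_type]
  exact Finset.prod_congr rfl fun i _ => Measure.pi_pi _ _

variable {ν : Measure ℝ} [IsProbabilityMeasure ν]

theorem lintegral_sq_sum_rows_sub_le {h : I → (K → ℝ) → ℝ}
    (hh : ∀ i, MemLp (h i) 2 (Measure.pi fun _ => ν)) {V : I → ℝ}
    (hV : ∀ i, ∫ x, h i x ^ 2 ∂Measure.pi (fun _ => ν) ≤ V i) :
    ∫⁻ c : I × K → ℝ, ENNReal.ofReal ((∑ i, h i (Function.curry c i) -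
        ∑ i, ∫ x, h i x ∂Measure.pi fun _ => ν) ^ 2) ∂Measure.pi (fun _ => ν) ≤
      ENNReal.ofReal (∑ i, V i) := by
  refine le_of_eq_of_le ?_ (lintegral_sq_sum_eval_sub_le hh hV)
  exact (measurePreserving_curry ν).lintegral_comp_emb
    (MeasurableEquiv.curry I K ℝ).measurableEmbedding fun x : I → K → ℝ =>
      ENNReal.ofReal ((∑ i, h i (x i) - ∑ i, ∫ y, h i y ∂Measure.pi fun _ => ν) ^ 2)

theorem memLp_eval_pi {q : ENNReal} (hν : MemLp id q ν) (k : K) :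
    MemLp (fun x : K → ℝ => x k) q (Measure.pi fun _ => ν) :=
  hν.comp_measurePreserving (measurePreserving_eval (fun _ => ν) k)

theorem integral_eval_mul_eval [DecidableEq K] (hmean : ∫ x, x ∂ν = 0) (k l : K) :
    ∫ x : K → ℝ, x k * x l ∂Measure.pi (fun _ => ν) = if k = l then ∫ x, x ^ 2 ∂ν else 0 := by
  split_ifs with h
  · subst h
    simp_rw [← sq]
    exact integral_comp_eval (μ := fun _ : K => ν) (f := fun x => x ^ 2)
      (by fun_prop)
  · have hindep : iIndepFun (fun (k : K) (x : K → ℝ) => x k) (Measure.pi fun _ => ν) :=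
      iIndepFun_pi (X := fun _ x => x) fun _ => aemeasurable_id
    rw [(hindep.indepFun h).integral_fun_mul_eq_mul_integral
      (measurable_pi_apply _).aestronglyMeasurable (measurable_pi_apply _).aestronglyMeasurable,
      integral_comp_eval (μ := fun _ : K => ν) (f := fun x => x) aestronglyMeasurable_id, hmean,
      zero_mul]

theorem integral_dotProduct_mul_dotProduct (hν : MemLp id 2 ν) (hmean : ∫ x, x ∂ν = 0)
    (u u' : K → ℝ) :
    ∫ x : K → ℝ, (x ⬝ᵥ u) * (x ⬝ᵥ u') ∂Measure.pi (fun _ => ν) =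
      (∫ x, x ^ 2 ∂ν) * (u ⬝ᵥ u') := by
  classical
  have hint (k l : K) : Integrable (fun x : K → ℝ => u k * u' l * (x k * x l))
      (Measure.pi fun _ => ν) :=
    ((memLp_eval_pi hν k).integrable_mul (memLp_eval_pi hν l)).const_mul _
  have hexpand (x : K → ℝ) :
      (x ⬝ᵥ u) * (x ⬝ᵥ u') = ∑ k, ∑ l, u k * u' l * (x k * x l) := by
    simp only [dotProduct, Finset.sum_mul_sum]
    exact Finset.sum_congr rfl fun k _ => Finset.sum_congr rfl fun l _ => by ring
  simp_rw [hexpand]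
  rw [integral_finsetSum _ fun k _ => integrable_finsetSum _ fun l _ => hint k l]
  simp_rw [integral_finsetSum _ fun l _ => hint _ l, integral_const_mul,
    integral_eval_mul_eval hmean]
  simp [dotProduct, Finset.sum_mul, mul_comm (∫ x, x ^ 2 ∂ν)]

end IndependentSums

/-! ### Gaussian random projections -/

/-- Fourth moment of the standard normal distribution. -/
def gaussFourth : ℝ := ∫ x, x ^ 4 ∂gaussianReal 0 1

theorem gaussFourth_nonneg : 0 ≤ gaussFourth :=
  integral_nonneg fun x => by positivity

theorem integral_pow_four_gaussianReal (v : NNReal) :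
    ∫ x, x ^ 4 ∂gaussianReal 0 v = (v : ℝ) ^ 2 * gaussFourth := by
  have h : gaussianReal 0 v = (gaussianReal 0 1).map (fun x => √(v : ℝ) * x) := by
    rw [gaussianReal_map_const_mul]
    congr 1
    · simp
    · ext; simp
  rw [h, integral_map (by fun_prop) (by fun_prop), gaussFourth, ← integral_const_mul]
  congr 1
  ext x
  rw [mul_pow, show √(v : ℝ) ^ 4 = (√(v : ℝ) ^ 2) ^ 2 by ring, Real.sq_sqrt v.coe_nonneg]

section GaussianVector

variable {I K : Type*} [Fintype I] [Fintype K] {v : NNReal}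

theorem integral_sq_gaussianReal (v : NNReal) : ∫ x, x ^ 2 ∂gaussianReal 0 v = v := by
  have h := variance_id_gaussianReal (μ := 0) (v := v)
  rw [variance_of_integral_eq_zero aemeasurable_id (by simp)] at h
  simpa using h

theorem hasGaussianLaw_dotProduct (v : NNReal) (u : K → ℝ) :
    HasGaussianLaw (fun x : K → ℝ => x ⬝ᵥ u) (Measure.pi fun _ => gaussianReal 0 v) := by
  have hlaw (k : K) : HasLaw (fun x : K → ℝ => x k) (gaussianReal 0 v)
      (Measure.pi fun _ => gaussianReal 0 v) :=
    (measurePreserving_eval (fun _ : K => gaussianReal 0 v) k).hasLaw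
  refine iIndepFun.hasGaussianLaw_fun_sum (fun k => ⟨?_⟩)
    (iIndepFun_pi (X := fun k x => x * u k) fun k => by fun_prop)
  rw [(gaussianReal_mul_const (hlaw k) (u k)).map_eq]
  infer_instance

theorem hasLaw_dotProduct (v : NNReal) (u : K → ℝ) :
    HasLaw (fun x : K → ℝ => x ⬝ᵥ u) (gaussianReal 0 (v * (u ⬝ᵥ u)).toNNReal)
      (Measure.pi fun _ => gaussianReal 0 v) := by
  have hG := hasGaussianLaw_dotProduct v u
  have hmean : ∫ x : K → ℝ, x ⬝ᵥ u ∂Measure.pi (fun _ => gaussianReal 0 v) = 0 := by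
    simp only [dotProduct]
    rw [integral_finsetSum _ fun k _ =>
      ((memLp_eval_pi (memLp_id_gaussianReal 1) k).integrable le_rfl).mul_const _]
    refine Finset.sum_eq_zero fun k _ => ?_
    rw [integral_mul_const, integral_comp_eval (μ := fun _ : K => gaussianReal 0 v)
      (f := fun x => x) aestronglyMeasurable_id, integral_id_gaussianReal, zero_mul]
  refine ⟨hG.aemeasurable, ?_⟩
  rw [hG.map_eq_gaussianReal, hmean, variance_of_integral_eq_zero hG.aemeasurable hmean]
  simp_rw [sq]
  rw [integral_dotProduct_mul_dotProduct (memLp_id_gaussianReal 2) integral_id_gaussianReal,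
    integral_sq_gaussianReal]

theorem memLp_dotProduct (v : NNReal) (u : K → ℝ) {q : ENNReal} (hq : q ≠ ⊤) :
    MemLp (fun x : K → ℝ => x ⬝ᵥ u) q (Measure.pi fun _ => gaussianReal 0 v) :=
  (hasGaussianLaw_dotProduct v u).memLp hq

theorem memLp_dotProduct_mul_dotProduct (v : NNReal) (u u' : K → ℝ) :
    MemLp (fun x : K → ℝ => (x ⬝ᵥ u) * (x ⬝ᵥ u')) 2 (Measure.pi fun _ => gaussianReal 0 v) := by
  have : ENNReal.HolderTriple 4 4 2 := ⟨by
    rw [← two_mul, show (4 : ENNReal) = 2 * 2 by norm_num,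
      ENNReal.mul_inv (by simp) (by simp), ← mul_assoc, ENNReal.mul_inv_cancel (by simp) (by simp),
      one_mul]⟩
  exact (memLp_dotProduct v u' (q := 4) (by simp)).mul' (memLp_dotProduct v u (q := 4) (by simp))

theorem integrable_dotProduct_pow_four (v : NNReal) (u : K → ℝ) :
    Integrable (fun x : K → ℝ => (x ⬝ᵥ u) ^ 4) (Measure.pi fun _ => gaussianReal 0 v) := by
  refine (memLp_dotProduct_mul_dotProduct v u u).integrable_sq.congr (ae_of_all _ fun x => ?_)
  ring

theorem integral_dotProduct_pow_four (v : NNReal) (u : K → ℝ) :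
    ∫ x : K → ℝ, (x ⬝ᵥ u) ^ 4 ∂Measure.pi (fun _ => gaussianReal 0 v) =
      (v * (u ⬝ᵥ u)) ^ 2 * gaussFourth := by
  have h := (hasLaw_dotProduct v u).integral_comp (f := fun x : ℝ => x ^ 4) (by fun_prop)
  simp only [Function.comp_def] at h
  have hnonneg : 0 ≤ u ⬝ᵥ u := Finset.sum_nonneg fun k _ => mul_self_nonneg _
  rw [h, integral_pow_four_gaussianReal, Real.coe_toNNReal _ (by positivity)]

theorem integral_sq_dotProduct_mul_dotProduct_le (v : NNReal) (u u' : K → ℝ) :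
    ∫ x : K → ℝ, ((x ⬝ᵥ u) * (x ⬝ᵥ u')) ^ 2 ∂Measure.pi (fun _ => gaussianReal 0 v) ≤
      gaussFourth * v ^ 2 * ((u ⬝ᵥ u) * (u' ⬝ᵥ u')) := by
  have hA : 0 ≤ u ⬝ᵥ u := Finset.sum_nonneg fun k _ => mul_self_nonneg _
  have hB : 0 ≤ u' ⬝ᵥ u' := Finset.sum_nonneg fun k _ => mul_self_nonneg _
  rcases hA.eq_or_lt with h0 | hA
  · simp [dotProduct_self_eq_zero.1 h0.symm]
  rcases hB.eq_or_lt with h0 | hB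
  · simp [dotProduct_self_eq_zero.1 h0.symm]
  set A := u ⬝ᵥ u
  set B := u' ⬝ᵥ u'
  have hu := integrable_dotProduct_pow_four v u
  have hu' := integrable_dotProduct_pow_four v u'
  have weighted_am_gm (s t : ℝ) : (s * t) ^ 2 ≤ B / (2 * A) * s ^ 4 + A / (2 * B) * t ^ 4 := by
    have hid : B / (2 * A) * s ^ 4 + A / (2 * B) * t ^ 4 - (s * t) ^ 2 =
        (B * s ^ 2 - A * t ^ 2) ^ 2 / (2 * A * B) := by
      field_simp; ring
    rw [← sub_nonneg, hid]
    positivity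
  calc ∫ x : K → ℝ, ((x ⬝ᵥ u) * (x ⬝ᵥ u')) ^ 2 ∂Measure.pi (fun _ => gaussianReal 0 v)
      ≤ ∫ x : K → ℝ, (B / (2 * A) * (x ⬝ᵥ u) ^ 4 + A / (2 * B) * (x ⬝ᵥ u') ^ 4)
          ∂Measure.pi (fun _ => gaussianReal 0 v) :=
        integral_mono (memLp_dotProduct_mul_dotProduct v u u').integrable_sq
          ((hu.const_mul _).add (hu'.const_mul _)) fun x => weighted_am_gm _ _
    _ = gaussFourth * v ^ 2 * (A * B) := by
        rw [integral_add (hu.const_mul _) (hu'.const_mul _), integral_const_mul,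
          integral_const_mul, integral_dotProduct_pow_four, integral_dotProduct_pow_four]
        field_simp
        ring

theorem lintegral_sq_projection_sub_le [Nonempty I] (hv : (v : ℝ) = 1 / Fintype.card I)
    (u u' : K → ℝ) :
    ∫⁻ c : I × K → ℝ, ENNReal.ofReal ((∑ i, (Function.curry c i ⬝ᵥ u) *
        (Function.curry c i ⬝ᵥ u') - u ⬝ᵥ u') ^ 2) ∂Measure.pi (fun _ => gaussianReal 0 v) ≤
      ENNReal.ofReal (gaussFourth / Fintype.card I * ((u ⬝ᵥ u) * (u' ⬝ᵥ u'))) := by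
  have h := lintegral_sq_sum_rows_sub_le (I := I)
    (fun _ => memLp_dotProduct_mul_dotProduct v u u')
    (fun _ => integral_sq_dotProduct_mul_dotProduct_le v u u')
  rw [integral_dotProduct_mul_dotProduct (memLp_id_gaussianReal 2) integral_id_gaussianReal,
    integral_sq_gaussianReal, hv] at h
  simp only [Finset.sum_const, Finset.card_univ, nsmul_eq_mul] at h
  convert h using 2
  · field_simp
  · field_simp

end GaussianVector

/-! ### Mean-square size of the noise term and of the error of the Gram matrix -/

section ErrorTerms

variable {ρ κ : Type*} [Fintype ρ]

/-- The correction that debiasing adds to `θ`. At the true coefficients it is pure noise: it is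
the part of the error of the debiased Lasso that does not involve the Lasso. -/
def noiseTerm [Fintype κ] (n : ℕ) (w : ℝ) (M : Matrix ρ κ ℝ) (y : ρ → ℝ) (θ : κ → ℝ) : κ → ℝ :=
  (1 / (n : ℝ)) • M.transpose.mulVec (y - M.mulVec θ) + (w ^ 2 / (n : ℝ)) • θ

theorem noiseTerm_apply [Fintype κ] (n : ℕ) (w : ℝ) (M : Matrix ρ κ ℝ) (y : ρ → ℝ) (θ : κ → ℝ)
    (k : κ) :
    noiseTerm n w M y θ k =
      1 / (n : ℝ) * ∑ a, M a k * (y - M.mulVec θ) a + w ^ 2 / n * θ k :=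
  rfl

/-- Deviation of the normalized Gram matrix from its expectation `(1 + w² / n) I`. -/
def gramError [DecidableEq κ] (n : ℕ) (w : ℝ) (M : Matrix ρ κ ℝ) : Matrix κ κ ℝ :=
  (1 + w ^ 2 / (n : ℝ)) • 1 - (1 / (n : ℝ)) • (M.transpose * M)

theorem gramError_apply [DecidableEq κ] (n : ℕ) (w : ℝ) (M : Matrix ρ κ ℝ) (k l : κ) :
    gramError n w M k l =
      (1 + w ^ 2 / (n : ℝ)) * (if k = l then 1 else 0) - 1 / (n : ℝ) * ∑ a, M a k * M a l := by
  simp [gramError, Matrix.mul_apply, Matrix.one_apply]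

end ErrorTerms

section Integrals

theorem lintegral_ofReal_mul_add_le {α : Type*} [MeasurableSpace α] {μ : Measure α}
    [IsProbabilityMeasure μ] {g : α → ℝ} (hg : Measurable g) (hg0 : ∀ x, 0 ≤ g x) {A B m : ℝ}
    (hA : 0 ≤ A) (hB : 0 ≤ B) (hm : 0 ≤ m)
    (h : ∫⁻ x, ENNReal.ofReal (g x) ∂μ ≤ ENNReal.ofReal m) :
    ∫⁻ x, ENNReal.ofReal (A * g x + B) ∂μ ≤ ENNReal.ofReal (A * m + B) := by
  simp_rw [fun x => ENNReal.ofReal_add (mul_nonneg hA (hg0 x)) hB, ENNReal.ofReal_mul hA]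
  rw [lintegral_add_right _ measurable_const, lintegral_const_mul _ hg.ennreal_ofReal,
    lintegral_const, measure_univ, mul_one, ENNReal.ofReal_add (mul_nonneg hA hm) hB,
    ENNReal.ofReal_mul hA]
  gcongr

theorem lintegral_sum_eval_pi {I : Type*} [Fintype I] {β : Type*} [MeasurableSpace β]
    (ν : Measure β) [IsProbabilityMeasure ν] {g : β → ENNReal} (hg : Measurable g) :
    ∫⁻ x : I → β, ∑ i, g (x i) ∂Measure.pi (fun _ => ν) = Fintype.card I * ∫⁻ x, g x ∂ν := by
  rw [lintegral_finsetSum _ fun i _ => show Measurable fun x : I → β => g (x i) by fun_prop]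
  simp_rw [fun i : I => (measurePreserving_eval (fun _ : I => ν) i).lintegral_comp hg]
  simp

theorem lintegral_cond_sublevel_le {α : Type*} [MeasurableSpace α] (μ : Measure α)
    [IsProbabilityMeasure μ] {g : α → ENNReal} (hg : Measurable g) (t : ENNReal) :
    ∫⁻ x, g x ∂μ[|{x | g x ≤ t}] ≤ ∫⁻ x, g x ∂μ := by
  set s := {x | g x ≤ t}
  have hs : MeasurableSet s := measurableSet_le hg measurable_const
  have hbelow : ∫⁻ x in s, g x ∂μ ≤ t * μ s := by
    rw [← setLIntegral_const]
    exact setLIntegral_mono measurable_const fun x hx => hx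
  have habove : t * μ sᶜ ≤ ∫⁻ x in sᶜ, g x ∂μ := by
    rw [← setLIntegral_const]
    exact setLIntegral_mono hg fun x hx =>
      (not_le.1 (show ¬ g x ≤ t from hx)).le
  rw [ProbabilityTheory.cond, lintegral_smul_measure, smul_eq_mul, mul_comm, ← div_eq_mul_inv]
  refine ENNReal.div_le_of_le_mul ?_
  calc ∫⁻ x in s, g x ∂μ = (μ s + μ sᶜ) * ∫⁻ x in s, g x ∂μ := by
        rw [measure_add_measure_compl hs, measure_univ, one_mul]
    _ ≤ μ s * (∫⁻ x in s, g x ∂μ) + μ sᶜ * (t * μ s) := by rw [add_mul]; gcongr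
    _ = μ s * (∫⁻ x in s, g x ∂μ) + μ s * (t * μ sᶜ) := by ring
    _ ≤ μ s * (∫⁻ x in s, g x ∂μ) + μ s * ∫⁻ x in sᶜ, g x ∂μ := by gcongr
    _ = (∫⁻ x, g x ∂μ) * μ s := by
        rw [← mul_add, lintegral_add_compl _ hs, mul_comm]

end Integrals

namespace Setting

variable {S : Setting}

theorem lintegral_sq_noiseLaw_le (S : Setting) (n : ℕ) :
    ∫⁻ x, ENNReal.ofReal (x ^ 2) ∂S.noiseLaw n ≤ ENNReal.ofReal (S.σ ^ 2) := by
  by_cases hbn : 0 ≤ S.bn n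
  · have hset : Set.Icc (-S.bn n) (S.bn n) =
        {x | ENNReal.ofReal (x ^ 2) ≤ ENNReal.ofReal (S.bn n ^ 2)} := by
      ext x
      rw [Set.mem_Icc, ← abs_le, Set.mem_ofPred_eq, ENNReal.ofReal_le_ofReal_iff (sq_nonneg _),
        sq_le_sq, abs_of_nonneg hbn]
    rw [noiseLaw, hset]
    refine (lintegral_cond_sublevel_le _ (by fun_prop) _).trans_eq ?_
    have hint : Integrable (fun x => x ^ 2) (gaussianReal 0 (S.σ ^ 2).toNNReal) :=
      (memLp_id_gaussianReal 2).integrable_sq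
    rw [← ofReal_integral_eq_lintegral_ofReal hint (ae_of_all _ fun x => sq_nonneg x)]
    simp [integral_sq_gaussianReal, sq_nonneg]
  · simp [noiseLaw, Set.Icc_eq_empty (show ¬ -S.bn n ≤ S.bn n by linarith)]

namespace Admissible

theorem memLp_D (hS : S.Admissible) (q : ENNReal) : MemLp id q S.D := by
  have := hS.D_prob
  exact MemLp.of_bound aestronglyMeasurable_id S.b hS.D_bdd

variable {I K : Type*} [Fintype I] [Fintype K]

theorem ae_abs_le_b (hS : S.Admissible) :
    ∀ᵐ a ∂(Measure.pi fun _ : K => S.D), ∀ k, |a k| ≤ S.b := by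
  have := hS.D_prob
  exact ae_all_iff.2 fun k =>
    (Measure.quasiMeasurePreserving_eval (fun _ : K => S.D) k).ae hS.D_bdd

theorem lintegral_sq_gram_sub_le [DecidableEq K] (hS : S.Admissible) (k l : K) :
    ∫⁻ a, ENNReal.ofReal ((∑ i : I, a (i, k) * a (i, l) -
        Fintype.card I * (if k = l then 1 else 0)) ^ 2) ∂(Measure.pi fun _ : I × K => S.D) ≤
      ENNReal.ofReal (Fintype.card I * S.b ^ 4) := by
  have := hS.D_prob
  have hbdd : ∀ᵐ x ∂(Measure.pi fun _ : K => S.D), |x k * x l| ≤ S.b ^ 2 := by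
    filter_upwards [hS.ae_abs_le_b] with x hx
    rw [abs_mul, sq]
    exact mul_le_mul (hx _) (hx _) (abs_nonneg _) (zero_le_one.trans hS.one_le_b)
  have hmem : MemLp (fun x : K → ℝ => x k * x l) 2 (Measure.pi fun _ => S.D) :=
    MemLp.of_bound (by fun_prop) _ hbdd
  have hsecond : ∫ x : K → ℝ, (x k * x l) ^ 2 ∂Measure.pi (fun _ => S.D) ≤ S.b ^ 4 := by
    calc ∫ x : K → ℝ, (x k * x l) ^ 2 ∂Measure.pi (fun _ => S.D)
        ≤ ∫ _ : K → ℝ, S.b ^ 4 ∂Measure.pi (fun _ => S.D) := by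
          refine integral_mono_ae hmem.integrable_sq (integrable_const _) ?_
          filter_upwards [hbdd] with x hx
          calc (x k * x l) ^ 2 = |x k * x l| ^ 2 := (sq_abs _).symm
            _ ≤ (S.b ^ 2) ^ 2 := by gcongr
            _ = S.b ^ 4 := by ring
      _ = S.b ^ 4 := by simp
  have h := lintegral_sq_sum_rows_sub_le (I := I) (fun _ => hmem) fun _ => hsecond
  rw [integral_eval_mul_eval hS.D_mean, hS.integral_sq_D] at h
  simpa using h

theorem lintegral_sq_corr_le (hS : S.Admissible) (k : K) (x : I → ℝ) :
    ∫⁻ a, ENNReal.ofReal ((∑ i : I, a (i, k) * x i) ^ 2) ∂(Measure.pi fun _ : I × K => S.D) ≤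
      ENNReal.ofReal (∑ i, x i ^ 2) := by
  classical
  have := hS.D_prob
  have hmem (i : I) : MemLp (fun a : K → ℝ => a k * x i) 2 (Measure.pi fun _ => S.D) :=
    (memLp_eval_pi (hS.memLp_D 2) k).mul_const (x i)
  have hsecond (i : I) : ∫ a : K → ℝ, (a k * x i) ^ 2 ∂Measure.pi (fun _ => S.D) ≤ x i ^ 2 := by
    simp_rw [mul_pow, sq (_ : ℝ)]
    rw [integral_mul_const, integral_eval_mul_eval hS.D_mean, hS.integral_sq_D]
    simp
  have h := lintegral_sq_sum_rows_sub_le hmem hsecond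
  simp_rw [integral_mul_const, integral_comp_eval (μ := fun _ : K => S.D) (f := fun x => x)
    aestronglyMeasurable_id, hS.D_mean] at h
  simpa using h

end Admissible

end Setting

section ModelMoments

variable {S : Setting} {n : ℕ}

/-- True coefficients, extended by zero to the knockoffs. -/
def Setting.θext (S : Setting) (n : ℕ) : Fin (S.p n) ⊕ Fin (S.p n) → ℝ :=
  Sum.elim (S.θ₀ n) fun _ => 0

theorem Setting.Admissible.sum_sq_θext (hS : S.Admissible) (n : ℕ) :
    ∑ k, S.θext n k ^ 2 = 1 := by
  simp [Setting.θext, Fintype.sum_sum_type, hS.θ₀_norm n]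

/-- Column `k` of `[X X̃]` followed by the rows that the privatization appends, for
the design `a`. -/
def augCol (S : Setting) (n : ℕ) (a : Fin n × (Fin (S.p n) ⊕ Fin (S.p n)) → ℝ)
    (k : Fin (S.p n) ⊕ Fin (S.p n)) : Fin n ⊕ ((Fin (S.p n) ⊕ Fin (S.p n)) ⊕ Unit) → ℝ :=
  Sum.elim (fun i => a (i, k)) (Sum.elim (S.w n • Pi.single k 1) 0)

/-- Residual of the response, with the rows appended by the privatization, at the true
coefficients and the noise `b`. -/
def augResidual (S : Setting) (n : ℕ) (b : Fin n → ℝ) :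
    Fin n ⊕ ((Fin (S.p n) ⊕ Fin (S.p n)) ⊕ Unit) → ℝ :=
  Sum.elim b (Sum.elim (-(S.w n • S.θext n)) fun _ => S.w n)

variable (a : Fin n × (Fin (S.p n) ⊕ Fin (S.p n)) → ℝ) (b : Fin n → ℝ)
  (c : Fin (S.r n) × (Fin n ⊕ ((Fin (S.p n) ⊕ Fin (S.p n)) ⊕ Unit)) → ℝ)

theorem privatizedDesign_apply_eq_dotProduct (i : Fin (S.r n)) (k : Fin (S.p n) ⊕ Fin (S.p n)) :
    privatizedDesign S n (Sum.elim a (Sum.elim b c)) i k =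
      Function.curry c i ⬝ᵥ augCol S n a k := by
  simp [privatizedDesign, dotProduct, augCol, Fintype.sum_sum_type, Pi.single_apply, mul_comm]

theorem privatizedResponse_sub_mulVec_eq_dotProduct (i : Fin (S.r n)) :
    (privatizedResponse S n (Sum.elim a (Sum.elim b c)) -
        (privatizedDesign S n (Sum.elim a (Sum.elim b c))).mulVec (S.θext n)) i =
      Function.curry c i ⬝ᵥ augResidual S n b := by
  simp only [privatizedResponse, privatizedDesign, Matrix.mulVec, dotProduct, augResidual,
    Setting.θext, Fintype.sum_sum_type, Pi.sub_apply, Pi.neg_apply, Pi.smul_apply, smul_eq_mul,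
    Matrix.of_apply, Sum.elim_inl, Sum.elim_inr, Function.curry_apply, add_mul, mul_add, mul_zero,
    Finset.sum_const_zero, add_zero, Finset.sum_add_distrib, Finset.sum_mul,
    Finset.mul_sum, Finset.univ_unique, Finset.sum_singleton, mul_neg, Finset.sum_neg_distrib]
  rw [Finset.sum_comm]
  simp only [mul_assoc, mul_comm, mul_left_comm]
  ring

theorem augCol_dotProduct_augCol (k l : Fin (S.p n) ⊕ Fin (S.p n)) :
    augCol S n a k ⬝ᵥ augCol S n a l =
      ∑ i, a (i, k) * a (i, l) + S.w n ^ 2 * if k = l then 1 else 0 := by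
  simp [augCol, dotProduct, Fintype.sum_sum_type (α₁ := Fin n), Pi.single_apply, eq_comm, sq]

theorem augCol_dotProduct_augResidual (k : Fin (S.p n) ⊕ Fin (S.p n)) :
    augCol S n a k ⬝ᵥ augResidual S n b = ∑ i, a (i, k) * b i - S.w n ^ 2 * S.θext n k := by
  simp [augCol, augResidual, dotProduct, Fintype.sum_sum_type (α₁ := Fin n), Pi.single_apply]
  ring

theorem augResidual_dotProduct_self (hS : S.Admissible) :
    augResidual S n b ⬝ᵥ augResidual S n b = ∑ i, b i ^ 2 + 2 * S.w n ^ 2 := by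
  have hθ : ∑ k, S.w n * S.θext n k * (S.w n * S.θext n k) = S.w n ^ 2 := by
    rw [← mul_one (S.w n ^ 2), ← hS.sum_sq_θext n, Finset.mul_sum]
    exact Finset.sum_congr rfl fun k _ => by ring
  simp only [augResidual, dotProduct, Fintype.sum_sum_type (α₁ := Fin n),
    Fintype.sum_sum_type (α₂ := Unit), Sum.elim_inl, Sum.elim_inr, Pi.neg_apply, Pi.smul_apply,
    smul_eq_mul, neg_mul_neg, hθ, Finset.univ_unique, Finset.sum_singleton]
  simp only [sq, two_mul]

variable {a}

theorem augCol_dotProduct_self_le (ha : ∀ q, |a q| ≤ S.b) (k : Fin (S.p n) ⊕ Fin (S.p n)) :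
    augCol S n a k ⬝ᵥ augCol S n a k ≤ n * S.b ^ 2 + S.w n ^ 2 := by
  have hcol : ∑ i, a (i, k) * a (i, k) ≤ n * S.b ^ 2 := by
    calc ∑ i, a (i, k) * a (i, k) ≤ ∑ _i : Fin n, S.b ^ 2 :=
          Finset.sum_le_sum fun i _ => by
            rw [← sq, ← sq_abs]
            gcongr
            exact ha _
      _ = n * S.b ^ 2 := by simp
  simpa [augCol_dotProduct_augCol] using hcol

variable (a)

theorem lintegral_sq_projected_add_le (hS : S.Admissible) (n : ℕ)
    (u u' : Fin n ⊕ ((Fin (S.p n) ⊕ Fin (S.p n)) ⊕ Unit) → ℝ) (Y : ℝ) :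
    ∫⁻ c : Fin (S.r n) × (Fin n ⊕ ((Fin (S.p n) ⊕ Fin (S.p n)) ⊕ Unit)) → ℝ,
        ENNReal.ofReal ((1 / (n : ℝ) * (∑ i, (Function.curry c i ⬝ᵥ u) *
          (Function.curry c i ⬝ᵥ u') - u ⬝ᵥ u' + Y)) ^ 2) ∂Measure.pi (fun _ => S.projLaw n) ≤
      ENNReal.ofReal (2 / (n : ℝ) ^ 2 * Y ^ 2 +
        2 / (n : ℝ) ^ 2 * (gaussFourth / S.r n * ((u ⬝ᵥ u) * (u' ⬝ᵥ u')))) := by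
  have : Nonempty (Fin (S.r n)) := ⟨⟨0, hS.r_pos n⟩⟩
  have h4 := gaussFourth_nonneg
  have huu (v : Fin n ⊕ ((Fin (S.p n) ⊕ Fin (S.p n)) ⊕ Unit) → ℝ) : 0 ≤ v ⬝ᵥ v :=
    Finset.sum_nonneg fun _ _ => mul_self_nonneg _
  have hproj : ∫⁻ c : Fin (S.r n) × (Fin n ⊕ ((Fin (S.p n) ⊕ Fin (S.p n)) ⊕ Unit)) → ℝ,
      ENNReal.ofReal ((∑ i, (Function.curry c i ⬝ᵥ u) * (Function.curry c i ⬝ᵥ u') -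
        u ⬝ᵥ u') ^ 2) ∂Measure.pi (fun _ => S.projLaw n) ≤
      ENNReal.ofReal (gaussFourth / S.r n * ((u ⬝ᵥ u) * (u' ⬝ᵥ u'))) := by
    have hcard : ((1 / S.r n : NNReal) : ℝ) = 1 / Fintype.card (Fin (S.r n)) := by simp
    simpa only [Fintype.card_fin, Setting.projLaw] using
      lintegral_sq_projection_sub_le (I := Fin (S.r n)) hcard u u'
  rw [add_comm (2 / (n : ℝ) ^ 2 * Y ^ 2)]
  refine (lintegral_mono fun c => ENNReal.ofReal_le_ofReal ?_).trans
    (lintegral_ofReal_mul_add_le (A := 2 / (n : ℝ) ^ 2) (B := 2 / (n : ℝ) ^ 2 * Y ^ 2) ?_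
      (fun _ => sq_nonneg _) (by positivity) (by positivity) ?_ hproj)
  · calc _ = 1 / (n : ℝ) ^ 2 * (_ + Y) ^ 2 := by rw [mul_pow, div_pow, one_pow]
      _ ≤ 1 / (n : ℝ) ^ 2 * (2 * (_ ^ 2 + Y ^ 2)) := by gcongr; exact add_sq_le
      _ = _ := by ring
  · simp only [dotProduct, Function.curry_apply]
    fun_prop
  · have := huu u
    have := huu u'
    positivity

variable {a}

theorem lintegral_sq_gramError_proj_le (hS : S.Admissible) (hn : 0 < n) (ha : ∀ q, |a q| ≤ S.b)
    (k l : Fin (S.p n) ⊕ Fin (S.p n)) :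
    ∫⁻ c, ENNReal.ofReal (gramError n (S.w n)
        (privatizedDesign S n (Sum.elim a (Sum.elim b c))) k l ^ 2)
        ∂Measure.pi (fun _ => S.projLaw n) ≤
      ENNReal.ofReal (2 / (n : ℝ) ^ 2 *
          (∑ i, a (i, k) * a (i, l) - n * (if k = l then 1 else 0)) ^ 2 +
        2 / (n : ℝ) ^ 2 * (gaussFourth / S.r n * (n * S.b ^ 2 + S.w n ^ 2) ^ 2)) := by
  have hn' : (n : ℝ) ≠ 0 := by exact_mod_cast hn.ne'
  have h4 := gaussFourth_nonneg
  have herror (c) : gramError n (S.w n) (privatizedDesign S n (Sum.elim a (Sum.elim b c))) k l ^ 2 =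
      (1 / (n : ℝ) * (∑ i, (Function.curry c i ⬝ᵥ augCol S n a k) *
        (Function.curry c i ⬝ᵥ augCol S n a l) - augCol S n a k ⬝ᵥ augCol S n a l +
        (∑ i, a (i, k) * a (i, l) - n * (if k = l then 1 else 0)))) ^ 2 := by
    rw [gramError_apply, augCol_dotProduct_augCol, ← neg_sq]
    simp only [privatizedDesign_apply_eq_dotProduct]
    congr 1
    field_simp
    ring
  simp_rw [herror]
  refine (lintegral_sq_projected_add_le hS n _ _ _).trans (ENNReal.ofReal_le_ofReal ?_)
  rw [sq (n * S.b ^ 2 + S.w n ^ 2)]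
  have h0 : 0 ≤ augCol S n a l ⬝ᵥ augCol S n a l :=
    Finset.sum_nonneg fun _ _ => mul_self_nonneg _
  gcongr <;> exact augCol_dotProduct_self_le ha _

theorem lintegral_sq_noiseTerm_proj_le (hS : S.Admissible) (hn : 0 < n) (ha : ∀ q, |a q| ≤ S.b)
    (k : Fin (S.p n) ⊕ Fin (S.p n)) :
    ∫⁻ c, ENNReal.ofReal (noiseTerm n (S.w n)
        (privatizedDesign S n (Sum.elim a (Sum.elim b c)))
        (privatizedResponse S n (Sum.elim a (Sum.elim b c))) (S.θext n) k ^ 2)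
        ∂Measure.pi (fun _ => S.projLaw n) ≤
      ENNReal.ofReal (2 / (n : ℝ) ^ 2 * (∑ i, a (i, k) * b i) ^ 2 +
        2 / (n : ℝ) ^ 2 * (gaussFourth / S.r n *
          ((n * S.b ^ 2 + S.w n ^ 2) * (∑ i, b i ^ 2 + 2 * S.w n ^ 2)))) := by
  have hn' : (n : ℝ) ≠ 0 := by exact_mod_cast hn.ne'
  have h4 := gaussFourth_nonneg
  have hnoise (c) : noiseTerm n (S.w n) (privatizedDesign S n (Sum.elim a (Sum.elim b c)))
        (privatizedResponse S n (Sum.elim a (Sum.elim b c))) (S.θext n) k =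
      1 / (n : ℝ) * (∑ i, (Function.curry c i ⬝ᵥ augCol S n a k) *
        (Function.curry c i ⬝ᵥ augResidual S n b) - augCol S n a k ⬝ᵥ augResidual S n b +
        ∑ i, a (i, k) * b i) := by
    rw [noiseTerm_apply, augCol_dotProduct_augResidual]
    simp only [privatizedDesign_apply_eq_dotProduct, privatizedResponse_sub_mulVec_eq_dotProduct]
    field_simp
    ring
  simp_rw [hnoise]
  refine (lintegral_sq_projected_add_le hS n _ _ _).trans (ENNReal.ofReal_le_ofReal ?_)
  rw [augResidual_dotProduct_self b hS]
  gcongr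
  exact augCol_dotProduct_self_le ha k

theorem measurable_gramError_privatizedDesign (k l : Fin (S.p n) ⊕ Fin (S.p n)) :
    Measurable fun e => gramError n (S.w n) (privatizedDesign S n e) k l := by
  have := continuous_privatizedDesign S n
  refine Continuous.measurable ?_
  unfold gramError
  fun_prop

theorem measurable_noiseTerm_privatized (k : Fin (S.p n) ⊕ Fin (S.p n)) :
    Measurable fun e => noiseTerm n (S.w n) (privatizedDesign S n e) (privatizedResponse S n e)
      (S.θext n) k := by
  have := continuous_privatizedDesign S n
  have := continuous_privatizedResponse S n
  refine Continuous.measurable ?_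
  unfold noiseTerm
  fun_prop

theorem lintegral_sq_gramError_le (hS : S.Admissible) (hn : 0 < n)
    (k l : Fin (S.p n) ⊕ Fin (S.p n)) :
    ∫⁻ e, ENNReal.ofReal (gramError n (S.w n) (privatizedDesign S n e) k l ^ 2)
        ∂Measure.pi (entryLaw S n) ≤
      ENNReal.ofReal (2 / (n : ℝ) ^ 2 * (n * S.b ^ 4) +
        2 / (n : ℝ) ^ 2 * (gaussFourth / S.r n * (n * S.b ^ 2 + S.w n ^ 2) ^ 2)) := by
  have := hS.D_prob
  have := hS.isProbabilityMeasure_noiseLaw n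
  have h4 := gaussFourth_nonneg
  have hgram := hS.lintegral_sq_gram_sub_le (I := Fin n) k l
  rw [Fintype.card_fin] at hgram
  rw [lintegral_entries hS n
    ((measurable_gramError_privatizedDesign k l).pow_const 2).ennreal_ofReal]
  calc _ ≤ ∫⁻ a, ∫⁻ _b : Fin n → ℝ, ENNReal.ofReal (2 / (n : ℝ) ^ 2 *
          (∑ i, a (i, k) * a (i, l) - n * (if k = l then 1 else 0)) ^ 2 +
          2 / (n : ℝ) ^ 2 * (gaussFourth / S.r n * (n * S.b ^ 2 + S.w n ^ 2) ^ 2))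
        ∂Measure.pi (fun _ => S.noiseLaw n) ∂Measure.pi (fun _ => S.D) := by
        refine lintegral_mono_ae ?_
        filter_upwards [hS.ae_abs_le_b] with a ha
        exact lintegral_mono fun b => lintegral_sq_gramError_proj_le b hS hn ha k l
    _ ≤ _ := by
        simp only [lintegral_const, measure_univ, mul_one]
        exact lintegral_ofReal_mul_add_le (by fun_prop) (fun _ => sq_nonneg _) (by positivity)
          (by positivity) (by positivity) hgram

theorem lintegral_sum_sq_noise_le (hS : S.Admissible) (n : ℕ) :
    ∫⁻ b : Fin n → ℝ, ENNReal.ofReal (∑ i, b i ^ 2) ∂Measure.pi (fun _ => S.noiseLaw n) ≤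
      ENNReal.ofReal (n * S.σ ^ 2) := by
  have := hS.isProbabilityMeasure_noiseLaw n
  simp_rw [fun b : Fin n → ℝ => ENNReal.ofReal_sum_of_nonneg fun i (_ : i ∈ Finset.univ) =>
    sq_nonneg (b i)]
  rw [lintegral_sum_eval_pi _ (g := fun x => ENNReal.ofReal (x ^ 2)) (by fun_prop),
    Fintype.card_fin, ENNReal.ofReal_mul n.cast_nonneg, ENNReal.ofReal_natCast]
  gcongr
  exact S.lintegral_sq_noiseLaw_le n

theorem lintegral_sq_noiseTerm_le (hS : S.Admissible) (hn : 0 < n)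
    (k : Fin (S.p n) ⊕ Fin (S.p n)) :
    ∫⁻ e, ENNReal.ofReal (noiseTerm n (S.w n) (privatizedDesign S n e) (privatizedResponse S n e)
        (S.θext n) k ^ 2) ∂Measure.pi (entryLaw S n) ≤
      ENNReal.ofReal (2 / (n : ℝ) ^ 2 * (n * S.σ ^ 2) + 2 / (n : ℝ) ^ 2 * (gaussFourth / S.r n *
          ((n * S.b ^ 2 + S.w n ^ 2) * (n * S.σ ^ 2 + 2 * S.w n ^ 2)))) := by
  have := hS.D_prob
  have := hS.isProbabilityMeasure_noiseLaw n
  have h4 := gaussFourth_nonneg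
  rw [lintegral_entries hS n ((measurable_noiseTerm_privatized k).pow_const 2).ennreal_ofReal]
  set A : ℝ := gaussFourth / S.r n * (n * S.b ^ 2 + S.w n ^ 2) with hA
  set G : (Fin n → ℝ) → ℝ := fun b => 2 / (n : ℝ) ^ 2 * (A * (∑ i, b i ^ 2 + 2 * S.w n ^ 2))
  have hG0 (b) : 0 ≤ G b := by positivity
  have hGm : Measurable G := by fun_prop
  calc _ ≤ ∫⁻ a, ∫⁻ b : Fin n → ℝ, ENNReal.ofReal
          (2 / (n : ℝ) ^ 2 * (∑ i, a (i, k) * b i) ^ 2 + G b)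
        ∂Measure.pi (fun _ => S.noiseLaw n) ∂Measure.pi (fun _ => S.D) := by
        refine lintegral_mono_ae ?_
        filter_upwards [hS.ae_abs_le_b] with a ha
        refine lintegral_mono fun b => (lintegral_sq_noiseTerm_proj_le b hS hn ha k).trans_eq ?_
        rw [← mul_assoc (gaussFourth / _)]
    _ = ∫⁻ b : Fin n → ℝ, ∫⁻ a, ENNReal.ofReal
          (2 / (n : ℝ) ^ 2 * (∑ i, a (i, k) * b i) ^ 2 + G b)
        ∂Measure.pi (fun _ => S.D) ∂Measure.pi (fun _ => S.noiseLaw n) :=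
        lintegral_lintegral_swap (by fun_prop)
    _ ≤ ∫⁻ b : Fin n → ℝ, ENNReal.ofReal
          (2 / (n : ℝ) ^ 2 * (∑ i, b i ^ 2) + G b) ∂Measure.pi (fun _ => S.noiseLaw n) :=
        lintegral_mono fun b => lintegral_ofReal_mul_add_le (by fun_prop) (fun _ => sq_nonneg _)
          (by positivity) (hG0 b) (by positivity) (hS.lintegral_sq_corr_le k b)
    _ = ∫⁻ b : Fin n → ℝ, ENNReal.ofReal
          ((2 / (n : ℝ) ^ 2 * (1 + A)) * (∑ i, b i ^ 2) + 2 / (n : ℝ) ^ 2 * (A * (2 * S.w n ^ 2)))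
          ∂Measure.pi (fun _ => S.noiseLaw n) := by
        refine lintegral_congr fun b => congrArg ENNReal.ofReal ?_
        simp only [G]
        ring
    _ ≤ ENNReal.ofReal ((2 / (n : ℝ) ^ 2 * (1 + A)) * (n * S.σ ^ 2) +
          2 / (n : ℝ) ^ 2 * (A * (2 * S.w n ^ 2))) :=
        lintegral_ofReal_mul_add_le (by fun_prop) (fun _ => by positivity) (by positivity)
          (by positivity) (by positivity) (lintegral_sum_sq_noise_le hS n)
    _ = _ := by
        rw [hA]
        ring_nf

end ModelMoments

/-! ### Deterministic error bound for the debiased Lasso -/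

section Deterministic

variable {ρ κ : Type*} [Fintype ρ] [Fintype κ]

theorem sqrt_sum_sq_mulVec_le (G : Matrix κ κ ℝ) (v : κ → ℝ) :
    √(∑ k, (G *ᵥ v) k ^ 2) ≤ √(∑ k, ∑ l, G k l ^ 2) * √(∑ l, v l ^ 2) := by
  rw [← Real.sqrt_mul (by positivity), Finset.sum_mul]
  gcongr with k
  exact Finset.sum_mul_sq_le_sq_mul_sq _ _ _

theorem IsLassoSolution.basic_inequality {n : ℕ} {lam : ℝ} (hlam : 0 ≤ lam) {M : Matrix ρ κ ℝ}
    {y : ρ → ℝ} {θ v : κ → ℝ} (h : IsLassoSolution n lam M y (θ + v)) :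
    1 / (2 * (n : ℝ)) * (M *ᵥ v ⬝ᵥ M *ᵥ v) ≤
      1 / (n : ℝ) * (M *ᵥ v ⬝ᵥ (y - M *ᵥ θ)) + lam * ∑ k, |v k| := by
  have hadd := lassoObjective_add n lam M y θ v
  have hmin := h θ
  have htriangle : -∑ k, |v k| ≤ ∑ k, (|θ k + v k| - |θ k|) := by
    rw [← Finset.sum_neg_distrib]
    gcongr with k
    have := abs_sub_abs_le_abs_sub (θ k) (θ k + v k)
    rw [sub_add_cancel_left, abs_neg] at this
    linarith
  have hpenalty := mul_le_mul_of_nonneg_left htriangle hlam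
  have hsq : M *ᵥ v ⬝ᵥ M *ᵥ v = ∑ i, (M *ᵥ v) i ^ 2 := by simp only [dotProduct, sq]
  rw [hsq]
  linarith

theorem dotProduct_noiseTerm (n : ℕ) (w : ℝ) (M : Matrix ρ κ ℝ) (y : ρ → ℝ) (θ v : κ → ℝ) :
    v ⬝ᵥ noiseTerm n w M y θ =
      1 / (n : ℝ) * (M *ᵥ v ⬝ᵥ (y - M *ᵥ θ)) + w ^ 2 / n * (v ⬝ᵥ θ) := by
  rw [noiseTerm, dotProduct_add, dotProduct_smul, dotProduct_smul, Matrix.dotProduct_mulVec,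
    Matrix.vecMul_transpose, smul_eq_mul, smul_eq_mul]

variable [DecidableEq κ]

theorem gramError_mulVec (n : ℕ) (w : ℝ) (M : Matrix ρ κ ℝ) (v : κ → ℝ) :
    gramError n w M *ᵥ v = (1 + w ^ 2 / (n : ℝ)) • v - (1 / (n : ℝ)) • Mᵀ *ᵥ (M *ᵥ v) := by
  rw [gramError, Matrix.sub_mulVec, Matrix.smul_mulVec, Matrix.smul_mulVec, Matrix.one_mulVec,
    Matrix.mulVec_mulVec]

theorem dotProduct_gramError_mulVec (n : ℕ) (w : ℝ) (M : Matrix ρ κ ℝ) (v : κ → ℝ) :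
    v ⬝ᵥ gramError n w M *ᵥ v =
      (1 + w ^ 2 / (n : ℝ)) * (v ⬝ᵥ v) - 1 / (n : ℝ) * (M *ᵥ v ⬝ᵥ M *ᵥ v) := by
  rw [gramError_mulVec, dotProduct_sub, dotProduct_smul, dotProduct_smul, Matrix.dotProduct_mulVec,
    Matrix.vecMul_transpose, smul_eq_mul, smul_eq_mul]

theorem debiased_sub (n : ℕ) (w : ℝ) (M : Matrix ρ κ ℝ) (y : ρ → ℝ) (θ θhat : κ → ℝ) :
    debiased n w M y θhat - θ = gramError n w M *ᵥ (θhat - θ) + noiseTerm n w M y θ := by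
  rw [debiased, noiseTerm, gramError_mulVec]
  simp only [Matrix.mulVec_sub, smul_sub, add_smul, one_smul]
  abel

theorem IsLassoSolution.dotProduct_self_le {n : ℕ} {lam : ℝ} (hlam : 0 ≤ lam) {w : ℝ}
    {M : Matrix ρ κ ℝ} {y : ρ → ℝ} {θ v : κ → ℝ} (h : IsLassoSolution n lam M y (θ + v)) :
    (1 + w ^ 2 / (n : ℝ)) / 2 * (v ⬝ᵥ v) ≤ 1 / 2 * (v ⬝ᵥ gramError n w M *ᵥ v) +
      v ⬝ᵥ noiseTerm n w M y θ + w ^ 2 / n * (v ⬝ᵥ -θ) + lam * ∑ k, |v k| := by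
  have hbasic := h.basic_inequality hlam
  have hhalf : 1 / (2 * (n : ℝ)) * (M *ᵥ v ⬝ᵥ M *ᵥ v) =
      1 / 2 * (1 / (n : ℝ) * (M *ᵥ v ⬝ᵥ M *ᵥ v)) := by ring
  rw [dotProduct_gramError_mulVec, dotProduct_noiseTerm, dotProduct_neg]
  linarith

theorem IsLassoSolution.sqrt_sum_sq_sub_le {n : ℕ} {lam : ℝ} (hlam : 0 ≤ lam) {w : ℝ}
    {M : Matrix ρ κ ℝ} {y : ρ → ℝ} {θ θhat : κ → ℝ} (h : IsLassoSolution n lam M y θhat)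
    (hθ : ∑ k, θ k ^ 2 = 1)
    (hG : √(∑ k, ∑ l, gramError n w M k l ^ 2) ≤ (1 + w ^ 2 / n) / 2) :
    √(∑ k, (θhat k - θ k) ^ 2) ≤ 4 / (1 + w ^ 2 / n) *
      (√(∑ k, noiseTerm n w M y θ k ^ 2) + w ^ 2 / n + lam * √(Fintype.card κ : ℝ)) := by
  obtain ⟨v, rfl⟩ : ∃ v, θhat = θ + v := ⟨θhat - θ, by abel⟩
  simp only [Pi.add_apply, add_sub_cancel_left]
  set N := √(∑ k, noiseTerm n w M y θ k ^ 2)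
  set V := √(∑ k, v k ^ 2)
  have hφ : 0 < 1 + w ^ 2 / (n : ℝ) := by positivity
  have hVsq : v ⬝ᵥ v = V ^ 2 := by
    rw [Real.sq_sqrt (by positivity)]
    simp only [dotProduct, sq]
  have hcs (u : κ → ℝ) : v ⬝ᵥ u ≤ V * √(∑ k, u k ^ 2) := Real.sum_mul_le_sqrt_mul_sqrt _ _ _
  have hgram : v ⬝ᵥ gramError n w M *ᵥ v ≤ V * ((1 + w ^ 2 / n) / 2 * V) := by
    refine (hcs _).trans ?_
    gcongr
    exact (sqrt_sum_sq_mulVec_le _ v).trans (by gcongr)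
  have hshrink : v ⬝ᵥ -θ ≤ V := by simpa [hθ] using hcs (-θ)
  have hl1 : ∑ k, |v k| ≤ √(Fintype.card κ : ℝ) * V := by
    simpa using Real.sum_mul_le_sqrt_mul_sqrt Finset.univ (fun _ : κ => (1 : ℝ)) fun k => |v k|
  have hshrink' := mul_le_mul_of_nonneg_left hshrink (by positivity : 0 ≤ w ^ 2 / (n : ℝ))
  have hl1' := mul_le_mul_of_nonneg_left hl1 hlam
  have hmain := h.dotProduct_self_le (w := w) hlam
  rw [hVsq] at hmain
  have hquad : (1 + w ^ 2 / (n : ℝ)) / 4 * V * V ≤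
      (N + w ^ 2 / n + lam * √(Fintype.card κ : ℝ)) * V := by
    linarith [hcs (noiseTerm n w M y θ)]
  rcases (show 0 ≤ V from Real.sqrt_nonneg _).eq_or_lt with hV | hV
  · rw [← hV]
    positivity
  · rw [div_mul_eq_mul_div, le_div_iff₀ hφ]
    linarith [le_of_mul_le_mul_right hquad hV]

theorem IsLassoSolution.sum_sq_debiased_sub_le {n : ℕ} {lam : ℝ} (hlam : 0 ≤ lam)
    {w : ℝ} {M : Matrix ρ κ ℝ} {y : ρ → ℝ} {θ θhat : κ → ℝ} (h : IsLassoSolution n lam M y θhat)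
    (hθ : ∑ k, θ k ^ 2 = 1) {g N : ℝ} (hg : √(∑ k, ∑ l, gramError n w M k l ^ 2) ≤ g)
    (hN : √(∑ k, noiseTerm n w M y θ k ^ 2) ≤ N) (hgφ : g ≤ (1 + w ^ 2 / n) / 2) :
    ∑ k, (debiased n w M y θhat k - θ k) ^ 2 ≤
      2 * (2 * N + 4 / (1 + w ^ 2 / n) * (g * (w ^ 2 / n + lam * √(Fintype.card κ : ℝ)))) ^ 2 +
        2 * N ^ 2 := by
  have hg0 : 0 ≤ g := (Real.sqrt_nonneg _).trans hg
  have hN0 : 0 ≤ N := (Real.sqrt_nonneg _).trans hN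
  have hbias : √(∑ k, (gramError n w M *ᵥ (θhat - θ)) k ^ 2) ≤
      2 * N + 4 / (1 + w ^ 2 / n) * (g * (w ^ 2 / n + lam * √(Fintype.card κ : ℝ))) := by
    calc √(∑ k, (gramError n w M *ᵥ (θhat - θ)) k ^ 2)
        ≤ g * (4 / (1 + w ^ 2 / n) * (N + w ^ 2 / n + lam * √(Fintype.card κ : ℝ))) := by
          refine (sqrt_sum_sq_mulVec_le _ _).trans (mul_le_mul hg ?_ (Real.sqrt_nonneg _) hg0)
          refine (h.sqrt_sum_sq_sub_le hlam hθ (hg.trans hgφ)).trans ?_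
          gcongr
      _ = 4 / (1 + w ^ 2 / n) * g * N +
          4 / (1 + w ^ 2 / n) * (g * (w ^ 2 / n + lam * √(Fintype.card κ : ℝ))) := by ring
      _ ≤ 4 / (1 + w ^ 2 / n) * ((1 + w ^ 2 / n) / 2) * N +
          4 / (1 + w ^ 2 / n) * (g * (w ^ 2 / n + lam * √(Fintype.card κ : ℝ))) := by gcongr
      _ = _ := by
        field_simp
        ring
  calc ∑ k, (debiased n w M y θhat k - θ k) ^ 2
      ≤ ∑ k, 2 * ((gramError n w M *ᵥ (θhat - θ)) k ^ 2 + noiseTerm n w M y θ k ^ 2) := by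
        gcongr with k
        have hk := congrFun (debiased_sub n w M y θ θhat) k
        rw [Pi.sub_apply, Pi.add_apply] at hk
        rw [hk]
        exact add_sq_le
    _ = 2 * ∑ k, (gramError n w M *ᵥ (θhat - θ)) k ^ 2 + 2 * ∑ k, noiseTerm n w M y θ k ^ 2 := by
        rw [← Finset.mul_sum, Finset.sum_add_distrib, mul_add]
    _ ≤ _ := by
        gcongr
        · exact Real.sqrt_le_left (by positivity) |>.1 hbias
        · exact Real.sqrt_le_left hN0 |>.1 hN

end Deterministic

/-! ### Consequences of the growth conditions -/

section Growth

namespace Setting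

variable (S : Setting)

/-- Order of magnitude, up to a constant, of the entries of `gramError`. -/
def τ (n : ℕ) : ℝ := 1 / √(n : ℝ) + S.φ n / √(S.r n : ℝ)

theorem φ_pos (n : ℕ) : 0 < S.φ n := by
  unfold Setting.φ; positivity

theorem τ_nonneg (n : ℕ) : 0 ≤ S.τ n := by
  have := S.φ_pos n
  unfold Setting.τ; positivity

theorem two_mul_lam_mul_sqrt_s₀_le_κ (C : ℝ) (n : ℕ) :
    2 * S.lam C n * √(S.s₀ n : ℝ) ≤ S.κ C n :=
  le_add_of_nonneg_right (by positivity)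

variable {S}

theorem mul_τ_le {n : ℕ} {m : ℝ} (h₁ : m ≤ √(n : ℝ)) (h₂ : m ≤ √(S.r n : ℝ))
    (h₃ : m ≤ n / S.w n ^ 2 * √(S.r n : ℝ)) : m * S.τ n ≤ 3 := by
  have e₁ : m * (1 / √(n : ℝ)) ≤ 1 := by
    rw [mul_one_div]; exact div_le_one_of_le₀ h₁ (Real.sqrt_nonneg _)
  have e₂ : m * (1 / √(S.r n : ℝ)) ≤ 1 := by
    rw [mul_one_div]; exact div_le_one_of_le₀ h₂ (Real.sqrt_nonneg _)
  have e₃ : m * (S.w n ^ 2 / n / √(S.r n : ℝ)) ≤ 1 := by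
    calc m * (S.w n ^ 2 / n / √(S.r n : ℝ)) = m / (n / S.w n ^ 2 * √(S.r n : ℝ)) := by
          rw [div_eq_mul_inv m, mul_inv, inv_div]; ring
      _ ≤ 1 := div_le_one_of_le₀ h₃ (by positivity)
  calc m * S.τ n = m * (1 / √(n : ℝ)) + m * (1 / √(S.r n : ℝ)) +
        m * (S.w n ^ 2 / n / √(S.r n : ℝ)) := by unfold Setting.τ Setting.φ; ring
    _ ≤ 3 := by linarith

namespace Admissible

theorem one_le_s₀ (hS : S.Admissible) (n : ℕ) : 1 ≤ S.s₀ n := by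
  rw [Setting.s₀, Nat.one_le_iff_ne_zero, Finset.card_ne_zero]
  by_contra! hempty
  have hzero (j) : S.θ₀ n j = 0 := by
    by_contra hj
    simpa [hempty] using mem_supp.2 hj
  simpa [hzero] using hS.θ₀_norm n

theorem τ_pos (hS : S.Admissible) (n : ℕ) : 0 < S.τ n := by
  have := hS.r_pos n
  have := S.φ_pos n
  unfold Setting.τ; positivity

theorem ρ_sq (hS : S.Admissible) {n : ℕ} (hn : 0 < n) :
    S.ρ n ^ 2 = ((n : ℝ) + S.r n + 1) / (n * S.r n) + S.w n ^ 2 / (n * S.r n) := by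
  have := hS.r_pos n
  exact Real.sq_sqrt (by positivity)

theorem ρ_pos (hS : S.Admissible) {n : ℕ} (hn : 0 < n) : 0 < S.ρ n := by
  have := hS.r_pos n
  exact Real.sqrt_pos.2 (by positivity)

theorem inv_n_le_ρ_sq (hS : S.Admissible) {n : ℕ} (hn : 0 < n) : 1 / (n : ℝ) ≤ S.ρ n ^ 2 := by
  have hr : (0 : ℝ) < S.r n := by exact_mod_cast hS.r_pos n
  rw [hS.ρ_sq hn, ← add_div, div_le_div_iff₀ (by positivity) (by positivity)]
  nlinarith [sq_nonneg (S.w n)]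

theorem inv_r_le_ρ_sq (hS : S.Admissible) {n : ℕ} (hn : 0 < n) :
    1 / (S.r n : ℝ) ≤ S.ρ n ^ 2 := by
  have hr : (0 : ℝ) < S.r n := by exact_mod_cast hS.r_pos n
  rw [hS.ρ_sq hn, ← add_div, div_le_div_iff₀ hr (by positivity)]
  nlinarith [sq_nonneg (S.w n)]

theorem w_sq_div_le_κ (hS : S.Admissible) {C : ℝ} (hC : 0 < C) {n : ℕ} (hn : 0 < n) :
    S.w n ^ 2 / n ≤ S.κ C n := by
  have := hS.lam_pos hC hn
  exact le_add_of_nonneg_left (by positivity)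

theorem κ_pos (hS : S.Admissible) {C : ℝ} (hC : 0 < C) {n : ℕ} (hn : 0 < n) : 0 < S.κ C n := by
  have := hS.w_pos n
  exact lt_of_lt_of_le (by positivity) (hS.w_sq_div_le_κ hC hn)

end Admissible

theorem eventually_one_le_log_d (hp : Tendsto S.p atTop atTop) :
    ∀ᶠ n in atTop, 1 ≤ Real.log (S.d n) := by
  have hd : Tendsto S.d atTop atTop :=
    (tendsto_natCast_atTop_atTop.comp hp).const_mul_atTop (by norm_num)
  exact (Real.tendsto_log_atTop.comp hd).eventually_ge_atTop 1

variable (S) in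
/-- The part of the debiasing conditions that controls the debiased Lasso in `ℓ²`, with the rates
of `Debiasing` expressed through `τ` and without logarithmic factors. -/
structure WeakDebiasing (C : ℝ) : Prop where
  compatibility :
    Tendsto (fun n => S.κ C n ^ 2 / (S.lam C n ^ 2 * S.φ n) * S.τ n) atTop (𝓝 0)
  error : (fun n => S.κ C n ^ 2 / (S.lam C n * S.φ n) * S.τ n) =O[atTop] S.ρ

theorem sqrt_div_log_mul_min_mul_τ_le (n : ℕ) (hlog : 1 ≤ Real.log (S.d n)) :
    √((n : ℝ) / Real.log (S.d n)) *
      min 1 (min √((S.r n : ℝ) / n) (√((S.r n : ℝ) * n) / S.w n ^ 2)) * S.τ n ≤ 3 := by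
  obtain rfl | hn := n.eq_zero_or_pos
  · simp
  have hsn : √(n : ℝ) ≠ 0 := by positivity
  have hle {x : ℝ} (hx : min 1 (min √((S.r n : ℝ) / n) (√((S.r n : ℝ) * n) / S.w n ^ 2)) ≤ x) :
      √((n : ℝ) / Real.log (S.d n)) *
        min 1 (min √((S.r n : ℝ) / n) (√((S.r n : ℝ) * n) / S.w n ^ 2)) ≤ √(n : ℝ) * x := by
    have := div_le_self n.cast_nonneg hlog (α := ℝ)
    gcongr
  refine mul_τ_le ((hle (min_le_left _ _)).trans_eq (mul_one _))
    ((hle ((min_le_right _ _).trans (min_le_left _ _))).trans_eq ?_)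
    ((hle ((min_le_right _ _).trans (min_le_right _ _))).trans_eq ?_)
  · rw [Real.sqrt_div' _ n.cast_nonneg, mul_div_cancel₀ _ hsn]
  · rw [Real.sqrt_mul' _ n.cast_nonneg]
    linear_combination √(S.r n : ℝ) / S.w n ^ 2 * Real.mul_self_sqrt n.cast_nonneg (x := (n : ℝ))

theorem min_sqrt_div_log_mul_τ_le (n : ℕ) (hlog : 1 ≤ Real.log (S.d n)) :
    min (min √((n : ℝ) / Real.log (S.d n)) √((S.r n : ℝ) / Real.log (S.d n)))
      (min ((n : ℝ) / S.w n ^ 2 * √((S.r n : ℝ) / Real.log (S.d n)))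
        (√((n : ℝ) * S.r n) / (S.w n * Real.log (S.d n)))) * S.τ n ≤ 3 := by
  have hsqrt {k : ℕ} : √((k : ℝ) / Real.log (S.d n)) ≤ √(k : ℝ) :=
    Real.sqrt_le_sqrt (div_le_self k.cast_nonneg hlog)
  refine mul_τ_le ((min_le_left _ _).trans ((min_le_left _ _).trans hsqrt))
    ((min_le_left _ _).trans ((min_le_right _ _).trans hsqrt))
    ((min_le_right _ _).trans ((min_le_left _ _).trans ?_))
  gcongr
  exact div_le_self (Nat.cast_nonneg _) hlog

theorem Debiasing.weakDebiasing (hS : S.Admissible) (hp : Tendsto S.p atTop atTop) {C : ℝ}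
    (hd : S.Debiasing C) : S.WeakDebiasing C where
  compatibility := by
    rw [← isLittleO_one_iff ℝ]
    refine (hd.compatibility.mul_isBigO (isBigO_refl S.τ _)).trans_isBigO
      (IsBigO.of_bound 3 ?_)
    filter_upwards [eventually_one_le_log_d hp] with n hlog
    have := S.τ_nonneg n
    rw [Real.norm_of_nonneg (by positivity), norm_one, mul_one]
    exact sqrt_div_log_mul_min_mul_τ_le n hlog
  error := by
    have hbound : (fun n => 1 / (S.σ * S.ρ n) * (4 * S.κ C n ^ 2 / (S.lam C n * S.φ n)) * S.τ n)
        =O[atTop] fun _ => (1 : ℝ) := by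
      refine (hd.error.isBigO.mul (isBigO_refl S.τ _)).trans (IsBigO.of_bound 3 ?_)
      filter_upwards [eventually_one_le_log_d hp] with n hlog
      have := S.τ_nonneg n
      have := hS.w_pos n
      rw [Real.norm_of_nonneg (by positivity), norm_one, mul_one]
      exact min_sqrt_div_log_mul_τ_le n hlog
    refine (((isBigO_refl S.ρ atTop).const_mul_left (S.σ / 4)).mul hbound).congr' ?_
      (.of_forall fun n => mul_one _)
    filter_upwards [eventually_gt_atTop 0] with n hn
    have := hS.ρ_pos hn
    have := hS.σ_pos
    field_simp

variable {C : ℝ}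

theorem WeakDebiasing.eventually_sqrt_s₀_mul_κ_mul_τ_le (hS : S.Admissible) (hC : 0 < C)
    (hd : S.WeakDebiasing C) :
    ∃ K : ℝ, 0 < K ∧ ∀ᶠ n in atTop, √(S.s₀ n : ℝ) * S.κ C n * S.τ n ≤ K * (S.ρ n * S.φ n) := by
  obtain ⟨K, hK, hbound⟩ := hd.error.exists_pos
  refine ⟨K / 2, half_pos hK, ?_⟩
  filter_upwards [hbound.bound, eventually_gt_atTop 0] with n herr hn
  have hlam := hS.lam_pos hC hn
  have hφ := S.φ_pos n
  have hρ := hS.ρ_pos hn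
  have hτ := S.τ_nonneg n
  have hκ := hS.κ_pos hC hn
  have hsκ : 2 * S.lam C n * √(S.s₀ n : ℝ) * S.κ C n ≤ S.κ C n ^ 2 := by
    rw [sq]; gcongr; exact two_mul_lam_mul_sqrt_s₀_le_κ S C n
  rw [Real.norm_of_nonneg (by positivity), Real.norm_of_nonneg hρ.le] at herr
  calc √(S.s₀ n : ℝ) * S.κ C n * S.τ n
      = 2 * S.lam C n * √(S.s₀ n : ℝ) * S.κ C n / (S.lam C n * S.φ n) * S.τ n *
          (S.φ n / 2) := by field_simp
    _ ≤ S.κ C n ^ 2 / (S.lam C n * S.φ n) * S.τ n * (S.φ n / 2) := by gcongr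
    _ ≤ K * S.ρ n * (S.φ n / 2) := by gcongr
    _ = K / 2 * (S.ρ n * S.φ n) := by ring

theorem WeakDebiasing.eventually_w_pow_four_le (hS : S.Admissible) (hC : 0 < C)
    (hd : S.WeakDebiasing C) :
    ∃ K : ℝ, 0 < K ∧ ∀ᶠ n in atTop, S.w n ^ 4 / (n ^ 2 * S.r n) ≤ K * S.ρ n ^ 2 := by
  obtain ⟨K, hK, hbound⟩ := hd.eventually_sqrt_s₀_mul_κ_mul_τ_le hS hC
  refine ⟨K ^ 2, by positivity, ?_⟩
  filter_upwards [hbound, eventually_gt_atTop 0] with n hle hn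
  have hφ := S.φ_pos n
  have hs : 1 ≤ √(S.s₀ n : ℝ) := Real.one_le_sqrt.2 (by exact_mod_cast hS.one_le_s₀ n)
  have hw : S.w n ^ 2 / n / √(S.r n : ℝ) ≤ K * S.ρ n := by
    refine le_of_mul_le_mul_right ?_ hφ
    calc S.w n ^ 2 / n / √(S.r n : ℝ) * S.φ n
        = 1 * (S.w n ^ 2 / n) * (S.φ n / √(S.r n : ℝ)) := by ring
      _ ≤ √(S.s₀ n : ℝ) * S.κ C n * S.τ n := by
          have := hS.κ_pos hC hn
          gcongr
          · exact hS.w_sq_div_le_κ hC hn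
          · exact le_add_of_nonneg_left (by positivity)
      _ ≤ K * S.ρ n * S.φ n := hle.trans_eq (by ring)
  calc S.w n ^ 4 / (n ^ 2 * S.r n) = (S.w n ^ 2 / n / √(S.r n : ℝ)) ^ 2 := by
        rw [div_pow, div_pow, Real.sq_sqrt (by positivity), div_div]; ring
    _ ≤ (K * S.ρ n) ^ 2 := by gcongr
    _ = K ^ 2 * S.ρ n ^ 2 := mul_pow _ _ _

variable {c : ℝ}

theorem WeakDebiasing.eventually_p_mul_τ_le (hS : S.Admissible) (hC : 0 < C)
    (hd : S.WeakDebiasing C) (hc : 0 < c) (hs : ∀ᶠ n in atTop, c * S.p n ≤ S.s₀ n) {η : ℝ}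
    (hη : 0 < η) : ∀ᶠ n in atTop, S.p n * S.τ n ≤ η * S.φ n := by
  filter_upwards [hd.compatibility.eventually_le_const (show 0 < 4 * c * η by positivity), hs,
    eventually_gt_atTop 0] with n hsmall hcp hn
  have hlam := hS.lam_pos hC hn
  have hφ := S.φ_pos n
  have hτ := S.τ_nonneg n
  have hsκ : 4 * S.lam C n ^ 2 * S.s₀ n ≤ S.κ C n ^ 2 := by
    calc 4 * S.lam C n ^ 2 * S.s₀ n = (2 * S.lam C n * √(S.s₀ n : ℝ)) ^ 2 := by
          rw [mul_pow, mul_pow, Real.sq_sqrt (by positivity)]; ring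
      _ ≤ S.κ C n ^ 2 := by gcongr; exact two_mul_lam_mul_sqrt_s₀_le_κ S C n
  refine le_of_mul_le_mul_left ?_ (show 0 < 4 * c / S.φ n by positivity)
  calc 4 * c / S.φ n * (S.p n * S.τ n) = 4 * (c * S.p n) / S.φ n * S.τ n := by ring
    _ ≤ 4 * S.s₀ n / S.φ n * S.τ n := by gcongr
    _ = 4 * S.lam C n ^ 2 * S.s₀ n / (S.lam C n ^ 2 * S.φ n) * S.τ n := by field_simp
    _ ≤ S.κ C n ^ 2 / (S.lam C n ^ 2 * S.φ n) * S.τ n := by gcongr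
    _ ≤ 4 * c * η := hsmall
    _ = 4 * c / S.φ n * (η * S.φ n) := by field_simp

theorem Admissible.w_sq_div_add_lam_mul_le (hS : S.Admissible) (hC : 0 < C) {n : ℕ} (hn : 0 < n)
    {a : ℝ} (hs : √(S.p n : ℝ) ≤ a * √(S.s₀ n : ℝ)) :
    S.w n ^ 2 / n + S.lam C n * √(2 * S.p n : ℝ) ≤ (1 + √2 * a) * S.κ C n := by
  have hlam := hS.lam_pos hC hn
  have hs₀ : 0 < √(S.s₀ n : ℝ) := by have := hS.one_le_s₀ n; positivity
  have ha : 0 ≤ a := nonneg_of_mul_nonneg_left ((Real.sqrt_nonneg _).trans hs) hs₀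
  have hlam_le : S.lam C n * √(S.s₀ n : ℝ) ≤ S.κ C n := by
    have := two_mul_lam_mul_sqrt_s₀_le_κ S C n
    have : 0 ≤ S.lam C n * √(S.s₀ n : ℝ) := by positivity
    linarith
  calc S.w n ^ 2 / n + S.lam C n * √(2 * S.p n : ℝ)
      ≤ S.κ C n + S.lam C n * (√2 * (a * √(S.s₀ n : ℝ))) := by
        rw [Real.sqrt_mul zero_le_two]
        gcongr
        exact hS.w_sq_div_le_κ hC hn
    _ = S.κ C n + √2 * a * (S.lam C n * √(S.s₀ n : ℝ)) := by ring
    _ ≤ S.κ C n + √2 * a * S.κ C n := by gcongr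
    _ = (1 + √2 * a) * S.κ C n := by ring

theorem WeakDebiasing.eventually_bias_le (hS : S.Admissible) (hC : 0 < C)
    (hd : S.WeakDebiasing C) (hc : 0 < c) (hs : ∀ᶠ n in atTop, c * S.p n ≤ S.s₀ n) :
    ∃ K : ℝ, 0 < K ∧ ∀ᶠ n in atTop, S.p n * S.τ n *
      (S.w n ^ 2 / n + S.lam C n * √(2 * S.p n : ℝ)) ≤ K * (√(S.p n : ℝ) * S.ρ n * S.φ n) := by
  obtain ⟨K, hK, hbound⟩ := hd.eventually_sqrt_s₀_mul_κ_mul_τ_le hS hC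
  set a := √(1 / c)
  refine ⟨a * (1 + √2 * a) * K, by positivity, ?_⟩
  filter_upwards [hbound, hs, eventually_gt_atTop 0] with n hle hcp hn
  have hτ := S.τ_nonneg n
  have hp : √(S.p n : ℝ) ≤ a * √(S.s₀ n : ℝ) := by
    rw [← Real.sqrt_mul (by positivity)]
    refine Real.sqrt_le_sqrt ?_
    rw [one_div_mul_eq_div, le_div_iff₀ hc]
    linarith
  have hbias := hS.w_sq_div_add_lam_mul_le hC hn hp
  have hκ := hS.κ_pos hC hn
  calc S.p n * S.τ n * (S.w n ^ 2 / n + S.lam C n * √(2 * S.p n : ℝ))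
      ≤ S.p n * S.τ n * ((1 + √2 * a) * S.κ C n) := by gcongr
    _ = √(S.p n : ℝ) * √(S.p n : ℝ) * S.τ n * ((1 + √2 * a) * S.κ C n) := by
        rw [Real.mul_self_sqrt (by positivity)]
    _ ≤ √(S.p n : ℝ) * (a * √(S.s₀ n : ℝ)) * S.τ n * ((1 + √2 * a) * S.κ C n) := by gcongr
    _ = √(S.p n : ℝ) * a * (1 + √2 * a) * (√(S.s₀ n : ℝ) * S.κ C n * S.τ n) := by ring
    _ ≤ √(S.p n : ℝ) * a * (1 + √2 * a) * (K * (S.ρ n * S.φ n)) := by gcongr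
    _ = a * (1 + √2 * a) * K * (√(S.p n : ℝ) * S.ρ n * S.φ n) := by ring

end Setting

end Growth

/-! ### Tightness of the error of the debiased Lasso -/

section Tightness

theorem measure_lt_comp_le {Ω E : Type*} [MeasurableSpace Ω] [MeasurableSpace E] {P : Measure Ω}
    {ν : Measure E} {X : Ω → E} (hX : HasLaw X ν P) {F : E → ℝ} (hF : Measurable F) {A t : ℝ}
    (ht : 0 < t) (h : ∫⁻ e, ENNReal.ofReal (F e) ∂ν ≤ ENNReal.ofReal A) :
    P {ω | t < F (X ω)} ≤ ENNReal.ofReal (A / t) := by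
  calc P {ω | t < F (X ω)} ≤ P {ω | ENNReal.ofReal t ≤ ENNReal.ofReal (F (X ω))} :=
        measure_mono fun ω (hω : t < F (X ω)) => ENNReal.ofReal_le_ofReal hω.le
    _ ≤ (∫⁻ ω, ENNReal.ofReal (F (X ω)) ∂P) / ENNReal.ofReal t :=
        meas_ge_le_lintegral_div (hF.ennreal_ofReal.comp_aemeasurable hX.aemeasurable)
          (by simpa using ht) ENNReal.ofReal_ne_top
    _ = (∫⁻ e, ENNReal.ofReal (F e) ∂ν) / ENNReal.ofReal t := by
        rw [← hX.lintegral_comp hF.ennreal_ofReal.aemeasurable]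
    _ ≤ ENNReal.ofReal A / ENNReal.ofReal t := by gcongr
    _ = ENNReal.ofReal (A / t) := (ENNReal.ofReal_div_of_pos ht).symm

theorem lintegral_ofReal_sum_le {E ι : Type*} [MeasurableSpace E] {ν : Measure E} [Fintype ι]
    {F : ι → E → ℝ} (hF : ∀ i, Measurable (F i)) (hF0 : ∀ i e, 0 ≤ F i e) {A : ℝ}
    (h : ∀ i, ∫⁻ e, ENNReal.ofReal (F i e) ∂ν ≤ ENNReal.ofReal A) :
    ∫⁻ e, ENNReal.ofReal (∑ i, F i e) ∂ν ≤ ENNReal.ofReal (Fintype.card ι * A) := by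
  calc ∫⁻ e, ENNReal.ofReal (∑ i, F i e) ∂ν = ∫⁻ e, ∑ i, ENNReal.ofReal (F i e) ∂ν := by
        simp_rw [fun e => ENNReal.ofReal_sum_of_nonneg fun i (_ : i ∈ Finset.univ) => hF0 i e]
    _ = ∑ i, ∫⁻ e, ENNReal.ofReal (F i e) ∂ν :=
        lintegral_finsetSum _ fun i _ => (hF i).ennreal_ofReal
    _ ≤ ∑ _i : ι, ENNReal.ofReal A := Finset.sum_le_sum fun i _ => h i
    _ = ENNReal.ofReal (Fintype.card ι * A) := by
        rw [Finset.sum_const, Finset.card_univ, nsmul_eq_mul, ENNReal.ofReal_mul (by positivity),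
          ENNReal.ofReal_natCast]

variable {S : Setting} {n : ℕ} {C c : ℝ}

theorem card_columns (S : Setting) (n : ℕ) :
    (Fintype.card (Fin (S.p n) ⊕ Fin (S.p n)) : ℝ) = 2 * S.p n := by
  rw [Fintype.card_sum, Fintype.card_fin]; push_cast; ring

theorem mul_b_sq_add_w_sq_le (hS : S.Admissible) (hn : 0 < n) :
    n * S.b ^ 2 + S.w n ^ 2 ≤ S.b ^ 2 * (n * S.φ n) := by
  have hb : 1 ≤ S.b ^ 2 := one_le_pow₀ hS.one_le_b
  have hφ : n * S.φ n = n + S.w n ^ 2 := by unfold Setting.φ; field_simp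
  rw [hφ]
  nlinarith [sq_nonneg (S.w n)]

theorem Setting.Admissible.lintegral_sq_gramError_le_τ (hS : S.Admissible) (hn : 0 < n)
    (k l : Fin (S.p n) ⊕ Fin (S.p n)) :
    ∫⁻ e, ENNReal.ofReal (gramError n (S.w n) (privatizedDesign S n e) k l ^ 2)
        ∂Measure.pi (entryLaw S n) ≤
      ENNReal.ofReal (2 * S.b ^ 4 * (gaussFourth + 1) * S.τ n ^ 2) := by
  refine (lintegral_sq_gramError_le hS hn k l).trans (ENNReal.ofReal_le_ofReal ?_)
  have hr : (0 : ℝ) < S.r n := by exact_mod_cast hS.r_pos n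
  have h4 := gaussFourth_nonneg
  have hφ := S.φ_pos n
  have hn_le : 1 / (n : ℝ) ≤ S.τ n ^ 2 := by
    calc 1 / (n : ℝ) = (1 / √(n : ℝ)) ^ 2 := by
          rw [div_pow, Real.sq_sqrt n.cast_nonneg, one_pow]
      _ ≤ S.τ n ^ 2 := by
          unfold Setting.τ; gcongr; exact le_add_of_nonneg_right (by positivity)
  have hr_le : S.φ n ^ 2 / S.r n ≤ S.τ n ^ 2 := by
    calc S.φ n ^ 2 / S.r n = (S.φ n / √(S.r n : ℝ)) ^ 2 := by rw [div_pow, Real.sq_sqrt hr.le]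
      _ ≤ S.τ n ^ 2 := by
          unfold Setting.τ; gcongr; exact le_add_of_nonneg_left (by positivity)
  calc _ ≤ 2 / (n : ℝ) ^ 2 * (n * S.b ^ 4) +
        2 / (n : ℝ) ^ 2 * (gaussFourth / S.r n * (S.b ^ 2 * (n * S.φ n)) ^ 2) := by
        gcongr; exact mul_b_sq_add_w_sq_le hS hn
    _ = 2 * S.b ^ 4 * (1 / n) + 2 * S.b ^ 4 * gaussFourth * (S.φ n ^ 2 / S.r n) := by field_simp
    _ ≤ 2 * S.b ^ 4 * S.τ n ^ 2 + 2 * S.b ^ 4 * gaussFourth * S.τ n ^ 2 := by gcongr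
    _ = 2 * S.b ^ 4 * (gaussFourth + 1) * S.τ n ^ 2 := by ring

theorem Setting.Admissible.φ_sq_div_r_le (hS : S.Admissible) (hn : 0 < n) {K : ℝ}
    (hw : S.w n ^ 4 / (n ^ 2 * S.r n) ≤ K * S.ρ n ^ 2) :
    S.φ n ^ 2 / S.r n ≤ 2 * (1 + K) * S.ρ n ^ 2 := by
  have hφ : S.φ n ^ 2 ≤ 2 * (1 + (S.w n ^ 2 / n) ^ 2) := by
    unfold Setting.φ; nlinarith [sq_nonneg (1 - S.w n ^ 2 / n)]
  calc S.φ n ^ 2 / S.r n ≤ 2 * (1 + (S.w n ^ 2 / n) ^ 2) / S.r n := by gcongr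
    _ = 2 * (1 / S.r n) + 2 * (S.w n ^ 4 / (n ^ 2 * S.r n)) := by field_simp
    _ ≤ 2 * S.ρ n ^ 2 + 2 * (K * S.ρ n ^ 2) := by gcongr; exact hS.inv_r_le_ρ_sq hn
    _ = 2 * (1 + K) * S.ρ n ^ 2 := by ring

theorem Setting.Admissible.lintegral_sq_noiseTerm_le_ρ (hS : S.Admissible) (hn : 0 < n) {K : ℝ}
    (hw : S.w n ^ 4 / (n ^ 2 * S.r n) ≤ K * S.ρ n ^ 2) (k : Fin (S.p n) ⊕ Fin (S.p n)) :
    ∫⁻ e, ENNReal.ofReal (noiseTerm n (S.w n) (privatizedDesign S n e) (privatizedResponse S n e)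
        (S.θext n) k ^ 2) ∂Measure.pi (entryLaw S n) ≤
      ENNReal.ofReal ((2 * S.σ ^ 2 + 4 * gaussFourth * S.b ^ 2 * (S.σ ^ 2 + 2) * (1 + K)) *
        S.ρ n ^ 2) := by
  refine (lintegral_sq_noiseTerm_le hS hn k).trans (ENNReal.ofReal_le_ofReal ?_)
  have h4 := gaussFourth_nonneg
  have hφ := S.φ_pos n
  have hb := mul_b_sq_add_w_sq_le hS hn
  have hσ : n * S.σ ^ 2 + 2 * S.w n ^ 2 ≤ (S.σ ^ 2 + 2) * (n * S.φ n) := by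
    have hnφ : n * S.φ n = n + S.w n ^ 2 := by unfold Setting.φ; field_simp
    have : 0 ≤ 2 * n + S.σ ^ 2 * S.w n ^ 2 := by positivity
    rw [hnφ]
    linarith
  calc _ ≤ 2 / (n : ℝ) ^ 2 * (n * S.σ ^ 2) + 2 / (n : ℝ) ^ 2 * (gaussFourth / S.r n *
          (S.b ^ 2 * (n * S.φ n) * ((S.σ ^ 2 + 2) * (n * S.φ n)))) := by gcongr
    _ = 2 * S.σ ^ 2 * (1 / n) +
          2 * gaussFourth * S.b ^ 2 * (S.σ ^ 2 + 2) * (S.φ n ^ 2 / S.r n) := by field_simp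
    _ ≤ 2 * S.σ ^ 2 * S.ρ n ^ 2 +
          2 * gaussFourth * S.b ^ 2 * (S.σ ^ 2 + 2) * (2 * (1 + K) * S.ρ n ^ 2) := by
        gcongr
        · exact hS.inv_n_le_ρ_sq hn
        · exact hS.φ_sq_div_r_le hn hw
    _ = _ := by ring

namespace Sample

variable {Ω : Type*} (T : Sample S n Ω)

/-- Euclidean norm of the noise term of the private Lasso at the true coefficients. -/
def noiseNorm (ω : Ω) : ℝ :=
  √(∑ k, noiseTerm n (S.w n) (T.Xstar ω) (T.ystar ω) (S.θext n) k ^ 2)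

/-- Frobenius norm of the error of the private Gram matrix. -/
def gramErrorNorm (ω : Ω) : ℝ := √(∑ k, ∑ l, gramError n (S.w n) (T.Xstar ω) k l ^ 2)

/-- Error of the debiased private Lasso, as an estimate of `θ₀` padded by zeros. -/
def debiasedError (ω : Ω) (k : Fin (S.p n) ⊕ Fin (S.p n)) : ℝ :=
  debiased n (S.w n) (T.Xstar ω) (T.ystar ω) (T.θhat ω) k - S.θext n k

variable {T}

theorem sum_sq_debiasedError_le (hS : S.Admissible) (hC : 0 < C) (hn : 0 < n) {g h K : ℝ} {ω : Ω}
    (hlasso : IsLassoSolution n (S.lam C n) (T.Xstar ω) (T.ystar ω) (T.θhat ω))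
    (hg : 0 ≤ g) (hgram : T.gramErrorNorm ω ≤ g * (S.p n * S.τ n))
    (hnoise : T.noiseNorm ω ≤ h * (√(S.p n : ℝ) * S.ρ n))
    (hsmall : g * (S.p n * S.τ n) ≤ S.φ n / 2)
    (hbias : S.p n * S.τ n * (S.w n ^ 2 / n + S.lam C n * √(2 * S.p n : ℝ)) ≤
      K * (√(S.p n : ℝ) * S.ρ n * S.φ n)) :
    ∑ k, T.debiasedError ω k ^ 2 ≤
      (2 * (2 * h + 4 * g * K) ^ 2 + 2 * h ^ 2) * (S.p n * S.ρ n ^ 2) := by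
  have hφ := S.φ_pos n
  have hτ := S.τ_nonneg n
  have hlam := hS.lam_pos hC hn
  have hN : 0 ≤ h * (√(S.p n : ℝ) * S.ρ n) := (Real.sqrt_nonneg _).trans hnoise
  have hdet := hlasso.sum_sq_debiased_sub_le hlam.le (hS.sum_sq_θext n) hgram hnoise hsmall
  have hbias' : 4 / S.φ n * (g * (S.p n * S.τ n) * (S.w n ^ 2 / n + S.lam C n *
      √(2 * S.p n : ℝ))) ≤ 4 * g * K * (√(S.p n : ℝ) * S.ρ n) := by
    calc _ = 4 * g / S.φ n * (S.p n * S.τ n * (S.w n ^ 2 / n + S.lam C n * √(2 * S.p n : ℝ))) := by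
          ring
      _ ≤ 4 * g / S.φ n * (K * (√(S.p n : ℝ) * S.ρ n * S.φ n)) := by gcongr
      _ = 4 * g * K * (√(S.p n : ℝ) * S.ρ n) := by field_simp
  rw [card_columns] at hdet
  calc ∑ k, T.debiasedError ω k ^ 2
      ≤ 2 * (2 * (h * (√(S.p n : ℝ) * S.ρ n)) + 4 / S.φ n * (g * (S.p n * S.τ n) *
          (S.w n ^ 2 / n + S.lam C n * √(2 * S.p n : ℝ)))) ^ 2 +
          2 * (h * (√(S.p n : ℝ) * S.ρ n)) ^ 2 := hdet
    _ ≤ 2 * (2 * (h * (√(S.p n : ℝ) * S.ρ n)) + 4 * g * K * (√(S.p n : ℝ) * S.ρ n)) ^ 2 +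
          2 * (h * (√(S.p n : ℝ) * S.ρ n)) ^ 2 := by gcongr
    _ = (2 * (2 * h + 4 * g * K) ^ 2 + 2 * h ^ 2) * (√(S.p n : ℝ) ^ 2 * S.ρ n ^ 2) := by ring
    _ = _ := by rw [Real.sq_sqrt (by positivity)]

variable [MeasurableSpace Ω] {P : Measure Ω}

theorem IsModel.measure_lt_noiseNorm_le (hS : S.Admissible) (hn : 0 < n) (hT : T.IsModel C P)
    {A η : ℝ} (hA : 0 < A) (hη : 0 < η) (hmoment : ∀ k, ∫⁻ e, ENNReal.ofReal (noiseTerm n (S.w n)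
        (privatizedDesign S n e) (privatizedResponse S n e) (S.θext n) k ^ 2)
        ∂Measure.pi (entryLaw S n) ≤ ENNReal.ofReal (A * S.ρ n ^ 2)) :
    P {ω | √(2 * A / η) * (√(S.p n : ℝ) * S.ρ n) < T.noiseNorm ω} ≤ ENNReal.ofReal η := by
  have hp := hS.p_pos n
  have hρ := hS.ρ_pos hn
  have hsum := lintegral_ofReal_sum_le (fun k => (measurable_noiseTerm_privatized k).pow_const 2)
    (fun _ _ => sq_nonneg _) hmoment
  have hmarkov := measure_lt_comp_le hT.hasLaw_entryFun
    (Finset.measurable_sum _ fun k _ => (measurable_noiseTerm_privatized k).pow_const 2)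
    (t := (√(2 * A / η) * (√(S.p n : ℝ) * S.ρ n)) ^ 2) (by positivity) hsum
  convert hmarkov using 2
  · ext ω
    rw [Set.mem_ofPred_eq, Set.mem_ofPred_eq, noiseNorm, Real.lt_sqrt (by positivity),
      T.Xstar_eq, T.ystar_eq]
  · rw [card_columns, mul_pow, mul_pow, Real.sq_sqrt (by positivity),
      Real.sq_sqrt (by positivity)]
    field_simp

theorem IsModel.measure_lt_gramErrorNorm_le (hS : S.Admissible) (hT : T.IsModel C P)
    {A η : ℝ} (hA : 0 < A) (hη : 0 < η) (hmoment : ∀ k l, ∫⁻ e, ENNReal.ofReal (gramError n (S.w n)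
        (privatizedDesign S n e) k l ^ 2) ∂Measure.pi (entryLaw S n) ≤
          ENNReal.ofReal (A * S.τ n ^ 2)) :
    P {ω | √(4 * A / η) * (S.p n * S.τ n) < T.gramErrorNorm ω} ≤ ENNReal.ofReal η := by
  have hp := hS.p_pos n
  have hτ := hS.τ_pos n
  have hmeas (k l) := (measurable_gramError_privatizedDesign (S := S) (n := n) k l).pow_const 2
  have hsum := lintegral_ofReal_sum_le (fun k => Finset.measurable_sum _ fun l _ => hmeas k l)
    (fun _ _ => Finset.sum_nonneg fun _ _ => sq_nonneg _)
    fun k => lintegral_ofReal_sum_le (hmeas k) (fun _ _ => sq_nonneg _) (hmoment k)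
  have hmarkov := measure_lt_comp_le hT.hasLaw_entryFun
    (Finset.measurable_sum _ fun k _ => Finset.measurable_sum _ fun l _ => hmeas k l)
    (t := (√(4 * A / η) * (S.p n * S.τ n)) ^ 2) (by positivity) hsum
  convert hmarkov using 2
  · ext ω
    rw [Set.mem_ofPred_eq, Set.mem_ofPred_eq, gramErrorNorm, Real.lt_sqrt (by positivity),
      T.Xstar_eq]
  · rw [card_columns, mul_pow, mul_pow, Real.sq_sqrt (by positivity)]
    field_simp
    norm_num

end Sample

theorem Setting.WeakDebiasing.debiasedError_tight (hS : S.Admissible) (hC : 0 < C)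
    (hd : S.WeakDebiasing C) (hc : 0 < c) (hs : ∀ᶠ n in atTop, c * S.p n ≤ S.s₀ n)
    {Ω : ℕ → Type*} [∀ n, MeasurableSpace (Ω n)] {P : ∀ n, Measure (Ω n)}
    {T : ∀ n, Sample S n (Ω n)} (hT : ∀ n, (T n).IsModel C (P n)) {η : ℝ} (hη : 0 < η) :
    ∃ K : ℝ, 0 < K ∧ ∀ᶠ n in atTop,
      P n {ω | K * (S.p n * S.ρ n ^ 2) < ∑ k, (T n).debiasedError ω k ^ 2} ≤ ENNReal.ofReal η := by
  obtain ⟨Kb, hKb, hbias⟩ := hd.eventually_bias_le hS hC hc hs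
  obtain ⟨Kw, hKw, hw⟩ := hd.eventually_w_pow_four_le hS hC
  have h4 := gaussFourth_nonneg
  have hσ := hS.σ_pos
  have hb : 0 < S.b := zero_lt_one.trans_le hS.one_le_b
  set A := 2 * S.σ ^ 2 + 4 * gaussFourth * S.b ^ 2 * (S.σ ^ 2 + 2) * (1 + Kw)
  set h := √(2 * A / (η / 2))
  set g := √(4 * (2 * S.b ^ 4 * (gaussFourth + 1)) / (η / 2))
  have : 0 < h := by positivity
  have hg : 0 < g := by positivity
  refine ⟨2 * (2 * h + 4 * g * Kb) ^ 2 + 2 * h ^ 2, by positivity, ?_⟩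
  filter_upwards [hbias, hd.eventually_p_mul_τ_le hS hC hc hs (η := 1 / (2 * g)) (by positivity),
    hw, eventually_gt_atTop 0] with n hbias hτ hw hn
  have hsmall : g * (S.p n * S.τ n) ≤ S.φ n / 2 := by
    calc g * (S.p n * S.τ n) ≤ g * (1 / (2 * g) * S.φ n) := by gcongr
      _ = S.φ n / 2 := by field_simp
  calc P n {ω | _ < ∑ k, (T n).debiasedError ω k ^ 2}
      ≤ P n ({ω | h * (√(S.p n : ℝ) * S.ρ n) < (T n).noiseNorm ω} ∪
          {ω | g * (S.p n * S.τ n) < (T n).gramErrorNorm ω}) := by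
        refine measure_mono_ae ?_
        filter_upwards [(hT n).θhat_lasso] with ω hlasso hω
        by_contra hgood
        obtain ⟨hnoise, hgram⟩ := not_or.1 hgood
        exact (Sample.sum_sq_debiasedError_le hS hC hn hlasso hg.le (not_lt.1 hgram)
          (not_lt.1 hnoise) hsmall hbias).not_gt hω
    _ ≤ ENNReal.ofReal (η / 2) + ENNReal.ofReal (η / 2) :=
        (measure_union_le _ _).trans (add_le_add
          ((hT n).measure_lt_noiseNorm_le hS hn (by positivity) (half_pos hη)
            (hS.lintegral_sq_noiseTerm_le_ρ hn hw))
          ((hT n).measure_lt_gramErrorNorm_le hS (by positivity) (half_pos hη)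
            (hS.lintegral_sq_gramError_le_τ hn)))
    _ = ENNReal.ofReal η := by
        rw [← ENNReal.ofReal_add (by positivity) (by positivity), add_halves]

end Tightness

/-! ### Separation of signals and nulls -/

namespace IsFeatureFunction

variable {f : ℝ → ℝ → ℝ}

theorem exists_abs_sub_le (hf : IsFeatureFunction f) :
    ∃ L : ℝ, 0 < L ∧ ∀ a u v, |f u a - f v a| ≤ L * |u - v| := by
  obtain ⟨L, hL, hlip⟩ := hf.lipschitz
  exact ⟨L, hL, fun a u v => by simpa [Real.dist_eq] using (hlip a).dist_le_mul u v⟩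

theorem mul_apply_div (hf : IsFeatureFunction f) {a : ℝ} (ha : 0 < a) (u : ℝ) :
    a * f (u / a) 1 = f u a := by
  rw [hf.homogeneous a _ _ ha, mul_one, mul_div_cancel₀ _ ha.ne']

theorem exists_mul_abs_le (hf : IsFeatureFunction f) :
    ∃ c x₀ : ℝ, 0 < c ∧ ∀ a u, 0 < a → x₀ * a ≤ |u| → c * |u| ≤ f u a := by
  obtain ⟨c, x₀, hc, -, hgrow⟩ := hf.linear_growth 1
  have f_abs (u a : ℝ) : f |u| a = f u a := by
    rcases abs_choice u with h | h
    · rw [h]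
    · rw [h, ← hf.even]
  refine ⟨c, x₀, hc, fun a u ha hu => ?_⟩
  calc c * |u| = a * (c * (|u| / a)) := by field_simp
    _ ≤ a * f (|u| / a) 1 := by gcongr; exact hgrow _ ((le_div_iff₀ ha).2 hu)
    _ = f u a := by rw [hf.mul_apply_div ha, f_abs]

variable {ι : Type*} {l : Filter ι} {a μ t : ι → ℝ}

theorem eventually_abs_sub_lt (hf : IsFeatureFunction f) (ha : ∀ᶠ i in l, 0 < a i)
    (ht : Tendsto (fun i => t i / a i) l atTop) (m : ℝ) :
    ∀ᶠ i in l, ∀ u v, |u| ≤ m * a i → |v| ≤ m * a i → |f u (a i) - f v (a i)| < t i := by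
  obtain ⟨L, hL, hlip⟩ := hf.exists_abs_sub_le
  filter_upwards [ha, ht.eventually_gt_atTop (L * (2 * m))] with i ha ht u v hu hv
  rw [lt_div_iff₀ ha] at ht
  calc |f u (a i) - f v (a i)| ≤ L * |u - v| := hlip _ _ _
    _ ≤ L * (|u| + |v|) := by gcongr; exact abs_sub u v
    _ ≤ L * (m * a i + m * a i) := by gcongr
    _ < t i := by linarith

theorem eventually_le_sub (hf : IsFeatureFunction f) (ha : ∀ᶠ i in l, 0 < a i)
    (hμ : Tendsto (fun i => μ i / a i) l atTop) (htμ : Tendsto (fun i => t i / μ i) l (𝓝 0))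
    (m : ℝ) :
    ∀ᶠ i in l, ∀ u v θ, |u - θ| ≤ m * a i → |v| ≤ m * a i → μ i ≤ |θ| →
      t i ≤ f u (a i) - f v (a i) := by
  obtain ⟨L, hL, hlip⟩ := hf.exists_abs_sub_le
  obtain ⟨c, x₀, hc, hgrow⟩ := hf.exists_mul_abs_le
  filter_upwards [ha, hμ.eventually_gt_atTop 0, hμ.eventually_ge_atTop (x₀ + m),
    hμ.eventually_ge_atTop (2 / c * (c * m + f 0 1 + L * m)),
    htμ.eventually (gt_mem_nhds (half_pos hc))] with i ha hμ0 hx₀ hlarge ht u v θ hu hv hθ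
  have hμ0 : 0 < μ i := (div_pos_iff_of_pos_right ha).1 hμ0
  rw [le_div_iff₀ ha] at hx₀ hlarge
  rw [div_lt_iff₀ hμ0] at ht
  have hu' : μ i - m * a i ≤ |u| := by
    have := abs_sub_abs_le_abs_sub θ u
    rw [abs_sub_comm] at this
    linarith
  have hfu : c * (μ i - m * a i) ≤ f u (a i) :=
    (mul_le_mul_of_nonneg_left hu' hc.le).trans (hgrow _ _ ha (by linarith))
  have hfv : f v (a i) ≤ f 0 1 * a i + L * (m * a i) := by
    have h0 : a i * f 0 1 = f 0 (a i) := by simpa using hf.mul_apply_div ha 0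
    have hv0 : |f v (a i) - f 0 (a i)| ≤ L * (m * a i) := by
      simpa using (hlip (a i) v 0).trans (by rw [sub_zero]; gcongr)
    linarith [le_abs_self (f v (a i) - f 0 (a i))]
  have hsmall : (c * m + f 0 1 + L * m) * a i ≤ c / 2 * μ i := by
    calc _ = c / 2 * (2 / c * (c * m + f 0 1 + L * m) * a i) := by field_simp
      _ ≤ c / 2 * μ i := by gcongr
  linarith

end IsFeatureFunction

/-- All but at most `β p` of the statistics `W` are below `t` in absolute value at null features
and at least `t` at the features in the support. -/
def Separates {p : ℕ} (θ₀ W : Fin p → ℝ) (t β : ℝ) : Prop :=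
  ∃ E : Finset (Fin p), (E.card : ℝ) ≤ β * p ∧
    ∀ j ∉ E, (θ₀ j = 0 → |W j| < t) ∧ (θ₀ j ≠ 0 → t ≤ W j)

section Separates

variable {p : ℕ} {θ₀ W : Fin p → ℝ} {t β c q : ℝ}

theorem separates_of_sum_sq_le {e : Fin p ⊕ Fin p → ℝ} {m : ℝ} (hm : 0 < m)
    (he : ∑ k, e k ^ 2 ≤ β * p * m ^ 2)
    (hW : ∀ j, |e (Sum.inl j)| ≤ m → |e (Sum.inr j)| ≤ m →
      (θ₀ j = 0 → |W j| < t) ∧ (θ₀ j ≠ 0 → t ≤ W j)) :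
    Separates θ₀ W t β := by
  set E := Finset.univ.filter fun j => m < |e (Sum.inl j)| ∨ m < |e (Sum.inr j)|
  refine ⟨E, le_of_mul_le_mul_right ?_ (pow_pos hm 2), fun j hj => ?_⟩
  · have hsq (x : ℝ) (hx : m < |x|) : m ^ 2 ≤ x ^ 2 := by rw [← sq_abs x]; gcongr
    calc (E.card : ℝ) * m ^ 2 = ∑ _j ∈ E, m ^ 2 := by rw [Finset.sum_const, nsmul_eq_mul]
      _ ≤ ∑ j ∈ E, (e (Sum.inl j) ^ 2 + e (Sum.inr j) ^ 2) := by
          refine Finset.sum_le_sum fun j hj => ?_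
          rcases (Finset.mem_filter.1 hj).2 with h | h
          · exact le_add_of_le_of_nonneg (hsq _ h) (sq_nonneg _)
          · exact le_add_of_nonneg_of_le (sq_nonneg _) (hsq _ h)
      _ ≤ ∑ j, (e (Sum.inl j) ^ 2 + e (Sum.inr j) ^ 2) :=
          Finset.sum_le_sum_of_subset_of_nonneg (Finset.subset_univ _) fun j _ _ => by positivity
      _ = ∑ k, e k ^ 2 := by rw [Fintype.sum_sum_type, Finset.sum_add_distrib]
      _ ≤ β * p * m ^ 2 := he
  · simp only [E, Finset.mem_filter, Finset.mem_univ, true_and, not_or, not_lt] at hj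
    exact hW j hj.1 hj.2

namespace Separates

theorem card_selected_sdiff_supp_le (h : Separates θ₀ W t β) :
    ((selected W t \ supp θ₀).card : ℝ) ≤ β * p := by
  obtain ⟨E, hE, hsep⟩ := h
  have hsub : selected W t \ supp θ₀ ⊆ E := fun j hj => by
    rw [Finset.mem_sdiff, mem_selected, WithTop.coe_le_coe, mem_supp, not_not] at hj
    by_contra hjE
    exact (hj.1.trans (le_abs_self _)).not_gt ((hsep j hjE).1 hj.2)
  exact (Nat.cast_le.2 (Finset.card_le_card hsub)).trans hE

theorem card_selected_neg_le (h : Separates θ₀ W t β) (ht : 0 < t) :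
    ((selected (-W) t).card : ℝ) ≤ β * p := by
  obtain ⟨E, hE, hsep⟩ := h
  have hsub : selected (-W) t ⊆ E := fun j hj => by
    rw [mem_selected, WithTop.coe_le_coe, Pi.neg_apply] at hj
    by_contra hjE
    by_cases h0 : θ₀ j = 0
    · exact (hj.trans (neg_le_abs _)).not_gt ((hsep j hjE).1 h0)
    · linarith [(hsep j hjE).2 h0]
  exact (Nat.cast_le.2 (Finset.card_le_card hsub)).trans hE

theorem card_supp_le (h : Separates θ₀ W t β) :
    ((supp θ₀).card : ℝ) ≤ (selected W t ∩ supp θ₀).card + β * p := by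
  obtain ⟨E, hE, hsep⟩ := h
  have hsub : supp θ₀ ⊆ (selected W t ∩ supp θ₀) ∪ E := fun j hj => by
    rw [Finset.mem_union, Finset.mem_inter, mem_selected, WithTop.coe_le_coe, or_iff_not_imp_right]
    exact fun hjE => ⟨(hsep j hjE).2 (mem_supp.1 hj), hj⟩
  calc ((supp θ₀).card : ℝ) ≤ (selected W t ∩ supp θ₀).card + E.card := by
        exact_mod_cast (Finset.card_le_card hsub).trans (Finset.card_union_le _ _)
    _ ≤ _ := by gcongr

theorem le_card_selected (h : Separates θ₀ W t β) (hc : c * p ≤ (supp θ₀).card) :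
    (c - β) * p ≤ (selected W t).card := by
  have hinter : ((selected W t ∩ supp θ₀).card : ℝ) ≤ (selected W t).card := by
    exact_mod_cast Finset.card_le_card Finset.inter_subset_left
  linarith [h.card_supp_le]

theorem fdp_le (h : Separates θ₀ W t β) (hp : 0 < p) (hβ : 0 ≤ β) (hβc : β < c)
    (hc : c * p ≤ (supp θ₀).card) : FDP θ₀ W t ≤ β / (c - β) := by
  have hd : 0 < c - β := sub_pos.2 hβc
  calc FDP θ₀ W t ≤ β * p / ((c - β) * p) := by
        unfold FDP
        gcongr
        · exact h.card_selected_sdiff_supp_le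
        · exact (h.le_card_selected hc).trans (le_max_right _ _)
    _ = β / (c - β) := by field_simp

theorem fdpHat_le (h : Separates θ₀ W t β) (ht : 0 < t) (hp : 0 < p) (hβ : 0 ≤ β) (hβc : β < c)
    (hc : c * p ≤ (supp θ₀).card) : fdpHat W t ≤ (1 / p + β) / (c - β) := by
  have hd : 0 < c - β := sub_pos.2 hβc
  calc fdpHat W t ≤ (1 + β * p) / ((c - β) * p) := by
        rw [fdpHat_eq_card_selected]
        gcongr
        · exact h.card_selected_neg_le ht
        · exact (h.le_card_selected hc).trans (le_max_right _ _)
    _ = (1 / p + β) / (c - β) := by field_simp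

theorem one_sub_le_power (h : Separates θ₀ W t β) (hp : 0 < p) (hβ : 0 ≤ β) (hc₀ : 0 < c)
    (hc : c * p ≤ (supp θ₀).card) : 1 - β / c ≤ power θ₀ W t := by
  have hs : (0 : ℝ) < (supp θ₀).card := lt_of_lt_of_le (by positivity) hc
  have hβs : β * p ≤ β / c * (supp θ₀).card := by
    calc β * p = β / c * (c * p) := by field_simp
      _ ≤ β / c * (supp θ₀).card := by gcongr
  rw [power, le_div_iff₀ hs]
  linarith [h.card_supp_le]

end Separates

theorem power_le_one (θ₀ W : Fin p → ℝ) (t : WithTop ℝ) : power θ₀ W t ≤ 1 :=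
  div_le_one_of_le₀ (by exact_mod_cast Finset.card_le_card Finset.inter_subset_right)
    (by positivity)

theorem power_mono (θ₀ : Fin p → ℝ) {t t' : WithTop ℝ} (h : selected W t ⊆ selected W t') :
    power θ₀ W t ≤ power θ₀ W t' := by
  unfold power
  gcongr

/-- The least `|W k| ≥ t` selects the same features as `t`, also for `-W`, and is a candidate in
the definition of `knockoffThreshold`. -/
theorem selected_subset_selected_knockoffThreshold (ht : 0 < t) (hq : fdpHat W t ≤ q) :
    selected W t ⊆ selected W (knockoffThreshold q W) := by
  intro j hj
  rw [mem_selected, WithTop.coe_le_coe] at hj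
  obtain ⟨k, hk, hmin⟩ := (Finset.univ.filter fun i => t ≤ |W i|).exists_min_image
    (fun i => |W i|) ⟨j, by simpa using hj.trans (le_abs_self _)⟩
  simp only [Finset.mem_filter, Finset.mem_univ, true_and] at hk hmin
  have hpos (i : Fin p) : |W k| ≤ W i ↔ t ≤ W i :=
    ⟨hk.trans, fun h => abs_of_pos (ht.trans_le h) ▸ hmin i (h.trans (le_abs_self _))⟩
  have hneg (i : Fin p) : |W k| ≤ -W i ↔ t ≤ -W i :=
    ⟨hk.trans, fun h => by
      have hi := hmin i (h.trans (neg_le_abs _))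
      rwa [abs_of_neg (neg_pos.1 (ht.trans_le h))] at hi⟩
  have hsel : selected W (|W k| : ℝ) = selected W t := by
    ext i; simp only [mem_selected, WithTop.coe_le_coe, hpos]
  have hsel_neg : selected (-W) (|W k| : ℝ) = selected (-W) t := by
    ext i; simp only [mem_selected, WithTop.coe_le_coe, Pi.neg_apply, hneg]
  rw [mem_selected, knockoffThreshold_le_coe_iff]
  refine ⟨k, abs_pos.1 (ht.trans_le hk), ?_, (hpos j).2 hj⟩
  rwa [fdpHat_eq_card_selected, hsel, hsel_neg, ← fdpHat_eq_card_selected]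

end Separates

/-! ### Asymptotic false discovery proportion and power -/

section SeparatesInProb

variable {Ω : ℕ → Type*} [∀ n, MeasurableSpace (Ω n)] {p : ℕ → ℕ}

/-- With probability tending to one, the threshold `t n` separates signals from nulls up to an
arbitrarily small fraction of the features. -/
def SeparatesInProb (P : ∀ n, Measure (Ω n)) (θ₀ : ∀ n, Fin (p n) → ℝ)
    (W : ∀ n, Ω n → Fin (p n) → ℝ) (t : ℕ → ℝ) : Prop :=
  ∀ β : ℝ, 0 < β → Tendsto (fun n => P n {ω | ¬ Separates (θ₀ n) (W n ω) (t n) β}) atTop (𝓝 0)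

variable {P : ∀ n, Measure (Ω n)} {θ₀ : ∀ n, Fin (p n) → ℝ} {W : ∀ n, Ω n → Fin (p n) → ℝ}
  {t : ℕ → ℝ} {c : ℝ}

namespace SeparatesInProb

theorem tendstoInProb (h : SeparatesInProb P θ₀ W t) {Y : ∀ n, Ω n → ℝ} {y : ℝ}
    (hY : ∀ η : ℝ, 0 < η → ∃ β : ℝ, 0 < β ∧
      ∀ᶠ n in atTop, ∀ ω, Separates (θ₀ n) (W n ω) (t n) β → |Y n ω - y| < η) :
    TendstoInProb P Y y := by
  intro η hη
  obtain ⟨β, hβ, hclose⟩ := hY η hη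
  refine tendsto_of_tendsto_of_tendsto_of_le_of_le' tendsto_const_nhds (h β hβ)
    (Eventually.of_forall fun _ => zero_le)
    (hclose.mono fun n hn => measure_mono fun ω hω hsep => ?_)
  exact (hn ω hsep).not_ge hω

theorem tendstoInProb_fdp (h : SeparatesInProb P θ₀ W t) (hp : ∀ᶠ n in atTop, 0 < p n)
    (hc : 0 < c) (hs : ∀ᶠ n in atTop, c * p n ≤ (supp (θ₀ n)).card) :
    TendstoInProb P (fun n ω => FDP (θ₀ n) (W n ω) (t n)) 0 := by
  refine h.tendstoInProb fun η hη => ?_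
  obtain ⟨β, hβ, hβη⟩ : ∃ β : ℝ, 0 < β ∧ β < c * η / (1 + η) := exists_between (by positivity)
  rw [lt_div_iff₀ (by positivity)] at hβη
  have hβc : β < c := by nlinarith
  refine ⟨β, hβ, ?_⟩
  filter_upwards [hp, hs] with n hp hs ω hsep
  rw [sub_zero, abs_of_nonneg (fdp_nonneg _ _ _)]
  refine (hsep.fdp_le hp hβ.le hβc hs).trans_lt ?_
  rw [div_lt_iff₀ (sub_pos.2 hβc)]
  linarith

theorem tendstoInProb_power (h : SeparatesInProb P θ₀ W t) (hp : ∀ᶠ n in atTop, 0 < p n)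
    (hc : 0 < c) (hs : ∀ᶠ n in atTop, c * p n ≤ (supp (θ₀ n)).card) :
    TendstoInProb P (fun n ω => power (θ₀ n) (W n ω) (t n)) 1 := by
  refine h.tendstoInProb fun η hη => ⟨c * η / 2, by positivity, ?_⟩
  filter_upwards [hp, hs] with n hp hs ω hsep
  have hpower := hsep.one_sub_le_power hp (by positivity) hc hs
  have hhalf : c * η / 2 / c = η / 2 := by field_simp
  rw [abs_of_nonpos (sub_nonpos.2 (power_le_one _ _ _))]
  linarith

theorem tendstoInProb_power_knockoffThreshold (h : SeparatesInProb P θ₀ W t)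
    (ht : ∀ᶠ n in atTop, 0 < t n) (hp : Tendsto p atTop atTop) (hc : 0 < c)
    (hs : ∀ᶠ n in atTop, c * p n ≤ (supp (θ₀ n)).card) {q : ℝ} (hq : 0 < q) :
    TendstoInProb P (fun n ω => power (θ₀ n) (W n ω) (knockoffThreshold q (W n ω))) 1 := by
  refine h.tendstoInProb fun η hη => ?_
  obtain ⟨β, hβ, hβ_lt⟩ : ∃ β : ℝ, 0 < β ∧ β < min (c * η) (c * q / (2 + q)) :=
    exists_between (lt_min (by positivity) (by positivity))
  obtain ⟨hβη, hβq⟩ := lt_min_iff.1 hβ_lt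
  rw [lt_div_iff₀ (by positivity)] at hβq
  have hβc : β < c := by nlinarith
  have hinv : Tendsto (fun n => 1 / (p n : ℝ)) atTop (𝓝 0) :=
    tendsto_one_div_atTop_nhds_zero_nat.comp hp
  refine ⟨β, hβ, ?_⟩
  filter_upwards [ht, hp.eventually_gt_atTop 0, hs, hinv.eventually (gt_mem_nhds hβ)]
    with n ht hp hs hinv ω hsep
  have hfdpHat : fdpHat (W n ω) (t n) ≤ q := by
    refine (hsep.fdpHat_le ht hp hβ.le hβc hs).trans ?_
    rw [div_le_iff₀ (sub_pos.2 hβc)]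
    linarith
  have hpower := (hsep.one_sub_le_power hp hβ.le hc hs).trans
    (power_mono (θ₀ n) (selected_subset_selected_knockoffThreshold ht hfdpHat))
  have hβη' : β / c < η := by rwa [div_lt_iff₀' hc]
  rw [abs_of_nonpos (sub_nonpos.2 (power_le_one _ _ _))]
  linarith

end SeparatesInProb

theorem tendsto_zero_of_forall_eventually_le_ofReal {ι : Type*} {l : Filter ι}
    {u : ι → ENNReal} (h : ∀ η : ℝ, 0 < η → ∀ᶠ i in l, u i ≤ ENNReal.ofReal η) :
    Tendsto u l (𝓝 0) := by
  refine ENNReal.tendsto_nhds_zero.2 fun η hη => ?_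
  obtain rfl | htop := eq_or_ne η ⊤
  · exact Eventually.of_forall fun _ => le_top
  · simpa only [ENNReal.ofReal_toReal htop] using h η.toReal (ENNReal.toReal_pos hη.ne' htop)

theorem Setting.WeakDebiasing.separatesInProb {S : Setting} {C : ℝ} (hS : S.Admissible)
    (hC : 0 < C) (hd : S.WeakDebiasing C) {T : ∀ n, Sample S n (Ω n)}
    (hT : ∀ n, (T n).IsModel C (P n)) (hc : 0 < c) (hs : ∀ᶠ n in atTop, c * S.p n ≤ S.s₀ n)
    {f : ℝ → ℝ → ℝ} (hf : IsFeatureFunction f) {μ : ℕ → ℝ}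
    (hμθ : ∀ n j, S.θ₀ n j ≠ 0 → μ n ≤ |S.θ₀ n j|)
    (hμ : Tendsto (fun n => μ n / (S.σ * S.ρ n)) atTop atTop)
    (ht : Tendsto (fun n => t n / (S.σ * S.ρ n)) atTop atTop)
    (htμ : Tendsto (fun n => t n / μ n) atTop (𝓝 0)) :
    SeparatesInProb P S.θ₀ (fun n => (T n).W f) t := by
  refine fun β hβ => tendsto_zero_of_forall_eventually_le_ofReal fun η hη => ?_
  obtain ⟨K, hK, htight⟩ := hd.debiasedError_tight hS hC hc hs hT hη
  have hσ := hS.σ_pos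
  set m := √(K / (β * S.σ ^ 2)) with hm
  have hm0 : 0 < m := Real.sqrt_pos.2 (by positivity)
  have ha : ∀ᶠ n in atTop, 0 < S.σ * S.ρ n :=
    (eventually_gt_atTop 0).mono fun n hn => mul_pos hσ (hS.ρ_pos hn)
  filter_upwards [htight, ha, hf.eventually_abs_sub_lt ha ht m,
    hf.eventually_le_sub ha hμ htμ m] with n htight ha hnull hsignal
  have hK_eq : K * (S.p n * S.ρ n ^ 2) = β * S.p n * (m * (S.σ * S.ρ n)) ^ 2 := by
    rw [mul_pow, hm, Real.sq_sqrt (by positivity)]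
    field_simp
  refine (measure_mono fun ω hω => ?_).trans htight
  by_contra hsmall
  refine hω (separates_of_sum_sq_le (mul_pos hm0 ha) ((not_lt.1 hsmall).trans hK_eq.le)
    fun j hu hv => ?_)
  have hv' : |debiased n (S.w n) ((T n).Xstar ω) ((T n).ystar ω) ((T n).θhat ω) (Sum.inr j)| ≤
      m * (S.σ * S.ρ n) := by
    simpa [Sample.debiasedError, Setting.θext] using hv
  refine ⟨fun h0 => hnull _ _ ?_ hv', fun h0 => hsignal _ _ _ hu hv' (hμθ n j h0)⟩
  simpa [Sample.debiasedError, Setting.θext, h0] using hu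

end SeparatesInProb

theorem exists_tendsto_div_atTop_and_tendsto_div_zero {ι : Type*} {l : Filter ι} {a μ : ι → ℝ}
    (ha : ∀ᶠ i in l, 0 < a i) (hμ : Tendsto (fun i => μ i / a i) l atTop) :
    ∃ t : ι → ℝ, Tendsto (fun i => t i / a i) l atTop ∧ Tendsto (fun i => t i / μ i) l (𝓝 0) := by
  have hsqrt := Real.tendsto_sqrt_atTop.comp hμ
  refine ⟨fun i => a i * √(μ i / a i), hsqrt.congr' ?_,
    (tendsto_inv_atTop_zero.comp hsqrt).congr' ?_⟩ <;> filter_upwards [ha] with i ha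
  · simp only [Function.comp_apply, mul_div_cancel_left₀ _ ha.ne']
  · calc (√(μ i / a i))⁻¹ = √(μ i / a i) / (μ i / a i) := by rw [Real.sqrt_div_self', one_div]
      _ = a i * √(μ i / a i) / μ i := by rw [div_div_eq_mul_div, mul_comm]

theorem eventually_half_mul_le_of_tendsto_div {ι : Type*} {l : Filter ι} {s p : ι → ℝ} {c : ℝ}
    (hp : ∀ i, 0 < p i) (hc : 0 < c) (h : Tendsto (fun i => s i / p i) l (𝓝 c)) :
    ∀ᶠ i in l, c / 2 * p i ≤ s i :=
  (h.eventually_const_le (half_lt_self hc)).mono fun i hi => (le_div_iff₀ (hp i)).1 hi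

end JLKnockoff

end

theorem mainTheorem4_general {S : JLKnockoff.Setting} (hS : S.Admissible)
    (hp : Tendsto S.p atTop atTop) {C : ℝ} (hC : 0 < C) (hd : S.WeakDebiasing C)
    {f : ℝ → ℝ → ℝ} (hf : JLKnockoff.IsFeatureFunction f)
    {c : ℝ} (hc : 0 < c) (hs : ∀ᶠ n in atTop, c * S.p n ≤ S.s₀ n)
    {μ : ℕ → ℝ} (hμθ : ∀ n j, S.θ₀ n j ≠ 0 → μ n ≤ |S.θ₀ n j|)
    (hμ : Tendsto (fun n => μ n / (S.σ * S.ρ n)) atTop atTop)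
    {Ω : ℕ → Type*} [∀ n, MeasurableSpace (Ω n)] {P : ∀ n, Measure (Ω n)}
    [∀ n, IsProbabilityMeasure (P n)] {T : ∀ n, JLKnockoff.Sample S n (Ω n)}
    (hT : ∀ n, (T n).IsModel C (P n)) :
    (∀ q : ℝ, 0 < q →
      (∀ n, 1 ≤ n →
        Integrable (fun ω => JLKnockoff.FDP (S.θ₀ n) ((T n).W f ω)
          (JLKnockoff.knockoffThreshold q ((T n).W f ω))) (P n) ∧
        ∫ ω, JLKnockoff.FDP (S.θ₀ n) ((T n).W f ω)
          (JLKnockoff.knockoffThreshold q ((T n).W f ω)) ∂(P n) ≤ q) ∧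
      JLKnockoff.TendstoInProb P (fun n ω => JLKnockoff.power (S.θ₀ n) ((T n).W f ω)
        (JLKnockoff.knockoffThreshold q ((T n).W f ω))) 1) ∧
    (∀ t : ℕ → ℝ,
      Tendsto (fun n => t n / (S.σ * S.ρ n)) atTop atTop →
      Tendsto (fun n => t n / μ n) atTop (𝓝 0) →
      JLKnockoff.TendstoInProb P
        (fun n ω => JLKnockoff.FDP (S.θ₀ n) ((T n).W f ω) (t n : WithTop ℝ)) 0 ∧
      JLKnockoff.TendstoInProb P
        (fun n ω => JLKnockoff.power (S.θ₀ n) ((T n).W f ω) (t n : WithTop ℝ)) 1) := by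
  have hp_pos : ∀ᶠ n in atTop, 0 < S.p n := hp.eventually_gt_atTop 0
  have ha : ∀ᶠ n in atTop, 0 < S.σ * S.ρ n :=
    (eventually_gt_atTop 0).mono fun n hn => mul_pos hS.σ_pos (hS.ρ_pos hn)
  refine ⟨fun q hq => ⟨fun n hn =>
    ⟨JLKnockoff.integrable_fdp_knockoffThreshold q _ ((hT n).aemeasurable_W hf),
      (hT n).integral_fdp_le hS hC hn hf hq.le⟩, ?_⟩, fun t ht htμ => ?_⟩
  · obtain ⟨t, ht, htμ⟩ := JLKnockoff.exists_tendsto_div_atTop_and_tendsto_div_zero ha hμ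
    have ht_pos : ∀ᶠ n in atTop, 0 < t n := by
      filter_upwards [ha, ht.eventually_gt_atTop 0] with n ha ht
      exact (div_pos_iff_of_pos_right ha).1 ht
    exact (hd.separatesInProb hS hC hT hc hs hf hμθ hμ ht htμ).tendstoInProb_power_knockoffThreshold
      ht_pos hp hc hs hq
  · have hsep := hd.separatesInProb hS hC hT hc hs hf hμθ hμ ht htμ
    exact ⟨hsep.tendstoInProb_fdp hp_pos hc hs, hsep.tendstoInProb_power hp_pos hc hs⟩

theorem mainTheorem4 :
    ∃ C : ℝ, 0 < C ∧
      ∀ (S : JLKnockoff.Setting) (f : ℝ → ℝ → ℝ) (c₀ : ℝ) (μ : ℕ → ℝ)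
        (Ω : ℕ → Type*) [∀ n, MeasurableSpace (Ω n)] (P : ∀ n, Measure (Ω n))
        [∀ n, IsProbabilityMeasure (P n)] (T : ∀ n, JLKnockoff.Sample S n (Ω n)),
        S.Standing → S.Debiasing C → JLKnockoff.IsFeatureFunction f →
        0 < c₀ → c₀ < 1 →
        Tendsto (fun n => (S.s₀ n : ℝ) / (S.p n : ℝ)) atTop (𝓝 c₀) →
        (∀ n, 0 < μ n) →
        (∀ n j, S.θ₀ n j ≠ 0 → μ n ≤ |S.θ₀ n j|) →
        Tendsto (fun n => μ n / (S.σ * S.ρ n)) atTop atTop →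
        (∀ n, (T n).IsModel C (P n)) →
        (∀ q : ℝ, 0 < q → q < 1 →
          (∀ n, 1 ≤ n →
            Integrable (fun ω => JLKnockoff.FDP (S.θ₀ n) ((T n).W f ω)
              (JLKnockoff.knockoffThreshold q ((T n).W f ω))) (P n) ∧
            ∫ ω, JLKnockoff.FDP (S.θ₀ n) ((T n).W f ω)
              (JLKnockoff.knockoffThreshold q ((T n).W f ω)) ∂(P n) ≤ q) ∧
          JLKnockoff.TendstoInProb P (fun n ω => JLKnockoff.power (S.θ₀ n) ((T n).W f ω)
            (JLKnockoff.knockoffThreshold q ((T n).W f ω))) 1) ∧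
        (∀ t : ℕ → ℝ,
          Tendsto (fun n => t n / (S.σ * S.ρ n)) atTop atTop →
          Tendsto (fun n => t n / μ n) atTop (𝓝 0) →
          JLKnockoff.TendstoInProb P
            (fun n ω => JLKnockoff.FDP (S.θ₀ n) ((T n).W f ω) (t n : WithTop ℝ)) 0 ∧
          JLKnockoff.TendstoInProb P
            (fun n ω => JLKnockoff.power (S.θ₀ n) ((T n).W f ω) (t n : WithTop ℝ)) 1) := by
  refine ⟨1, one_pos, fun S f c₀ μ Ω _ P _ T hS hd hf hc₀ _ hlim _ hμθ hμ hT => ?_⟩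
  have hs := JLKnockoff.eventually_half_mul_le_of_tendsto_div
    (fun n => Nat.cast_pos.2 (hS.admissible.p_pos n)) hc₀ hlim
  obtain ⟨hthreshold, hsequence⟩ := mainTheorem4_general hS.admissible hS.p_tendsto one_pos
    (hd.weakDebiasing hS.admissible hS.p_tendsto) hf (half_pos hc₀) hs hμθ hμ hT
  exact ⟨fun q hq _ => hthreshold q hq, hsequence⟩
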